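/- Let $k$ be a field, $q\in k$ nonzero, $1\le m\le n$ integers and $1\le a\le n$. Let $\mathcal O_q(M_{m,n})$ be the $k$-algebra generated by $x_{ij}$ ($1\le i\le m$, $1\le j\le n$) subject to $x_{ij}x_{il}=q\,x_{il}x_{ij}$ for $j<l$; $x_{ij}x_{sj}=q\,x_{sj}x_{ij}$ for $i<s$; $x_{ij}x_{sl}=x_{sl}x_{ij}$ for $s<i$, $j<l$; and $x_{ij}x_{sl}-x_{sl}x_{ij}=(q-q^{-1})x_{il}x_{sj}$ for $i<s$, $j<l$ (so $\mathcal O_q(M_{m,0})=k$). For $I=\{i_1<\dots<i_t\}$ and $J=\{j_1<\dots<j_t\}$ let $$[I|J]=\sum_{\sigma\in\mathfrak S_t}(-q)^{\ell(\sigma)}x_{i_{\sigma(1)}j_1}\cdots x_{i_{\sigma(t)}j_t}$$ be the quantum minor, where $\ell(\sigma)$ is the number of inversions of $\sigma$ (the empty minor is $1$). For an $m$-element subset $K\subseteq\{1,\dots,n\}$ write $[K]=[\{1,\dots,m\}|K]\in\mathcal O_q(M_{m,n})$. The quantum grassmannian $\mathcal O_q(G(m,n))$ is the subalgebra of $\mathcal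 O_q(M_{m,n})$ generated by all the $[K]$, with the $\mathbb N$-grading in which each $[K]$ has degree one. For an integer $c$ let $\widetilde c\in\{1,\dots,n\}$ be congruent to $c$ modulo $n$. Put $M=\{\widetilde a,\widetilde{a+1},\dots,\widetilde{a+m-1}\}$, and for $I\subseteq\{1,\dots,m\}$, $J\subseteq\{1,\dots,n-m\}$ with $|I|=|J|$ put $$Q(I,J)=\{\widetilde{j+a+m-1} : j\in J\}\ \sqcup\ \bigl(M\setminus\{\widetilde{a+m-i} : i\in I\}\bigr).$$ Then $[M]$ is a normal nonzero divisor of $\mathcal O_q(G(m,n))$. Let $\mathrm{Dhom}(\mathcal O_q(G(m,n)),[M])$ be the dehomogenisation at $[M]$, that is, the degree zero part of the $\mathbb Z$-graded Ore localisation of $\mathcal O_q(G(m,n))$ at the powers of $[M]$. There is a $k$-algebra isomorphism $$\rho:\mathcal O_q(M_{m,n-m})\longrightarrow \mathrm{Dhom}(\mathcal O_q(G(m,n)),[M])$$ with $\rho(x_{ij})=[Q(\{i\},\{j\})][M]^{-1}$ for all $1\le i\le m$, $1\le j\le n-m$ (it is determined by these values), and $$\rho([I|J])=[Q(I,J)]\,[M]^{-1}$$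 for all $I\subseteq\{1,\dots,m\}$ and $J\subseteq\{1,\dots,n-m\}$ with $|I|=|J|$. -/

import Mathlib

noncomputable section

namespace QuantumGrassmannian

open scoped Polynomial

/-! ### Quantum matrices and quantum minors

Rows and columns are indexed by `Fin m`, `Fin n`, that is, from `0` instead of from `1`. -/

section QuantumMatrices

variable (k : Type*) [Field k] (q : k) (m n : ℕ)

/-- The free generator in row `i` and column `j`. -/
abbrev freeGen (i : Fin m) (j : Fin n) : FreeAlgebra k (Fin m × Fin n) :=
  FreeAlgebra.ι k (i, j)

/-- The defining relations of the algebra of quantum `m × n` matrices. -/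
inductive QMatRel : FreeAlgebra k (Fin m × Fin n) → FreeAlgebra k (Fin m × Fin n) → Prop
  | row (i : Fin m) (j l : Fin n) (h : j < l) :
      QMatRel (freeGen k m n i j * freeGen k m n i l)
        (q • (freeGen k m n i l * freeGen k m n i j))
  | col (i s : Fin m) (j : Fin n) (h : i < s) :
      QMatRel (freeGen k m n i j * freeGen k m n s j)
        (q • (freeGen k m n s j * freeGen k m n i j))
  | anti (i s : Fin m) (j l : Fin n) (h : s < i) (h' : j < l) :
      QMatRel (freeGen k m n i j * freeGen k m n s l)
        (freeGen k m n s l * freeGen k m n i j)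
  | diag (i s : Fin m) (j l : Fin n) (h : i < s) (h' : j < l) :
      QMatRel (freeGen k m n i j * freeGen k m n s l - freeGen k m n s l * freeGen k m n i j)
        ((q - q⁻¹) • (freeGen k m n i l * freeGen k m n s j))

/-- The algebra `O_q(M_{m,n})` of quantum matrices. -/
abbrev QMat : Type _ := RingQuot (QMatRel k q m n)

variable {m n}

/-- The canonical generator `x_{ij}`. -/
def xGen (i : Fin m) (j : Fin n) : QMat k q m n :=
  RingQuot.mkAlgHom k (QMatRel k q m n) (freeGen k m n i j)

end QuantumMatrices

/-- The length of a permutation: its number of inversions. -/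
def invCount {t : ℕ} (σ : Equiv.Perm (Fin t)) : ℕ :=
  (Finset.univ.filter fun p : Fin t × Fin t => p.1 < p.2 ∧ σ p.2 < σ p.1).card

variable {k : Type*} [Field k] (q : k)

/-- The quantum minor `[I|J]`, where `I = {i_1 < ... < i_t}` and `J = {j_1 < ... < j_t}`:
`∑_σ (-q)^{ℓ(σ)} x_{i_{σ(1)} j_1} ⋯ x_{i_{σ(t)} j_t}`. -/
def qMinor {m n t : ℕ} (I : Finset (Fin m)) (J : Finset (Fin n)) (hI : I.card = t)
    (hJ : J.card = t) : QMat k q m n :=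
  ∑ σ : Equiv.Perm (Fin t), (-q) ^ invCount σ •
    (List.ofFn fun r : Fin t => xGen k q (I.orderEmbOfFin hI (σ r)) (J.orderEmbOfFin hJ r)).prod

/-- The maximal quantum minor with column set `J`, as an element of quantum matrices. -/
def maxMinor {m n : ℕ} (J : Finset (Fin n)) (hJ : J.card = m) : QMat k q m n :=
  qMinor q (Finset.univ : Finset (Fin m)) J (Finset.card_fin m) hJ

/-! ### The quantum grassmannian and its grading -/

variable (m n : ℕ)

/-- The quantum grassmannian `O_q(G(m,n))`: the subalgebra generated by the maximal minors. -/
def qGrass : Subalgebra k (QMat k q m n) :=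
  Algebra.adjoin k {z | ∃ (J : Finset (Fin n)) (hJ : J.card = m), z = maxMinor q J hJ}

variable {m n}

/-- The generator `[J]` of the quantum grassmannian. -/
def plucker (J : Finset (Fin n)) (hJ : J.card = m) : qGrass q m n :=
  ⟨maxMinor q J hJ, Algebra.subset_adjoin ⟨J, hJ, rfl⟩⟩

variable (m n)

/-- The linear span of the generating minors `[J]`. -/
def pluckerSpan : Submodule k (qGrass q m n) :=
  Submodule.span k {z | ∃ (J : Finset (Fin n)) (hJ : J.card = m), z = plucker q J hJ}

/-- The homogeneous component of degree `d` of the quantum grassmannian (each `[J]` has degree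
one): the span of all products of `d` generating minors. -/
def grassDeg (d : ℕ) : Submodule k (qGrass q m n) := pluckerSpan q m n ^ d

/-- The algebra map `x_{ij} ↦ x_{ij} T`, which records the degree in the generators `x_{ij}`. -/
def degHom : QMat k q m n →ₐ[k] (QMat k q m n)[X] :=
  RingQuot.liftAlgHom k ⟨FreeAlgebra.lift k fun p => Polynomial.C (xGen k q p.1 p.2) * Polynomial.X, by
    have key : ∀ (a b : QMat k q m n), (Polynomial.C a * Polynomial.X) *
        (Polynomial.C b * Polynomial.X) = Polynomial.C (a * b) * Polynomial.X ^ 2 := by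
      intro a b
      rw [mul_assoc, ← mul_assoc Polynomial.X, Polynomial.X_mul_C, Polynomial.C_mul, pow_two]
      simp only [mul_assoc]
    have smulC : ∀ (c : k) (a : QMat k q m n), c • (Polynomial.C a * Polynomial.X ^ 2) =
        Polynomial.C (c • a) * Polynomial.X ^ 2 := by
      intro c a
      rw [← Polynomial.smul_C, smul_mul_assoc]
    intro a b h
    have h' := RingQuot.mkAlgHom_rel k h
    induction h <;>
      · simp only [map_mul, map_sub, map_smul, FreeAlgebra.lift_ι_apply] at h' ⊢
        simp only [key, smulC]
        first
          | exact congrArg (fun z => Polynomial.C z * Polynomial.X ^ 2) h'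
          | exact (sub_mul _ _ _).symm.trans
              (congrArg (fun z => z * Polynomial.X ^ 2) ((Polynomial.C_sub).symm.trans
                (congrArg Polynomial.C h')))⟩

variable {m n}

theorem degHom_x (i : Fin m) (j : Fin n) :
    degHom q m n (xGen k q i j) = Polynomial.C (xGen k q i j) * Polynomial.X := by
  simp [degHom, xGen]

theorem degHom_mul_of {a b : QMat k q m n} {c d : ℕ}
    (ha : degHom q m n a = Polynomial.C a * Polynomial.X ^ c)
    (hb : degHom q m n b = Polynomial.C b * Polynomial.X ^ d) :
    degHom q m n (a * b) = Polynomial.C (a * b) * Polynomial.X ^ (c + d) := by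
  rw [map_mul, ha, hb, mul_assoc, ← mul_assoc (Polynomial.X ^ c), Polynomial.X_pow_mul_C,
    Polynomial.C_mul, pow_add]
  simp only [mul_assoc]

theorem degHom_maxMinor (J : Finset (Fin n)) (hJ : J.card = m) :
    degHom q m n (maxMinor q J hJ) = Polynomial.C (maxMinor q J hJ) * Polynomial.X ^ m := by
  have hprod : ∀ l : List (Fin m × Fin n),
      degHom q m n (l.map fun p => xGen k q p.1 p.2).prod =
        Polynomial.C (l.map fun p => xGen k q p.1 p.2).prod * Polynomial.X ^ l.length := by
    intro l
    induction l with
    | nil => simp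
    | cons p l ih =>
      rw [List.map_cons, List.prod_cons, List.length_cons, add_comm l.length 1]
      exact degHom_mul_of q (by rw [degHom_x, pow_one]) ih
  unfold maxMinor qMinor
  rw [map_sum, map_sum, Finset.sum_mul]
  refine Finset.sum_congr rfl fun σ _ => ?_
  rw [map_smul, ← Polynomial.smul_C, smul_mul_assoc]
  congr 1
  have := hprod (List.ofFn fun r : Fin m =>
    ((Finset.univ : Finset (Fin m)).orderEmbOfFin (Finset.card_fin m) (σ r),
      J.orderEmbOfFin hJ r))
  simpa [List.map_ofFn, Function.comp_def] using this

theorem degHom_of_mem {d : ℕ} {a : qGrass q m n} (ha : a ∈ grassDeg q m n d) :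
    degHom q m n a = Polynomial.C (a : QMat k q m n) * Polynomial.X ^ (m * d) := by
  have h1 : ∀ b ∈ pluckerSpan q m n,
      degHom q m n b = Polynomial.C (b : QMat k q m n) * Polynomial.X ^ m := by
    intro b hb
    induction hb using Submodule.span_induction with
    | mem b hb =>
      obtain ⟨J, hJ, rfl⟩ := hb
      exact degHom_maxMinor q J hJ
    | zero => simp
    | add b c _ _ hb hc => simp [hb, hc, add_mul]
    | smul r b _ hb =>
      rw [Subalgebra.coe_smul, map_smul, hb, ← Polynomial.smul_C, smul_mul_assoc]
  unfold grassDeg at ha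
  induction ha using Submodule.pow_induction_on_left' with
  | algebraMap r =>
    rw [Subalgebra.coe_algebraMap, AlgHom.commutes, mul_zero, pow_zero, mul_one]
    rfl
  | add b c i _ _ hb hc => simp [hb, hc, add_mul]
  | mem_mul b hb i c _ hc =>
    rw [Subalgebra.coe_mul, degHom_mul_of q (h1 b hb) hc]
    rw [Nat.mul_succ, add_comm m]

theorem plucker_mem (J : Finset (Fin n)) (hJ : J.card = m) :
    plucker q J hJ ∈ grassDeg q m n 1 := by
  unfold grassDeg
  rw [pow_one]
  exact Submodule.subset_span ⟨J, hJ, rfl⟩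

instance grassDeg_gradedMonoid : SetLike.GradedMonoid (grassDeg q m n) where
  one_mem := by
    unfold grassDeg
    rw [pow_zero]
    exact Submodule.one_le.mp le_rfl
  mul_mem i j a b ha hb := by
    unfold grassDeg at *
    rw [pow_add]
    exact Submodule.mul_mem_mul ha hb

theorem grassDeg_isInternal [NeZero m] : DirectSum.IsInternal (grassDeg q m n) := by
  refine ⟨?_, ?_⟩
  · intro f g hfg
    have key : ∀ (f : DirectSum ℕ fun d => grassDeg q m n d) (d : ℕ),
        (degHom q m n (DirectSum.coeAddMonoidHom (grassDeg q m n) f :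
          qGrass q m n)).coeff (m * d) = ((f d : qGrass q m n) : QMat k q m n) := by
      intro f d
      induction f using DirectSum.induction_on with
      | zero => simp
      | add f g hf hg => simp [hf, hg]
      | of e a =>
        rw [DirectSum.coeAddMonoidHom_of, degHom_of_mem q a.2, Polynomial.coeff_C_mul_X_pow]
        by_cases h : e = d
        · subst h
          simp
        · rw [if_neg, DirectSum.of_eq_of_ne _ _ _ (Ne.symm h)]
          · rfl
          · exact fun h' => h (Nat.eq_of_mul_eq_mul_left (NeZero.pos m) h').symm
    refine DFinsupp.ext fun d => ?_
    exact Subtype.ext (Subtype.ext ((key f d).symm.trans (by rw [hfg]; exact key g d)))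
  · intro a
    suffices h : ∀ b (hb : b ∈ qGrass q m n),
        (⟨b, hb⟩ : qGrass q m n) ∈ (DirectSum.coeAlgHom (grassDeg q m n)).range by
      exact h a.1 a.2
    intro b hb
    induction hb using Algebra.adjoin_induction with
    | mem b hb =>
      obtain ⟨J, hJ, rfl⟩ := hb
      exact ⟨DirectSum.of (fun d => grassDeg q m n d) 1 ⟨plucker q J hJ, plucker_mem q J hJ⟩,
        DirectSum.coeAlgHom_of _ _ _⟩
    | algebraMap r => exact Subalgebra.algebraMap_mem _ r
    | add b c _ _ hb hc => exact Subalgebra.add_mem _ hb hc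
    | mul b c _ _ hb hc => exact Subalgebra.mul_mem _ hb hc

/-- The quantum grassmannian is an `ℕ`-graded algebra. -/
instance grassDeg_gradedAlgebra [NeZero m] : GradedAlgebra (grassDeg q m n) where
  toGradedMonoid := grassDeg_gradedMonoid q
  toDecomposition := (grassDeg_isInternal q).chooseDecomposition

/-! ### Noncommutative dehomogenisation -/

/-- `s` is a normal element (`s A = A s`) and a nonzero divisor of the ring `A`. -/
class IsNormalNonZeroDivisor {A : Type*} [Ring A] (s : A) : Prop where
  normal : Set.range (fun b : A => s * b) = Set.range (fun b : A => b * s)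
  left_regular : ∀ b : A, s * b = 0 → b = 0
  right_regular : ∀ b : A, b * s = 0 → b = 0

section Dehomogenisation

variable {A : Type*} [Ring A] [Algebra k A] (s : A)

theorem exists_pow_mul_eq [hs : IsNormalNonZeroDivisor s] (d : ℕ) (b : A) :
    ∃ c : A, s ^ d * b = c * s ^ d := by
  induction d with
  | zero => exact ⟨b, by simp⟩
  | succ d ih =>
    obtain ⟨c, hc⟩ := ih
    obtain ⟨e, he⟩ : s * c ∈ Set.range (fun b : A => b * s) := hs.normal ▸ ⟨c, rfl⟩
    refine ⟨e, ?_⟩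
    rw [pow_succ', mul_assoc, hc, ← mul_assoc, ← mul_assoc]
    exact congrArg (· * s ^ d) he.symm

/-- The powers of a normal nonzero divisor form an Ore set. -/
instance oreSetPowers [hs : IsNormalNonZeroDivisor s] :
    OreLocalization.OreSet (Submonoid.powers s) :=
  Classical.choice <| OreLocalization.nonempty_oreSet_iff.mpr <| by
    refine ⟨?_, ?_⟩
    · rintro a b ⟨_, d, rfl⟩ h
      refine ⟨1, ?_⟩
      have reg : ∀ (d : ℕ) (c : A), c * s ^ d = 0 → c = 0 := by
        intro d
        induction d with
        | zero => intro c hc; simpa using hc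
        | succ d ih =>
          intro c hc
          rw [pow_succ, ← mul_assoc] at hc
          exact ih c (hs.right_regular _ hc)
      rw [sub_eq_zero.mp (reg d (a - b) (by rw [sub_mul, sub_eq_zero]; exact h))]
    · rintro a ⟨_, d, rfl⟩
      obtain ⟨c, hc⟩ := exists_pow_mul_eq s d a
      exact ⟨c, ⟨s ^ d, d, rfl⟩, hc⟩

/-- The Ore localisation of `A` at the powers of `s`. -/
abbrev Loc [IsNormalNonZeroDivisor s] : Type _ := OreLocalization (Submonoid.powers s) A

/-- The canonical map from `A` to its localisation. -/
def toLoc [IsNormalNonZeroDivisor s] (a : A) : Loc s :=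
  OreLocalization.oreDiv a (1 : Submonoid.powers s)

/-- The inverse of `s` in the localisation. -/
def invLoc [IsNormalNonZeroDivisor s] : Loc s :=
  OreLocalization.oreDiv (1 : A) (⟨s, 1, pow_one s⟩ : Submonoid.powers s)

variable (k)

/-- The canonical map, as an algebra homomorphism. -/
def toLocHom [IsNormalNonZeroDivisor s] : A →ₐ[k] Loc s where
  __ := (OreLocalization.numeratorRingHom : A →+* Loc s)
  commutes' _ := rfl

variable {k}

theorem toLocHom_apply [IsNormalNonZeroDivisor s] (a : A) : toLocHom k s a = toLoc s a := rfl

theorem toLoc_mul_invLoc [IsNormalNonZeroDivisor s] : toLoc s s * invLoc s = 1 :=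
  (OreLocalization.numeratorUnit (⟨s, 1, pow_one s⟩ : Submonoid.powers s)).mul_inv

theorem invLoc_mul_toLoc [IsNormalNonZeroDivisor s] : invLoc s * toLoc s s = 1 :=
  (OreLocalization.numeratorUnit (⟨s, 1, pow_one s⟩ : Submonoid.powers s)).inv_mul

/-- A normal homogeneous element of degree one can be moved past homogeneous elements. -/
theorem exists_mul_eq_of_mem {𝒜 : ℕ → Submodule k A} [GradedAlgebra 𝒜] (hs1 : s ∈ 𝒜 1)
    [hs : IsNormalNonZeroDivisor s] {e : ℕ} {b : A} (hb : b ∈ 𝒜 e) :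
    ∃ c ∈ 𝒜 e, s * c = b * s := by
  obtain ⟨c, hc⟩ : b * s ∈ Set.range (fun b : A => s * b) := hs.normal ▸ ⟨b, rfl⟩
  refine ⟨DirectSum.decompose 𝒜 c e, SetLike.coe_mem _, ?_⟩
  have h1 : (DirectSum.decompose 𝒜 (s * c) (1 + e) : A) = s * DirectSum.decompose 𝒜 c e :=
    DirectSum.coe_decompose_mul_add_of_left_mem 𝒜 hs1
  have h2 : b * s ∈ 𝒜 (1 + e) := add_comm e 1 ▸ SetLike.mul_mem_graded hb hs1
  rw [← h1, show s * c = b * s from hc, DirectSum.decompose_of_mem_same 𝒜 h2]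

theorem invLoc_pow_mul {𝒜 : ℕ → Submodule k A} [GradedAlgebra 𝒜] (hs1 : s ∈ 𝒜 1)
    [IsNormalNonZeroDivisor s] (d : ℕ) {e : ℕ} {b : A} (hb : b ∈ 𝒜 e) :
    ∃ c ∈ 𝒜 e, invLoc s ^ d * toLoc s b = toLoc s c * invLoc s ^ d := by
  induction d with
  | zero => exact ⟨b, hb, by simp⟩
  | succ d ih =>
    obtain ⟨c, hc, h⟩ := ih
    obtain ⟨c', hc', h'⟩ := exists_mul_eq_of_mem s hs1 hc
    refine ⟨c', hc', ?_⟩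
    have h2 : toLoc s s * toLoc s c' = toLoc s c * toLoc s s := by
      simp only [← toLocHom_apply (k := k), ← map_mul, h']
    have h3 : invLoc s * toLoc s c = toLoc s c' * invLoc s := by
      calc invLoc s * toLoc s c = invLoc s * (toLoc s c * toLoc s s) * invLoc s := by
            rw [mul_assoc, mul_assoc, toLoc_mul_invLoc, mul_one]
        _ = toLoc s c' * invLoc s := by
            rw [← h2, ← mul_assoc (invLoc s), invLoc_mul_toLoc, one_mul]
    rw [pow_succ', mul_assoc, h, ← mul_assoc, h3, mul_assoc]

theorem toLoc_pow_mul_invLoc_pow [IsNormalNonZeroDivisor s] (d : ℕ) :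
    toLoc s (s ^ d) * invLoc s ^ d = 1 := by
  induction d with
  | zero => rw [pow_zero, pow_zero, mul_one]; exact map_one (OreLocalization.numeratorRingHom : A →+* Loc s)
  | succ d ih =>
    have h : toLoc s (s ^ (d + 1)) = toLoc s (s ^ d) * toLoc s s := by
      rw [pow_succ]
      exact map_mul (OreLocalization.numeratorRingHom : A →+* Loc s) _ _
    rw [h, pow_succ' (invLoc s), mul_assoc, ← mul_assoc (toLoc s s), toLoc_mul_invLoc, one_mul, ih]

/-- The noncommutative dehomogenisation of the `ℕ`-graded algebra `A = ⨁ 𝒜 d` at a normal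
nonzero divisor `s` of degree one: the degree zero part `{a s⁻ᵈ | a ∈ 𝒜 d}` of the `ℤ`-graded
Ore localisation of `A` at the powers of `s`. -/
def Dhom (𝒜 : ℕ → Submodule k A) [GradedAlgebra 𝒜] (hs1 : s ∈ 𝒜 1)
    [IsNormalNonZeroDivisor s] : Subalgebra k (Loc s) where
  carrier := {z | ∃ d, ∃ a ∈ 𝒜 d, z = toLoc s a * invLoc s ^ d}
  mul_mem' := by
    rintro _ _ ⟨d, a, ha, rfl⟩ ⟨e, b, hb, rfl⟩
    obtain ⟨c, hc, h⟩ := invLoc_pow_mul s hs1 d hb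
    refine ⟨d + e, a * c, SetLike.mul_mem_graded ha hc, ?_⟩
    rw [← toLocHom_apply (k := k) s (a * c), map_mul, toLocHom_apply, toLocHom_apply, mul_assoc,
      ← mul_assoc (invLoc s ^ d), h, pow_add]
    simp only [mul_assoc]
  add_mem' := by
    rintro _ _ ⟨d, a, ha, rfl⟩ ⟨e, b, hb, rfl⟩
    have hpow : ∀ j : ℕ, s ^ j ∈ 𝒜 j := fun j => by
      simpa using SetLike.pow_mem_graded j hs1
    refine ⟨d + e, a * s ^ e + b * s ^ d, Submodule.add_mem _
      (SetLike.mul_mem_graded ha (hpow e))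
      (add_comm e d ▸ SetLike.mul_mem_graded hb (hpow d)), ?_⟩
    have key : ∀ (i j : ℕ) (c : A),
        toLoc s (c * s ^ j) * invLoc s ^ (j + i) = toLoc s c * invLoc s ^ i := by
      intro i j c
      rw [← toLocHom_apply (k := k) s (c * s ^ j), map_mul, toLocHom_apply, toLocHom_apply,
        pow_add, mul_assoc, ← mul_assoc (toLoc s (s ^ j)), toLoc_pow_mul_invLoc_pow, one_mul]
    rw [← toLocHom_apply (k := k) s (_ + _), map_add, toLocHom_apply, toLocHom_apply, add_mul,
      key e d b, add_comm d e, key d e a]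
  algebraMap_mem' r := ⟨0, algebraMap k A r, SetLike.algebraMap_mem_graded 𝒜 r, by
    rw [pow_zero, mul_one, ← toLocHom_apply (k := k), AlgHom.commutes]⟩

end Dehomogenisation

/-! ### Cyclically consecutive minors and the index sets `Q(I,J)` -/

section IndexSets

variable {m n : ℕ}

/-- The column reached from column `a` by `r` cyclic steps. In one-based labels, if `a` has label
`α` then `cyc a r` is the element of `{1,…,n}` congruent to `α + r` modulo `n`. -/
def cyc (a : Fin n) (r : ℕ) : Fin n := ⟨(a + r) % n, Nat.mod_lt _ a.pos⟩

theorem cyc_inj (a : Fin n) {r r' : ℕ} (hr : r < n) (hr' : r' < n) (h : cyc a r = cyc a r') :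
    r = r' := by
  have h1 : (a + r) ≡ (a + r') [MOD n] := congrArg Fin.val h
  have h2 := Nat.ModEq.add_left_cancel' (a : ℕ) h1
  rwa [Nat.ModEq, Nat.mod_eq_of_lt hr, Nat.mod_eq_of_lt hr'] at h2

/-- The consecutive index set `M`: the `m` cyclically consecutive columns starting at `a`. -/
def consec (m : ℕ) (a : Fin n) : Finset (Fin n) := (Finset.range m).image (cyc a)

theorem consec_card (hmn : m ≤ n) (a : Fin n) : (consec m a).card = m := by
  rw [consec, Finset.card_image_of_injOn, Finset.card_range]
  intro r hr r' hr' h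
  simp only [Finset.coe_range, Set.mem_Iio] at hr hr'
  exact cyc_inj a (hr.trans_le hmn) (hr'.trans_le hmn) h

/-- The columns which `J` contributes to `Q(I,J)`: the column with one-based label `j` goes to
label `j + α + m - 1` modulo `n`, where `α` is the label of `a`. -/
def addedCols (a : Fin n) (J : Finset (Fin (n - m))) : Finset (Fin n) :=
  J.image fun j : Fin (n - m) => cyc a (m + (j : ℕ))

/-- The columns which `I` removes from `M`: the row with one-based label `i` removes the column
with label `α + m - i` modulo `n`, where `α` is the label of `a`. -/
def removedCols (a : Fin n) (I : Finset (Fin m)) : Finset (Fin n) :=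
  I.image fun i : Fin m => cyc a (m - 1 - (i : ℕ))

/-- The index set `Q(I,J)`. -/
def idxQ (a : Fin n) (I : Finset (Fin m)) (J : Finset (Fin (n - m))) : Finset (Fin n) :=
  addedCols a J ∪ (consec m a \ removedCols a I)

theorem idxQ_card (hmn : m ≤ n) (a : Fin n) (I : Finset (Fin m)) (J : Finset (Fin (n - m)))
    (h : I.card = J.card) : (idxQ a I J).card = m := by
  have hI : (removedCols a I).card = I.card := by
    refine Finset.card_image_of_injOn fun i _ i' _ hii => Fin.ext ?_
    have := cyc_inj a (by omega) (by omega) hii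
    omega
  have hJ : (addedCols a J).card = J.card := by
    refine Finset.card_image_of_injOn fun j _ j' _ hjj => Fin.ext ?_
    have := cyc_inj a (by omega) (by omega) hjj
    omega
  have hsub : removedCols a I ⊆ consec m a := by
    intro c hc
    obtain ⟨i, -, rfl⟩ := Finset.mem_image.mp hc
    exact Finset.mem_image.mpr ⟨m - 1 - i, Finset.mem_range.mpr (by omega), rfl⟩
  have hdisj : Disjoint (addedCols a J) (consec m a \ removedCols a I) := by
    rw [Finset.disjoint_left]
    intro c hc hc'
    obtain ⟨j, -, rfl⟩ := Finset.mem_image.mp hc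
    obtain ⟨r, hr, hrj⟩ := Finset.mem_image.mp (Finset.mem_sdiff.mp hc').1
    rw [Finset.mem_range] at hr
    have := cyc_inj a (by omega) (by omega) hrj
    omega
  rw [idxQ, Finset.card_union_of_disjoint hdisj, Finset.card_sdiff_of_subset hsub, hI, hJ,
    consec_card hmn]
  have : I.card ≤ m := (Finset.card_le_univ I).trans_eq (Fintype.card_fin m)
  omega

end IndexSets

/-- The consecutive quantum minor `[M]`. -/
def consecMinor {m n : ℕ} (hmn : m ≤ n) (a : Fin n) : qGrass q m n :=
  plucker q (consec m a) (consec_card hmn a)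

/-- The dehomogenisation of the quantum grassmannian at the consecutive quantum minor `[M]`. -/
abbrev GrassDhom {m n : ℕ} [NeZero m] (hmn : m ≤ n) (a : Fin n)
    [IsNormalNonZeroDivisor (consecMinor q hmn a)] : Subalgebra k (Loc (consecMinor q hmn a)) :=
  Dhom (consecMinor q hmn a) (grassDeg q m n) (plucker_mem q _ _)

/-- The element `[K][M]⁻¹` of the localisation of the quantum grassmannian at `[M]`. -/
def curly {m n : ℕ} (hmn : m ≤ n) (a : Fin n) [IsNormalNonZeroDivisor (consecMinor q hmn a)]
    (K : Finset (Fin n)) (hK : K.card = m) : Loc (consecMinor q hmn a) :=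
  toLoc (consecMinor q hmn a) (plucker q K hK) * invLoc (consecMinor q hmn a)

end QuantumGrassmannian

end

open QuantumGrassmannian

/-!
The point is to realise all the algebras involved inside one ring in which every quantum minor is
invertible, and to obtain `ρ` there by explicit matrix manipulations.

*The ambient ring.* There is a quantum `m × n` matrix `X` of Laurent series over a quantum torus
such that each of its minors has a leading monomial, namely the product of the diagonal entries
(`exists_isTwistedGroupFamily`, `IsTwistedGroupFamily.exists_isQMat`). The matrix is built one row
at a time (`IsQMat.addRow`). Elements with leading monomials are units (`HasLead.isUnit`), and the
homomorphism from `𝒪_q(M_{m,n})` given by `X` is injective because the ordered monomials in the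
generators have different leading monomials (`IsQMat.lift_injective`). Hence the quantum
grassmannian and its localisation at `[M]` embed into the ring of Laurent series, which settles the
regularity of `[M]` and allows all identities to be checked there.

*Rotation.* If the lower left entry of a quantum matrix is invertible, then pivoting about it and
moving the last row to the top and the first column to the right gives another quantum matrix
(`rotMat_isQMat`), whose minors are minors of the original matrix divided by the pivot
(`qdet_rotMat`, `qdet_rotMat_append`). On the index sets `Q(I,J)` this is the step from `a` to
`a + 1` (`cycSet_succ`, `RotState.succ`). Regard `X` as the second block of the matrix `[1 | X]`,
whose maximal minors are all the minors of `X`. After `m` rotations the quotients of the maximal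
minors of `X` itself appear as minors of a quantum matrix, for `a = 0`; further rotations lead to
every `a` (`IsQMat.exists_rotState`). The result is a quantum `m × (n - m)` matrix `y` such that
`[I|J]_y [M] = [Q(I,J)]`, and such that `[M]` commutes with the minors of `y` up to scalars. So `[M]`
is normal, and `x_{ij} ↦ y_{ij}` defines a homomorphism whose image is the degree zero part of the
localisation, because every maximal minor is `[Q(I,J)]` for some `I` and `J` (`exists_cycSet_eq`,
`RotState.isoDhom`).

*Injectivity of `ρ`.* The entries of `y` need not have independent leading monomials, so growth is
used instead. If a nonzero element were killed, then its leading exponent `e₀` would make all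
ordered monomials divisible by `e₀` redundant in the image, whose growth would be that of a
polynomial ring in fewer than `m (n - m)` variables (`QuasiCommute.injective_of_growth`). But the
image contains the quotients of `m (n - m)` suitable maximal minors by `[M]`, and the products of
these have pairwise different leading monomials (`RotState.lift_injective`).
-/

noncomputable section

namespace QuantumGrassmannian

/-! ### Straightening of words modulo lower contents -/

section Words

variable {k : Type*} [Field k] {S : Type*} [Ring S] [Algebra k S] {ι : Type*}

/-- The content of a word: how often each letter occurs. -/
def wordContent (l : List ι) : ι →₀ ℕ := (l.map fun p => Finsupp.single p 1).sum

/-- The product of the letters of a word. -/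
def wordProd (x : ι → S) (l : List ι) : S := (l.map x).prod

/-- A word with the given content. -/
def contentWord (e : ι →₀ ℕ) : List ι := (Finsupp.toMultiset e).toList

theorem wordContent_cons (p : ι) (l : List ι) :
    wordContent (p :: l) = Finsupp.single p 1 + wordContent l := rfl

theorem wordContent_append (l l' : List ι) :
    wordContent (l ++ l') = wordContent l + wordContent l' := by
  simp [wordContent]

theorem wordProd_cons (x : ι → S) (p : ι) (l : List ι) :
    wordProd x (p :: l) = x p * wordProd x l := by simp [wordProd]

theorem wordProd_append (x : ι → S) (l l' : List ι) :
    wordProd x (l ++ l') = wordProd x l * wordProd x l' := by simp [wordProd]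

theorem wordContent_degree (l : List ι) : (wordContent l).degree = l.length := by
  induction l with
  | nil => simp [wordContent]
  | cons p l ih => rw [wordContent_cons, map_add, ih]; simp [add_comm]

variable [LinearOrder ι]

theorem wordContent_eq (l : List ι) :
    wordContent l = Multiset.toFinsupp (l : Multiset ι) := by
  induction l with
  | nil => simp [wordContent]
  | cons p l ih =>
    rw [wordContent_cons, ih, ← Multiset.cons_coe, ← Multiset.singleton_add, map_add,
      Multiset.toFinsupp_singleton]

theorem wordContent_contentWord (e : ι →₀ ℕ) : wordContent (contentWord e) = e := by
  rw [wordContent_eq, contentWord, Multiset.coe_toList]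
  simp

theorem perm_of_wordContent_eq {l l' : List ι} (h : wordContent l = wordContent l') :
    l.Perm l' := by
  rw [wordContent_eq, wordContent_eq] at h
  exact Multiset.coe_eq_coe.mp (Multiset.toFinsupp.injective h)

variable (k) in
/-- The span of the words whose content is smaller than `e` for the graded lexicographic order. -/
def lowerSpan (x : ι → S) (e : ι →₀ ℕ) : Submodule k S :=
  Submodule.span k {z | ∃ l : List ι, toDegLex (wordContent l) < toDegLex e ∧ z = wordProd x l}

variable (k) in
/-- The letters commute up to nonzero scalars and words of smaller content. -/
def QuasiCommute (x : ι → S) : Prop :=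
  ∀ p p' : ι, ∃ c : k, c ≠ 0 ∧ x p * x p' - c • (x p' * x p) ∈
    lowerSpan k x (Finsupp.single p 1 + Finsupp.single p' 1)

theorem mul_mem_lowerSpan {x : ι → S} {e : ι →₀ ℕ} {z : S} (hz : z ∈ lowerSpan k x e)
    (l : List ι) : wordProd x l * z ∈ lowerSpan k x (wordContent l + e) := by
  unfold lowerSpan at hz
  induction hz using Submodule.span_induction with
  | mem z hz =>
    obtain ⟨l', hl', rfl⟩ := hz
    refine Submodule.subset_span ⟨l ++ l', ?_, (wordProd_append x l l').symm⟩
    rw [wordContent_append, toDegLex_add, toDegLex_add]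
    exact add_lt_add_right hl' _
  | zero => rw [mul_zero]; exact Submodule.zero_mem _
  | add a b _ _ ha hb => rw [mul_add]; exact Submodule.add_mem _ ha hb
  | smul r a _ ha => rw [mul_smul_comm]; exact Submodule.smul_mem _ r ha

theorem lowerSpan_mul_mem {x : ι → S} {e : ι →₀ ℕ} {z : S} (hz : z ∈ lowerSpan k x e)
    (l : List ι) : z * wordProd x l ∈ lowerSpan k x (e + wordContent l) := by
  unfold lowerSpan at hz
  induction hz using Submodule.span_induction with
  | mem z hz =>
    obtain ⟨l', hl', rfl⟩ := hz
    refine Submodule.subset_span ⟨l' ++ l, ?_, (wordProd_append x l' l).symm⟩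
    rw [wordContent_append, toDegLex_add, toDegLex_add]
    exact add_lt_add_left hl' _
  | zero => rw [zero_mul]; exact Submodule.zero_mem _
  | add a b _ _ ha hb => rw [add_mul]; exact Submodule.add_mem _ ha hb
  | smul r a _ ha => rw [smul_mul_assoc]; exact Submodule.smul_mem _ r ha

/-- Rearranging a word changes its product by a nonzero scalar and by words of smaller content. -/
theorem QuasiCommute.perm {x : ι → S} (hx : QuasiCommute k x) {l l' : List ι} (h : l.Perm l') :
    ∃ c : k, c ≠ 0 ∧ wordProd x l - c • wordProd x l' ∈ lowerSpan k x (wordContent l) := by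
  induction h with
  | nil => exact ⟨1, one_ne_zero, by simp⟩
  | cons p h ih =>
    obtain ⟨c, hc, h⟩ := ih
    refine ⟨c, hc, ?_⟩
    have := mul_mem_lowerSpan h [p]
    simpa [wordProd, wordContent, mul_sub] using this
  | swap p p' l =>
    obtain ⟨c, hc, h⟩ := hx p' p
    refine ⟨c, hc, ?_⟩
    have := lowerSpan_mul_mem h l
    simpa [wordProd, wordContent, sub_mul, mul_assoc, add_assoc] using this
  | trans h₁ h₂ ih₁ ih₂ =>
    obtain ⟨c, hc, h⟩ := ih₁
    obtain ⟨c', hc', h'⟩ := ih₂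
    rename_i l₁ l₂ l₃
    have e : wordContent l₁ = wordContent l₂ := by
      rw [wordContent_eq, wordContent_eq, Multiset.coe_eq_coe.mpr h₁]
    refine ⟨c * c', mul_ne_zero hc hc', ?_⟩
    rw [← e] at h'
    have := Submodule.add_mem _ h (Submodule.smul_mem _ c h')
    convert this using 1
    rw [smul_sub, smul_smul]
    abel

/-- The words with pairwise different contents span all words. -/
theorem QuasiCommute.wordProd_mem_span [Finite ι] {x : ι → S} (hx : QuasiCommute k x)
    (l : List ι) :
    wordProd x l ∈ Submodule.span k (Set.range fun e : ι →₀ ℕ => wordProd x (contentWord e)) := by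
  have key : ∀ (d : DegLex (ι →₀ ℕ)) (l : List ι), toDegLex (wordContent l) = d →
      wordProd x l ∈
        Submodule.span k (Set.range fun e : ι →₀ ℕ => wordProd x (contentWord e)) := by
    intro d
    induction d using WellFoundedLT.induction with
    | ind d ih =>
    intro l hl
    obtain ⟨c, -, h⟩ := hx.perm (perm_of_wordContent_eq (wordContent_contentWord
      (wordContent l)).symm)
    rw [← sub_add_cancel (wordProd x l) (c • wordProd x (contentWord (wordContent l)))]
    refine Submodule.add_mem _ ?_ (Submodule.smul_mem _ _ (Submodule.subset_span ⟨_, rfl⟩))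
    refine (Submodule.span_le.mpr ?_) h
    rintro _ ⟨l', hl', rfl⟩
    exact ih _ (hl ▸ hl') l' rfl
  exact key _ l rfl

/-- If a map kills a nonzero element with leading exponent `e₀`, then the images of all words are
combinations of images of words whose exponent is not divisible by `e₀`. -/
theorem QuasiCommute.exists_exponent_of_ker [Finite ι] {x : ι → S} (hx : QuasiCommute k x)
    (hspan : ∀ s : S, s ∈ Submodule.span k (Set.range (wordProd x)))
    {R : Type*} [Ring R] [Algebra k R] (ρ : S →ₐ[k] R) {f : S} (hf : f ≠ 0) (hρ : ρ f = 0) :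
    ∃ e₀ : ι →₀ ℕ, ∀ (D : ℕ) (l : List ι), l.length ≤ D →
      ρ (wordProd x l) ∈ Submodule.span k
        ((fun e : ι →₀ ℕ => ρ (wordProd x (contentWord e))) ''
          {e | e.degree ≤ D ∧ ¬ e₀ ≤ e}) := by
  classical
  have hf' : f ∈ Submodule.span k
      (Set.range fun e : ι →₀ ℕ => wordProd x (contentWord e)) := by
    refine (Submodule.span_le.mpr ?_) (hspan f)
    rintro _ ⟨l, rfl⟩
    exact hx.wordProd_mem_span l
  obtain ⟨c, hc⟩ := (Finsupp.mem_span_range_iff_exists_finsupp).mp hf'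
  have hc0 : c.support.Nonempty := by
    rw [Finsupp.support_nonempty_iff]
    rintro rfl
    exact hf (by simpa using hc.symm)
  -- `e₀` is the leading exponent of `f`
  obtain ⟨e₀, he₀, hmax⟩ := Finset.exists_max_image c.support toDegLex hc0
  refine ⟨e₀, fun D l hl => ?_⟩
  set W := Submodule.span k ((fun e : ι →₀ ℕ => ρ (wordProd x (contentWord e))) ''
    {e | e.degree ≤ D ∧ ¬ e₀ ≤ e}) with hW
  have key : ∀ (d : DegLex (ι →₀ ℕ)) (l : List ι), toDegLex (wordContent l) = d → l.length ≤ D →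
      ρ (wordProd x l) ∈ W := by
    intro d
    induction d using WellFoundedLT.induction with
    | ind d ih =>
    intro l hl hlD
    -- words of smaller content are already known to be mapped into `W`
    have low : ∀ z ∈ lowerSpan k x (wordContent l), ρ z ∈ W := by
      intro z hz
      refine (Submodule.span_le (p := W.comap ρ.toLinearMap)).mpr ?_ hz
      rintro _ ⟨l', hl', rfl⟩
      refine ih _ (hl ▸ hl') l' rfl ?_
      have := Finsupp.DegLex.monotone_degree hl'.le
      simp only [ofDegLex_toDegLex, wordContent_degree] at this
      omega
    by_cases hle : e₀ ≤ wordContent l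
    · obtain ⟨g, hg⟩ := exists_add_of_le hle
      have hcont : wordContent (contentWord g ++ contentWord e₀) = wordContent l := by
        rw [wordContent_append, wordContent_contentWord, wordContent_contentWord, hg, add_comm]
      obtain ⟨a, -, h⟩ := hx.perm (perm_of_wordContent_eq hcont.symm)
      rw [← sub_add_cancel (wordProd x l) (a • wordProd x (contentWord g ++ contentWord e₀)),
        map_add]
      refine Submodule.add_mem _ (low _ h) ?_
      rw [map_smul]
      refine Submodule.smul_mem _ _ ?_
      -- in the image the leading word of `f` is a combination of the other words of `f`, which
      -- are smaller and remain so after multiplication by a word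
      have hsum : c e₀ • wordProd x (contentWord e₀) =
          f - ∑ e ∈ c.support.erase e₀, c e • wordProd x (contentWord e) := by
        rw [← hc, Finsupp.sum, ← Finset.add_sum_erase _ _ he₀]
        simp
      have hne : c e₀ ≠ 0 := Finsupp.mem_support_iff.mp he₀
      have : ρ (wordProd x (contentWord g ++ contentWord e₀)) =
          - ((c e₀)⁻¹ • ∑ e ∈ c.support.erase e₀,
            c e • ρ (wordProd x (contentWord g ++ contentWord e))) := by
        have h2 : wordProd x (contentWord e₀) = (c e₀)⁻¹ • (f -
            ∑ e ∈ c.support.erase e₀, c e • wordProd x (contentWord e)) := by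
          rw [← hsum, smul_smul, inv_mul_cancel₀ hne, one_smul]
        rw [wordProd_append, map_mul, h2, map_smul, map_sub, hρ, zero_sub, map_sum, mul_smul_comm,
          mul_neg, smul_neg, Finset.mul_sum]
        simp only [map_smul, mul_smul_comm, wordProd_append, map_mul]
      rw [this]
      refine Submodule.neg_mem _ (Submodule.smul_mem _ _ (Submodule.sum_mem _ fun e he =>
        Submodule.smul_mem _ _ ?_))
      have he' := Finset.mem_erase.mp he
      have hlt : toDegLex (wordContent (contentWord g ++ contentWord e)) < d := by
        rw [← hl, ← hcont, wordContent_append, wordContent_append, wordContent_contentWord,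
          wordContent_contentWord, wordContent_contentWord, toDegLex_add, toDegLex_add]
        exact add_lt_add_right (lt_of_le_of_ne (hmax e he'.2)
          fun h => he'.1 (toDegLex_injective h)) _
      refine ih _ hlt _ rfl ?_
      have := Finsupp.DegLex.monotone_degree (hlt.le.trans_eq hl.symm)
      simp only [ofDegLex_toDegLex, wordContent_degree] at this
      omega
    · obtain ⟨a, -, h⟩ := hx.perm (perm_of_wordContent_eq (wordContent_contentWord
        (wordContent l)).symm)
      rw [← sub_add_cancel (wordProd x l) (a • wordProd x (contentWord (wordContent l))), map_add]
      refine Submodule.add_mem _ (low _ h) ?_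
      rw [map_smul]
      refine Submodule.smul_mem _ _ (Submodule.subset_span ⟨wordContent l, ⟨?_, hle⟩, rfl⟩)
      rw [wordContent_degree]
      exact hlD
  exact key _ l rfl hl

/-- A map is injective if it sends words of different contents to linearly independent elements. -/
theorem QuasiCommute.injective_of_linearIndependent [Finite ι] {x : ι → S}
    (hx : QuasiCommute k x) (hspan : ∀ s : S, s ∈ Submodule.span k (Set.range (wordProd x)))
    {R : Type*} [Ring R] [Algebra k R] (ρ : S →ₐ[k] R)
    (hρ : LinearIndependent k fun e : ι →₀ ℕ => ρ (wordProd x (contentWord e))) :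
    Function.Injective ρ := by
  rw [injective_iff_map_eq_zero]
  intro f hf
  have hf' : f ∈ Submodule.span k
      (Set.range fun e : ι →₀ ℕ => wordProd x (contentWord e)) := by
    refine (Submodule.span_le.mpr ?_) (hspan f)
    rintro _ ⟨l, rfl⟩
    exact hx.wordProd_mem_span l
  obtain ⟨c, rfl⟩ := (Finsupp.mem_span_range_iff_exists_finsupp).mp hf'
  have : c = 0 := by
    refine (linearIndependent_iff.mp hρ) c ?_
    rw [Finsupp.linearCombination_apply, ← hf, Finsupp.sum, Finsupp.sum, map_sum]
    simp only [map_smul]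
  simp [this]

end Words

/-! ### Quantum matrices with entries in an algebra, and their minors -/

section QDet

variable {k : Type*} [Field k] (q : k) {R : Type*} [Ring R] [Algebra k R]

/-- The entries `y i j` with `i < m`, `j < N` satisfy the relations of quantum matrices. The indices
are natural numbers, so that shifting rows and columns needs no casts; entries outside the
`m × N` block are irrelevant. -/
structure IsQMat (m N : ℕ) (y : ℕ → ℕ → R) : Prop where
  row : ∀ i j l, i < m → j < l → l < N → y i j * y i l = q • (y i l * y i j)
  col : ∀ i s j, i < s → s < m → j < N → y i j * y s j = q • (y s j * y i j)
  anti : ∀ i s j l, i < s → s < m → j < l → l < N → y s j * y i l = y i l * y s j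
  diag : ∀ i s j l, i < s → s < m → j < l → l < N →
    y i j * y s l - y s l * y i j = (q - q⁻¹) • (y i l * y s j)

/-- The quantum minor with row set `I` and list of columns `c`, defined by Laplace expansion along
the first column. The columns need be neither increasing nor distinct. -/
def qdet (y : ℕ → ℕ → R) : List ℕ → Finset ℕ → R
  | [], I => if I = ∅ then 1 else 0
  | j :: c, I => ∑ i ∈ I, (-q) ^ (I.filter (· < i)).card • (y i j * qdet y c (I.erase i))

variable {q} {m N : ℕ} {y : ℕ → ℕ → R}

theorem qdet_nil (I : Finset ℕ) : qdet q y [] I = if I = ∅ then 1 else 0 := rfl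

theorem qdet_cons (j : ℕ) (c : List ℕ) (I : Finset ℕ) :
    qdet q y (j :: c) I =
      ∑ i ∈ I, (-q) ^ (I.filter (· < i)).card • (y i j * qdet q y c (I.erase i)) := rfl

theorem qdet_eq_zero {c : List ℕ} {I : Finset ℕ} (h : I.card ≠ c.length) :
    qdet q y c I = 0 := by
  induction c generalizing I with
  | nil => rw [qdet_nil, if_neg]; rintro rfl; simp at h
  | cons j c ih =>
    rw [qdet_cons]
    refine Finset.sum_eq_zero fun i hi => ?_
    rw [ih, mul_zero, smul_zero]
    rw [Finset.card_erase_of_mem hi]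
    have := Finset.card_pos.mpr ⟨i, hi⟩
    simp at h
    omega

/-- An element which commutes with the entries up to scalars depending multiplicatively on row and
column commutes with the quantum minors up to scalars. -/
theorem mul_qdet {w : R} {α β : ℕ → k} {c : List ℕ} {I : Finset ℕ}
    (h : ∀ i ∈ I, ∀ j ∈ c, w * y i j = (α i * β j) • (y i j * w)) :
    w * qdet q y c I = ((∏ i ∈ I, α i) * (c.map β).prod) • (qdet q y c I * w) := by
  induction c generalizing I with
  | nil =>
    rw [qdet_nil]
    split_ifs with hI
    · subst hI; simp
    · simp
  | cons j c ih =>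
    rw [qdet_cons, Finset.mul_sum, Finset.sum_mul, Finset.smul_sum]
    refine Finset.sum_congr rfl fun i hi => ?_
    have ih' := ih fun i' (hi' : i' ∈ I.erase i) j' hj' =>
      h i' (Finset.mem_of_mem_erase hi') j' (List.mem_cons_of_mem _ hj')
    rw [mul_smul_comm, ← mul_assoc, h i hi j (by simp), smul_mul_assoc, mul_assoc, ih',
      mul_smul_comm, smul_mul_assoc, smul_smul, smul_smul, smul_smul, mul_assoc (y i j),
      ← Finset.mul_prod_erase I α hi, List.map_cons, List.prod_cons]
    congr 1
    ring

theorem card_filter_erase {I : Finset ℕ} {i s : ℕ} (hi : i ∈ I) :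
    ((I.erase i).filter (· < s)).card + (if i < s then 1 else 0) = (I.filter (· < s)).card := by
  rw [Finset.filter_erase]
  split_ifs with h
  · exact Finset.card_erase_add_one (Finset.mem_filter.mpr ⟨hi, h⟩)
  · rw [Finset.erase_eq_of_notMem, add_zero]
    simp [h]

/-- A sum over ordered pairs of different elements, as a sum over pairs `i < s`. -/
theorem sum_sum_erase {M : Type*} [AddCommMonoid M] (I : Finset ℕ) (f : ℕ → ℕ → M) :
    ∑ i ∈ I, ∑ s ∈ I.erase i, f i s = ∑ i ∈ I, ∑ s ∈ I with i < s, (f i s + f s i) := by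
  have h1 : ∀ i ∈ I, ∑ s ∈ I.erase i, f i s =
      ∑ s ∈ I with i < s, f i s + ∑ s ∈ I with s < i, f i s := by
    intro i _
    rw [← Finset.sum_union]
    · refine Finset.sum_congr ?_ fun _ _ => rfl
      ext s
      simp only [Finset.mem_erase, Finset.mem_union, Finset.mem_filter]
      constructor
      · rintro ⟨h, h'⟩
        rcases lt_or_gt_of_ne h with h | h
        · exact Or.inr ⟨h', h⟩
        · exact Or.inl ⟨h', h⟩
      · rintro (⟨h, h'⟩ | ⟨h, h'⟩)
        · exact ⟨h'.ne', h⟩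
        · exact ⟨h'.ne, h⟩
    · rw [Finset.disjoint_left]
      intro s hs hs'
      simp only [Finset.mem_filter] at hs hs'
      exact lt_asymm hs.2 hs'.2
  rw [Finset.sum_congr rfl h1, Finset.sum_add_distrib]
  simp only [Finset.sum_add_distrib]
  congr 1
  simp only [Finset.sum_filter]
  rw [Finset.sum_comm]

/-- Expansion along the first two columns, with the terms of the two orders of rows collected. -/
theorem qdet_cons_cons (hq : q ≠ 0) (j l : ℕ) (c : List ℕ) (I : Finset ℕ) :
    qdet q y (j :: l :: c) I = ∑ i ∈ I, ∑ s ∈ I with i < s,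
      (-q) ^ ((I.filter (· < i)).card + (I.filter (· < s)).card) •
        ((y s j * y i l - q⁻¹ • (y i j * y s l)) * qdet q y c ((I.erase i).erase s)) := by
  have h1 : qdet q y (j :: l :: c) I = ∑ i ∈ I, ∑ s ∈ I.erase i,
      (-q) ^ ((I.filter (· < i)).card + ((I.erase i).filter (· < s)).card) •
        (y i j * y s l * qdet q y c ((I.erase i).erase s)) := by
    rw [qdet_cons]
    refine Finset.sum_congr rfl fun i _ => ?_
    rw [qdet_cons, Finset.mul_sum, Finset.smul_sum]
    refine Finset.sum_congr rfl fun s _ => ?_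
    rw [mul_smul_comm, smul_smul, pow_add, mul_assoc]
  rw [h1, sum_sum_erase]
  refine Finset.sum_congr rfl fun i hi => Finset.sum_congr rfl fun s hs => ?_
  obtain ⟨hs, his⟩ := Finset.mem_filter.mp hs
  have e1 := card_filter_erase (s := s) hi
  have e2 := card_filter_erase (s := i) hs
  rw [if_pos his] at e1
  rw [if_neg his.le.not_gt, add_zero] at e2
  rw [Finset.erase_right_comm (a := s), e2, ← e1, sub_mul, smul_sub, smul_mul_assoc, smul_smul]
  have e3 : (-q) ^ ((I.filter (· < i)).card + (((I.erase i).filter (· < s)).card + 1)) * q⁻¹ =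
      - (-q) ^ ((I.filter (· < i)).card + ((I.erase i).filter (· < s)).card) := by
    rw [← add_assoc, pow_succ, mul_assoc, neg_mul, mul_inv_cancel₀ hq]
    ring
  rw [e3, neg_smul, sub_neg_eq_add, add_comm]
  congr 3
  omega

/-- A quantum minor with two equal leading columns vanishes. -/
theorem IsQMat.qdet_self (hy : IsQMat q m N y) (hq : q ≠ 0) {j : ℕ} (hj : j < N) (c : List ℕ)
    {I : Finset ℕ} (hI : ∀ i ∈ I, i < m) : qdet q y (j :: j :: c) I = 0 := by
  rw [qdet_cons_cons hq]
  refine Finset.sum_eq_zero fun i hi => Finset.sum_eq_zero fun s hs => ?_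
  obtain ⟨hs, his⟩ := Finset.mem_filter.mp hs
  rw [hy.col i s j his (hI s hs) hj, smul_smul, inv_mul_cancel₀ hq, one_smul, sub_self, zero_mul,
    smul_zero]

/-- Exchanging the first two columns of a quantum minor multiplies it by `-q`. -/
theorem IsQMat.qdet_swap (hy : IsQMat q m N y) (hq : q ≠ 0) {j l : ℕ} (hj : j < l) (hl : l < N)
    (c : List ℕ) {I : Finset ℕ} (hI : ∀ i ∈ I, i < m) :
    qdet q y (l :: j :: c) I = (-q) • qdet q y (j :: l :: c) I := by
  rw [qdet_cons_cons hq, qdet_cons_cons hq, Finset.smul_sum]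
  refine Finset.sum_congr rfl fun i hi => ?_
  rw [Finset.smul_sum]
  refine Finset.sum_congr rfl fun s hs => ?_
  obtain ⟨hs, his⟩ := Finset.mem_filter.mp hs
  have e : y s l * y i j - q⁻¹ • (y i l * y s j) =
      (-q) • (y s j * y i l - q⁻¹ • (y i j * y s l)) := by
    have h1 := hy.diag i s j l his (hI s hs) hj hl
    have h2 := hy.anti i s j l his (hI s hs) hj hl
    rw [h2, sub_eq_iff_eq_add.mp h1]
    match_scalars <;> (field_simp; try ring)
  rw [e, smul_mul_assoc, smul_comm]

end QDet

/-! ### Rotation of a quantum matrix about its lower left entry -/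

section Rotation

variable {k : Type*} [Field k] (q : k) {R : Type*} [Ring R] [Algebra k R]

/-- The rotation of an `m × N` matrix `y` about its lower left entry, whose inverse is `v`. The last
row of `y` becomes the first row and the first column of `y` becomes the last column; the remaining
entries are the `2 × 2` quantum minors containing the pivot, divided by the pivot. -/
def rotMat (m N : ℕ) (y : ℕ → ℕ → R) (v : R) : ℕ → ℕ → R
  | 0, j => if j + 1 < N then y (m - 1) (j + 1) * v else v
  | i + 1, j =>
    if j + 1 < N then y i 0 * (y (m - 1) (j + 1) * v) - q • y i (j + 1) else y i 0 * v

variable {q} {m N : ℕ} {y : ℕ → ℕ → R} {v : R}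

theorem mul_assoc_of_mul_eq {a b e : R} (h : a * b = e) (x : R) : a * (b * x) = e * x := by
  rw [← mul_assoc, h]

theorem mul_eq_of_inverse_left {a u v : R} {c : k} (huv : u * v = 1) (hvu : v * u = 1)
    (h : a * u = c • (u * a)) : v * a = c • (a * v) := by
  calc v * a = v * (a * u) * v := by rw [mul_assoc, mul_assoc, huv, mul_one]
    _ = c • (a * v) := by rw [h, mul_smul_comm, ← mul_assoc, hvu, one_mul, smul_mul_assoc]

section Block

set_option linter.unusedSimpArgs false

/-! The rotated entries are `b_i ρ_j - q W_{ij}`, where `b` is the first column, `ρ` the normalised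
last row and `W` the rest of the matrix. The next lemmas bring products of two such entries into the
normal order `b < W < ρ`. -/

variable {b b' ρ ρ' W W' V V' : R}

theorem rot_block_row (hq : q ≠ 0) (h1 : ρ' * ρ = q⁻¹ • (ρ * ρ'))
    (h2 : ρ * b = q • (b * ρ) - (q ^ 2 - 1) • W) (h3 : ρ' * b = q • (b * ρ') - (q ^ 2 - 1) • W')
    (h4 : W * b = q⁻¹ • (b * W)) (h5 : W' * b = q⁻¹ • (b * W')) (h6 : W' * W = q⁻¹ • (W * W'))
    (h9 : ρ * W' = W' * ρ) (h10 : ρ' * W = W * ρ' - (q - q⁻¹) • (W' * ρ)) :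
    (b * ρ - q • W) * (b * ρ' - q • W') = q • ((b * ρ' - q • W') * (b * ρ - q • W)) := by
  simp only [sub_mul, mul_sub, smul_mul_assoc, mul_smul_comm, mul_assoc, h1, h2, h3, h4, h5, h6,
    h9, h10, mul_assoc_of_mul_eq h1, mul_assoc_of_mul_eq h2, mul_assoc_of_mul_eq h3,
    mul_assoc_of_mul_eq h4, mul_assoc_of_mul_eq h5, mul_assoc_of_mul_eq h6,
    mul_assoc_of_mul_eq h9, mul_assoc_of_mul_eq h10]
  match_scalars <;> (field_simp; try ring)

theorem rot_block_col (hq : q ≠ 0) (h1 : b' * b = q⁻¹ • (b * b'))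
    (h2 : ρ * b = q • (b * ρ) - (q ^ 2 - 1) • W) (h3 : ρ * b' = q • (b' * ρ) - (q ^ 2 - 1) • V)
    (h6 : V * W = q⁻¹ • (W * V)) (h7 : ρ * W = q⁻¹ • (W * ρ)) (h8 : ρ * V = q⁻¹ • (V * ρ))
    (h9 : W * b' = b' * W) (h10 : V * b = b * V - (q - q⁻¹) • (b' * W)) :
    (b * ρ - q • W) * (b' * ρ - q • V) = q • ((b' * ρ - q • V) * (b * ρ - q • W)) := by
  simp only [sub_mul, mul_sub, smul_mul_assoc, mul_smul_comm, mul_assoc, h1, h2, h3, h6, h7, h8,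
    h9, h10, mul_assoc_of_mul_eq h1, mul_assoc_of_mul_eq h2, mul_assoc_of_mul_eq h3,
    mul_assoc_of_mul_eq h6, mul_assoc_of_mul_eq h7, mul_assoc_of_mul_eq h8,
    mul_assoc_of_mul_eq h9, mul_assoc_of_mul_eq h10]
  match_scalars <;> (field_simp; try ring)

/-- Here `W, W'` and `V, V'` are the middle entries of an upper and a lower row. -/
theorem rot_block_anti_diag (hq : q ≠ 0) (h1 : b' * b = q⁻¹ • (b * b'))
    (h1' : ρ' * ρ = q⁻¹ • (ρ * ρ'))
    (h2 : ρ * b = q • (b * ρ) - (q ^ 2 - 1) • W) (h2' : ρ * b' = q • (b' * ρ) - (q ^ 2 - 1) • V)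
    (h3 : ρ' * b = q • (b * ρ') - (q ^ 2 - 1) • W')
    (h3' : ρ' * b' = q • (b' * ρ') - (q ^ 2 - 1) • V')
    (h6 : W * b' = b' * W) (h6' : W' * b' = b' * W')
    (h7 : V * b = b * V - (q - q⁻¹) • (b' * W)) (h7' : V' * b = b * V' - (q - q⁻¹) • (b' * W'))
    (h10 : ρ * W' = W' * ρ) (h10' : ρ * V' = V' * ρ)
    (h11 : ρ' * W = W * ρ' - (q - q⁻¹) • (W' * ρ))
    (h11' : ρ' * V = V * ρ' - (q - q⁻¹) • (V' * ρ))
    (h12 : V * W' = W' * V) (h13 : V' * W = W * V' - (q - q⁻¹) • (W' * V)) :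
    (b' * ρ - q • V) * (b * ρ' - q • W') = (b * ρ' - q • W') * (b' * ρ - q • V) ∧
    (b * ρ - q • W) * (b' * ρ' - q • V') - (b' * ρ' - q • V') * (b * ρ - q • W) =
      (q - q⁻¹) • ((b * ρ' - q • W') * (b' * ρ - q • V)) := by
  constructor
  · simp only [sub_mul, mul_sub, smul_mul_assoc, mul_smul_comm, mul_assoc, h1, h1', h2, h2', h3,
      h3', h6, h6', h7, h7', h10, h10', h11, h11', h12, h13, mul_assoc_of_mul_eq h1,
      mul_assoc_of_mul_eq h1', mul_assoc_of_mul_eq h2, mul_assoc_of_mul_eq h2',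
      mul_assoc_of_mul_eq h3, mul_assoc_of_mul_eq h3', mul_assoc_of_mul_eq h6,
      mul_assoc_of_mul_eq h6', mul_assoc_of_mul_eq h7, mul_assoc_of_mul_eq h7',
      mul_assoc_of_mul_eq h10, mul_assoc_of_mul_eq h10', mul_assoc_of_mul_eq h11,
      mul_assoc_of_mul_eq h11', mul_assoc_of_mul_eq h12, mul_assoc_of_mul_eq h13]
    match_scalars <;> (field_simp; try ring)
  · simp only [sub_mul, mul_sub, smul_mul_assoc, mul_smul_comm, mul_assoc, h1, h1', h2, h2', h3,
      h3', h6, h6', h7, h7', h10, h10', h11, h11', h12, h13, mul_assoc_of_mul_eq h1,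
      mul_assoc_of_mul_eq h1', mul_assoc_of_mul_eq h2, mul_assoc_of_mul_eq h2',
      mul_assoc_of_mul_eq h3, mul_assoc_of_mul_eq h3', mul_assoc_of_mul_eq h6,
      mul_assoc_of_mul_eq h6', mul_assoc_of_mul_eq h7, mul_assoc_of_mul_eq h7',
      mul_assoc_of_mul_eq h10, mul_assoc_of_mul_eq h10', mul_assoc_of_mul_eq h11,
      mul_assoc_of_mul_eq h11', mul_assoc_of_mul_eq h12, mul_assoc_of_mul_eq h13]
    match_scalars <;> (field_simp; try ring)

end Block

variable (hq : q ≠ 0) (hy : IsQMat q m N y) (huv : y (m - 1) 0 * v = 1) (hvu : v * y (m - 1) 0 = 1)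

include hy huv hvu

theorem rot_v_col {i : ℕ} (hi : i < m - 1) (hN : 0 < N) :
    v * y i 0 = q • (y i 0 * v) :=
  mul_eq_of_inverse_left huv hvu (hy.col i (m - 1) 0 hi (by omega) hN)

theorem rot_v_mid {i l : ℕ} (hi : i < m - 1) (hl : l + 1 < N) :
    v * y i (l + 1) = y i (l + 1) * v := by
  have := mul_eq_of_inverse_left (a := y i (l + 1)) (c := (1 : k)) huv hvu (by
    rw [one_smul]; exact (hy.anti i (m - 1) 0 (l + 1) hi (by omega) (by omega) hl).symm)
  rwa [one_smul] at this

theorem rot_row_mid_lt {i j l : ℕ} (hi : i < m - 1) (hjl : j < l) (hl : l + 1 < N) :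
    (y (m - 1) (j + 1) * v) * y i (l + 1) = y i (l + 1) * (y (m - 1) (j + 1) * v) := by
  rw [mul_assoc, rot_v_mid hy huv hvu hi hl, ← mul_assoc,
    hy.anti i (m - 1) (j + 1) (l + 1) hi (by omega) (by omega) hl, mul_assoc]

theorem rot_row_mid_gt {i j l : ℕ} (hi : i < m - 1) (hjl : j < l) (hl : l + 1 < N) :
    (y (m - 1) (l + 1) * v) * y i (j + 1) = y i (j + 1) * (y (m - 1) (l + 1) * v) -
      (q - q⁻¹) • (y i (l + 1) * (y (m - 1) (j + 1) * v)) := by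
  have h1 := rot_v_mid hy huv hvu (l := j) hi (by omega)
  have h2 := sub_eq_iff_eq_add.mp
    (hy.diag i (m - 1) (j + 1) (l + 1) hi (by omega) (by omega) hl)
  simp only [mul_assoc, h1, mul_assoc_of_mul_eq h2, smul_mul_assoc, add_mul]
  abel

include hq

theorem rot_v_row {l : ℕ} (hm : 0 < m) (hl : l + 1 < N) :
    v * y (m - 1) (l + 1) = q⁻¹ • (y (m - 1) (l + 1) * v) := by
  refine mul_eq_of_inverse_left huv hvu ?_
  rw [hy.row (m - 1) 0 (l + 1) (by omega) (by omega) hl, smul_smul, inv_mul_cancel₀ hq, one_smul]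

/-- Normalised entries `ρ_j = r_j v` of the pivot row. -/
theorem rot_row_row {j l : ℕ} (hm : 0 < m) (hjl : j < l) (hl : l + 1 < N) :
    (y (m - 1) (l + 1) * v) * (y (m - 1) (j + 1) * v) =
      q⁻¹ • ((y (m - 1) (j + 1) * v) * (y (m - 1) (l + 1) * v)) := by
  have h1 := rot_v_row hq hy huv hvu hm hl
  have h2 := rot_v_row hq hy huv hvu (l := j) hm (by omega)
  have h3 := hy.row (m - 1) (j + 1) (l + 1) (by omega) (by omega) hl
  simp only [mul_assoc, mul_assoc_of_mul_eq h1, mul_assoc_of_mul_eq h2, mul_assoc_of_mul_eq h3,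
    mul_smul_comm, smul_mul_assoc]
  match_scalars
  field_simp

theorem rot_row_col {i l : ℕ} (hi : i < m - 1) (hl : l + 1 < N) :
    (y (m - 1) (l + 1) * v) * y i 0 =
      q • (y i 0 * (y (m - 1) (l + 1) * v)) - (q ^ 2 - 1) • y i (l + 1) := by
  have h1 := rot_v_col hy huv hvu hi (by omega)
  have h2 := sub_eq_iff_eq_add.mp (hy.diag i (m - 1) 0 (l + 1) hi (by omega) (by omega) hl)
  simp only [mul_assoc, h1, mul_assoc_of_mul_eq h2, huv, mul_smul_comm, add_mul, smul_mul_assoc,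
    mul_one]
  match_scalars <;> (field_simp; try ring)

theorem rot_row_mid {i j : ℕ} (hi : i < m - 1) (hj : j + 1 < N) :
    (y (m - 1) (j + 1) * v) * y i (j + 1) = q⁻¹ • (y i (j + 1) * (y (m - 1) (j + 1) * v)) := by
  have h1 := rot_v_mid hy huv hvu hi hj
  have h2 := hy.col i (m - 1) (j + 1) hi (by omega) hj
  simp only [mul_assoc, h1, mul_assoc_of_mul_eq h2, smul_mul_assoc]
  match_scalars
  field_simp

theorem rot_v_nrow {l : ℕ} (hm : 0 < m) (hl : l + 1 < N) :
    v * (y (m - 1) (l + 1) * v) = q⁻¹ • ((y (m - 1) (l + 1) * v) * v) := by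
  rw [← mul_assoc, rot_v_row hq hy huv hvu hm hl, smul_mul_assoc]

/-- The rotation of a quantum matrix about an invertible lower left entry is a quantum matrix. Each
relation comes in four cases, as the rows and columns involved may include the first row and the last
column of the rotated matrix. -/
theorem rotMat_isQMat : IsQMat q m N (rotMat q m N y v) := by
  -- the relations between the first column and the columns after it, in the direction in which
  -- they bring products into normal order
  have col0 := fun i s (h : i < s) (hs : s < m) (hN : 0 < N) => hy.col i s 0 h hs hN
  have bb : ∀ i s, i < s → s < m → 0 < N → y s 0 * y i 0 = q⁻¹ • (y i 0 * y s 0) := by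
    intro i s h hs hN
    rw [hy.col i s 0 h hs hN, smul_smul, inv_mul_cancel₀ hq, one_smul]
  have Wb : ∀ i l, i < m → l + 1 < N → y i (l + 1) * y i 0 = q⁻¹ • (y i 0 * y i (l + 1)) := by
    intro i l hi hl
    rw [hy.row i 0 (l + 1) hi (by omega) hl, smul_smul, inv_mul_cancel₀ hq, one_smul]
  have Wb1 : ∀ i s l, i < s → s < m → l + 1 < N → y i (l + 1) * y s 0 = y s 0 * y i (l + 1) :=
    fun i s l h hs hl => (hy.anti i s 0 (l + 1) h hs (by omega) hl).symm
  have Wb2 : ∀ i s l, i < s → s < m → l + 1 < N → y s (l + 1) * y i 0 =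
      y i 0 * y s (l + 1) - (q - q⁻¹) • (y s 0 * y i (l + 1)) := by
    intro i s l h hs hl
    rw [← Wb1 i s l h hs hl, ← hy.diag i s 0 (l + 1) h hs (by omega) hl]
    abel
  have WWc : ∀ i s l, i < s → s < m → l + 1 < N →
      y s (l + 1) * y i (l + 1) = q⁻¹ • (y i (l + 1) * y s (l + 1)) := by
    intro i s l h hs hl
    rw [hy.col i s (l + 1) h hs hl, smul_smul, inv_mul_cancel₀ hq, one_smul]
  have WWr : ∀ i j l, i < m → j < l → l + 1 < N →
      y i (l + 1) * y i (j + 1) = q⁻¹ • (y i (j + 1) * y i (l + 1)) := by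
    intro i j l hi h hl
    rw [hy.row i (j + 1) (l + 1) hi (by omega) hl, smul_smul, inv_mul_cancel₀ hq, one_smul]
  have WWa : ∀ i s j l, i < s → s < m → j < l → l + 1 < N →
      y s (j + 1) * y i (l + 1) = y i (l + 1) * y s (j + 1) :=
    fun i s j l h hs h' hl => hy.anti i s (j + 1) (l + 1) h hs (by omega) hl
  have WWd : ∀ i s j l, i < s → s < m → j < l → l + 1 < N →
      y s (l + 1) * y i (j + 1) =
        y i (j + 1) * y s (l + 1) - (q - q⁻¹) • (y i (l + 1) * y s (j + 1)) := by
    intro i s j l h hs h' hl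
    rw [← hy.diag i s (j + 1) (l + 1) h hs (by omega) hl]
    abel
  have hr : ∀ j, j + 1 < N → rotMat q m N y v 0 j = y (m - 1) (j + 1) * v := fun j hj => if_pos hj
  have hv : ∀ j, ¬ j + 1 < N → rotMat q m N y v 0 j = v := fun j hj => if_neg hj
  have hw : ∀ i j, j + 1 < N → rotMat q m N y v (i + 1) j =
    y i 0 * (y (m - 1) (j + 1) * v) - q • y i (j + 1) := fun i j hj => if_pos hj
  have hb : ∀ i j, ¬ j + 1 < N → rotMat q m N y v (i + 1) j = y i 0 * v := fun i j hj => if_neg hj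
  constructor
  · intro i j l hi hjl hl
    have hj : j + 1 < N := by omega
    rcases i with _ | i
    · by_cases hl' : l + 1 < N
      · rw [hr j hj, hr l hl', rot_row_row hq hy huv hvu hi hjl hl', smul_smul,
          mul_inv_cancel₀ hq, one_smul]
      · rw [hr j hj, hv l hl', rot_v_nrow hq hy huv hvu hi hj, smul_smul, mul_inv_cancel₀ hq,
          one_smul]
    · have hi' : i < m - 1 := by omega
      by_cases hl' : l + 1 < N
      · rw [hw i j hj, hw i l hl']
        exact rot_block_row hq (rot_row_row hq hy huv hvu (by omega) hjl hl')
          (rot_row_col hq hy huv hvu hi' hj) (rot_row_col hq hy huv hvu hi' hl')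
          (Wb i j (by omega) hj) (Wb i l (by omega) hl') (WWr i j l (by omega) hjl hl')
          (rot_row_mid_lt hy huv hvu hi' hjl hl') (rot_row_mid_gt hy huv hvu hi' hjl hl')
      · rw [hw i j hj, hb i l hl']
        have e1 := rot_v_col hy huv hvu hi' (by omega)
        have e2 := rot_row_col hq hy huv hvu hi' hj
        have e3 := rot_v_nrow hq hy huv hvu (by omega) hj
        have e4 := rot_v_mid hy huv hvu hi' hj
        have e5 := Wb i j (by omega) hj
        generalize y (m - 1) (j + 1) * v = ρ at *
        simp only [sub_mul, mul_sub, smul_mul_assoc, mul_smul_comm, mul_assoc, e3, e4,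
          mul_assoc_of_mul_eq e1, mul_assoc_of_mul_eq e2, mul_assoc_of_mul_eq e5]
        match_scalars <;> (field_simp; try ring)
  · intro i s j his hs hj
    obtain ⟨s, rfl⟩ : ∃ s', s = s' + 1 := ⟨s - 1, by omega⟩
    have hs' : s < m - 1 := by omega
    rcases i with _ | i
    · by_cases hj' : j + 1 < N
      · rw [hr j hj', hw s j hj']
        have e2 := rot_row_col hq hy huv hvu hs' hj'
        have e3 := rot_row_mid hq hy huv hvu hs' hj'
        generalize y (m - 1) (j + 1) * v = ρ at *
        simp only [sub_mul, mul_sub, smul_mul_assoc, mul_smul_comm, mul_assoc,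
          mul_assoc_of_mul_eq e2, e3]
        match_scalars <;> (field_simp; try ring)
      · rw [hv j hj', hb s j hj', mul_assoc_of_mul_eq (rot_v_col hy huv hvu hs' (by omega)),
          smul_mul_assoc]
    · by_cases hj' : j + 1 < N
      · rw [hw i j hj', hw s j hj']
        have his' : i < s := by omega
        have hi' : i < m - 1 := by omega
        exact rot_block_col hq (bb i s his' (by omega) (by omega))
          (rot_row_col hq hy huv hvu hi' hj') (rot_row_col hq hy huv hvu hs' hj')
          (WWc i s j his' (by omega) hj') (rot_row_mid hq hy huv hvu hi' hj')
          (rot_row_mid hq hy huv hvu hs' hj') (Wb1 i s j his' (by omega) hj')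
          (Wb2 i s j his' (by omega) hj')
      · rw [hb i j hj', hb s j hj']
        have e1 := rot_v_col hy huv hvu hs' (by omega)
        have e2 := rot_v_col hy huv hvu (i := i) (by omega) (by omega)
        have e3 := bb i s (by omega) (by omega) (by omega)
        simp only [smul_mul_assoc, mul_smul_comm, mul_assoc, mul_assoc_of_mul_eq e1,
          mul_assoc_of_mul_eq e2, mul_assoc_of_mul_eq e3]
        match_scalars <;> (field_simp; try ring)
  · intro i s j l his hs hjl hl
    obtain ⟨s, rfl⟩ : ∃ s', s = s' + 1 := ⟨s - 1, by omega⟩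
    have hs' : s < m - 1 := by omega
    have hj : j + 1 < N := by omega
    have e0 := rot_v_mid hy huv hvu hs' hj
    have e1 := rot_v_col hy huv hvu hs' (by omega)
    have e2 := rot_v_nrow hq hy huv hvu (by omega) hj
    rcases i with _ | i
    · by_cases hl' : l + 1 < N
      · rw [hr l hl', hw s j hj]
        have e3 := rot_row_col hq hy huv hvu hs' hl'
        have e4 := rot_row_mid_gt hy huv hvu hs' hjl hl'
        have e5 := rot_row_row hq hy huv hvu (by omega) hjl hl'
        generalize y (m - 1) (j + 1) * v = ρ at *
        generalize y (m - 1) (l + 1) * v = ρ' at *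
        simp only [sub_mul, mul_sub, smul_mul_assoc, mul_smul_comm, mul_assoc,
          mul_assoc_of_mul_eq e3, e4, e5]
        match_scalars <;> (field_simp; try ring)
      · rw [hv l hl', hw s j hj]
        generalize y (m - 1) (j + 1) * v = ρ at *
        simp only [sub_mul, mul_sub, smul_mul_assoc, mul_smul_comm, mul_assoc,
          mul_assoc_of_mul_eq e1, e0, e2]
        match_scalars <;> (field_simp; try ring)
    · have his' : i < s := by omega
      have hi' : i < m - 1 := by omega
      by_cases hl' : l + 1 < N
      · rw [hw i l hl', hw s j hj]
        exact (rot_block_anti_diag hq (bb i s his' (by omega) (by omega))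
          (rot_row_row hq hy huv hvu (by omega) hjl hl')
          (rot_row_col hq hy huv hvu hi' hj) (rot_row_col hq hy huv hvu hs' hj)
          (rot_row_col hq hy huv hvu hi' hl') (rot_row_col hq hy huv hvu hs' hl')
          (Wb1 i s j his' (by omega) hj) (Wb1 i s l his' (by omega) hl')
          (Wb2 i s j his' (by omega) hj) (Wb2 i s l his' (by omega) hl')
          (rot_row_mid_lt hy huv hvu hi' hjl hl') (rot_row_mid_lt hy huv hvu hs' hjl hl')
          (rot_row_mid_gt hy huv hvu hi' hjl hl') (rot_row_mid_gt hy huv hvu hs' hjl hl')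
          (WWa i s j l his' (by omega) hjl hl') (WWd i s j l his' (by omega) hjl hl')).1
      · rw [hb i l hl', hw s j hj]
        have e3 := rot_row_col hq hy huv hvu hi' hj
        have e4 := Wb2 i s j his' (by omega) hj
        have e5 := bb i s his' (by omega) (by omega)
        generalize y (m - 1) (j + 1) * v = ρ at *
        simp only [sub_mul, mul_sub, smul_mul_assoc, mul_smul_comm, mul_assoc,
          mul_assoc_of_mul_eq e1, e0, e2, mul_assoc_of_mul_eq e3, mul_assoc_of_mul_eq e4,
          mul_assoc_of_mul_eq e5]
        match_scalars <;> (field_simp; try ring)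
  · intro i s j l his hs hjl hl
    obtain ⟨s, rfl⟩ : ∃ s', s = s' + 1 := ⟨s - 1, by omega⟩
    have hs' : s < m - 1 := by omega
    have hj : j + 1 < N := by omega
    have e0 := rot_v_mid hy huv hvu hs' hj
    have e1 := rot_v_col hy huv hvu hs' (by omega)
    have e2 := rot_v_nrow hq hy huv hvu (by omega) hj
    rcases i with _ | i
    · by_cases hl' : l + 1 < N
      · rw [hr l hl', hr j hj, hw s j hj, hw s l hl']
        have e3 := rot_row_col hq hy huv hvu hs' hl'
        have e3' := rot_row_col hq hy huv hvu hs' hj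
        have e4 := rot_row_mid_gt hy huv hvu hs' hjl hl'
        have e4' := rot_row_mid_lt hy huv hvu hs' hjl hl'
        have e5 := rot_row_row hq hy huv hvu (by omega) hjl hl'
        generalize y (m - 1) (j + 1) * v = ρ at *
        generalize y (m - 1) (l + 1) * v = ρ' at *
        simp only [sub_mul, mul_sub, smul_mul_assoc, mul_smul_comm, mul_assoc,
          mul_assoc_of_mul_eq e3, mul_assoc_of_mul_eq e3', e4, e4', e5]
        match_scalars <;> (field_simp; try ring)
      · rw [hv l hl', hr j hj, hw s j hj, hb s l hl']
        have e3 := rot_row_col hq hy huv hvu hs' hj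
        generalize y (m - 1) (j + 1) * v = ρ at *
        simp only [sub_mul, mul_sub, smul_mul_assoc, mul_smul_comm, mul_assoc,
          mul_assoc_of_mul_eq e1, e0, e2, mul_assoc_of_mul_eq e3]
        match_scalars <;> (field_simp; try ring)
    · have his' : i < s := by omega
      have hi' : i < m - 1 := by omega
      by_cases hl' : l + 1 < N
      · rw [hw i l hl', hw s j hj, hw i j hj, hw s l hl']
        exact (rot_block_anti_diag hq (bb i s his' (by omega) (by omega))
          (rot_row_row hq hy huv hvu (by omega) hjl hl')
          (rot_row_col hq hy huv hvu hi' hj) (rot_row_col hq hy huv hvu hs' hj)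
          (rot_row_col hq hy huv hvu hi' hl') (rot_row_col hq hy huv hvu hs' hl')
          (Wb1 i s j his' (by omega) hj) (Wb1 i s l his' (by omega) hl')
          (Wb2 i s j his' (by omega) hj) (Wb2 i s l his' (by omega) hl')
          (rot_row_mid_lt hy huv hvu hi' hjl hl') (rot_row_mid_lt hy huv hvu hs' hjl hl')
          (rot_row_mid_gt hy huv hvu hi' hjl hl') (rot_row_mid_gt hy huv hvu hs' hjl hl')
          (WWa i s j l his' (by omega) hjl hl') (WWd i s j l his' (by omega) hjl hl')).2
      · rw [hb i l hl', hw s j hj, hw i j hj, hb s l hl']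
        have e1' := rot_v_col hy huv hvu hi' (by omega)
        have e0' := rot_v_mid hy huv hvu hi' hj
        have e3 := rot_row_col hq hy huv hvu hi' hj
        have e3' := rot_row_col hq hy huv hvu hs' hj
        have e4 := Wb2 i s j his' (by omega) hj
        have e5 := bb i s his' (by omega) (by omega)
        have e6 := Wb1 i s j his' (by omega) hj
        generalize y (m - 1) (j + 1) * v = ρ at *
        simp only [sub_mul, mul_sub, smul_mul_assoc, mul_smul_comm, mul_assoc,
          mul_assoc_of_mul_eq e1, mul_assoc_of_mul_eq e1', e0, e0', e2,
          mul_assoc_of_mul_eq e3', mul_assoc_of_mul_eq e5, mul_assoc_of_mul_eq e6]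
        match_scalars <;> (field_simp; try ring)

end Rotation

/-! ### Minors of the rotated matrix -/

section RotationMinors

variable {k : Type*} [Field k] {q : k} {R : Type*} [Ring R] [Algebra k R]
variable {m N : ℕ} {y : ℕ → ℕ → R} {v : R}

/-- The set of rows shifted by one. -/
def shiftRows (E : Finset ℕ) : Finset ℕ := E.map (addRightEmbedding 1)

theorem mem_shiftRows {E : Finset ℕ} {i : ℕ} : i ∈ shiftRows E ↔ ∃ i' ∈ E, i' + 1 = i := by
  simp [shiftRows]

theorem shiftRows_erase (E : Finset ℕ) (i : ℕ) :
    (shiftRows E).erase (i + 1) = shiftRows (E.erase i) := by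
  ext s
  simp only [Finset.mem_erase, mem_shiftRows]
  constructor
  · rintro ⟨h, s, hs, rfl⟩
    exact ⟨s, ⟨fun h' => h (by rw [h']), hs⟩, rfl⟩
  · rintro ⟨s, ⟨h, hs⟩, rfl⟩
    exact ⟨fun h' => h (by omega), s, hs, rfl⟩

theorem zero_notMem_shiftRows (E : Finset ℕ) : 0 ∉ shiftRows E := by
  simp [mem_shiftRows]

theorem card_filter_shiftRows (E : Finset ℕ) (i : ℕ) :
    ((shiftRows E).filter (· < i + 1)).card = (E.filter (· < i)).card := by
  rw [shiftRows, Finset.filter_map, Finset.card_map]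
  congr 1
  ext s
  simp

/-- Laplace expansion along the first column, for rows shifted by one. -/
theorem qdet_cons_shiftRows (j : ℕ) (c : List ℕ) (E : Finset ℕ) :
    qdet q y (j :: c) (shiftRows E) = ∑ i ∈ E, (-q) ^ (E.filter (· < i)).card •
      (y (i + 1) j * qdet q y c (shiftRows (E.erase i))) := by
  rw [qdet_cons]
  conv_lhs => rw [shiftRows]
  rw [Finset.sum_map]
  refine Finset.sum_congr rfl fun i _ => ?_
  rw [addRightEmbedding_apply, ← shiftRows_erase, ← card_filter_shiftRows E]
  rfl

theorem qdet_cons_insert_zero (j : ℕ) (c : List ℕ) (E : Finset ℕ) :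
    qdet q y (j :: c) (insert 0 (shiftRows E)) =
      y 0 j * qdet q y c (shiftRows E) + (-q) • ∑ i ∈ E, (-q) ^ (E.filter (· < i)).card •
        (y (i + 1) j * qdet q y c (insert 0 (shiftRows (E.erase i)))) := by
  rw [qdet_cons, Finset.sum_insert (zero_notMem_shiftRows E)]
  congr 1
  · rw [Finset.erase_insert (zero_notMem_shiftRows E)]
    simp
  · conv_lhs => arg 1; rw [shiftRows]
    rw [Finset.sum_map, Finset.smul_sum]
    refine Finset.sum_congr rfl fun i _ => ?_
    rw [addRightEmbedding_apply, Finset.erase_insert_of_ne (by omega), shiftRows_erase, smul_smul,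
      Finset.filter_insert, if_pos (Nat.succ_pos i), Finset.card_insert_of_notMem,
      card_filter_shiftRows, pow_succ']
    simp [zero_notMem_shiftRows]

theorem qdet_cons_insert_last (j : ℕ) (c : List ℕ) {E : Finset ℕ} {p : ℕ} (hE : ∀ i ∈ E, i < p) :
    qdet q y (j :: c) (insert p E) =
      ∑ i ∈ E, (-q) ^ (E.filter (· < i)).card • (y i j * qdet q y c (insert p (E.erase i))) +
        (-q) ^ E.card • (y p j * qdet q y c E) := by
  have hp : p ∉ E := fun h => lt_irrefl _ (hE p h)
  rw [qdet_cons, Finset.sum_insert hp, add_comm]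
  congr 1
  · refine Finset.sum_congr rfl fun i hi => ?_
    have := hE i hi
    rw [Finset.erase_insert_of_ne (by omega), Finset.filter_insert, if_neg (by omega)]
  · rw [Finset.erase_insert hp, Finset.filter_insert, if_neg (lt_irrefl p),
      Finset.filter_true_of_mem hE]

variable (hq : q ≠ 0) (hy : IsQMat q m N y) (huv : y (m - 1) 0 * v = 1)
  (hvu : v * y (m - 1) 0 = 1)

include hq hy huv hvu

/-- A Laplace expansion with coefficients from the rotated matrix, in terms of expansions along the
first column and along the column `j + 1` of the original matrix. -/
theorem sum_rotMat_mul {E : Finset ℕ} (hE : ∀ i ∈ E, i < m - 1) {j : ℕ} (hj : j + 1 < N)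
    (a : ℕ → k) (X : ℕ → R) :
    ∑ i ∈ E, a i • (rotMat q m N y v (i + 1) j * (X i * v)) =
      (q⁻¹ • (y (m - 1) (j + 1) * v * ∑ i ∈ E, a i • (y i 0 * X i)) -
        q⁻¹ • ∑ i ∈ E, a i • (y i (j + 1) * X i)) * v := by
  rw [Finset.mul_sum, Finset.smul_sum, Finset.smul_sum, ← Finset.sum_sub_distrib, Finset.sum_mul]
  refine Finset.sum_congr rfl fun i hi => ?_
  have h := rot_row_col hq hy huv hvu (hE i hi) hj
  have h' : rotMat q m N y v (i + 1) j =
      q⁻¹ • (y (m - 1) (j + 1) * v * y i 0) - q⁻¹ • y i (j + 1) := by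
    rw [h]
    simp only [rotMat, if_pos hj]
    match_scalars <;> (field_simp; try ring)
  rw [h']
  simp only [sub_mul, smul_mul_assoc, mul_smul_comm, mul_assoc]
  match_scalars <;> ring

/-- Minors of the rotated matrix which do not involve its last column: they are minors of the
original matrix which involve the pivot row, divided by the pivot. -/
theorem qdet_rotMat (hm : 0 < m) {E : Finset ℕ} (hE : ∀ i ∈ E, i < m - 1) {c : List ℕ}
    (hc : ∀ j ∈ c, j + 1 < N) :
    qdet q (rotMat q m N y v) c (shiftRows E) =
        qdet q y (0 :: c.map (· + 1)) (insert (m - 1) E) * v ∧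
      qdet q (rotMat q m N y v) c (insert 0 (shiftRows E)) =
        qdet q y (c.map (· + 1)) (insert (m - 1) E) * v := by
  induction c generalizing E with
  | nil =>
    constructor
    · rw [List.map_nil]
      by_cases h : E = ∅
      · subst h
        simp [qdet_cons, qdet_nil, shiftRows, huv, Finset.filter_singleton]
      · rw [qdet_eq_zero, qdet_eq_zero, zero_mul]
        · rw [Finset.card_insert_of_notMem fun h' => lt_irrefl _ (hE _ h')]
          simpa using h
        · simpa [shiftRows] using h
    · rw [List.map_nil, qdet_eq_zero, qdet_eq_zero, zero_mul]
      · simp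
      · simp
  | cons j c ih =>
    have hj : j + 1 < N := hc j (by simp)
    have hlast : ∀ i ∈ insert (m - 1) E, i < m := by
      intro i hi
      rcases Finset.mem_insert.mp hi with rfl | hi
      · omega
      · have := hE i hi
        omega
    have ih' := fun i => ih (E := E.erase i)
      (fun i' hi' => hE i' (Finset.mem_of_mem_erase hi'))
      fun j' hj' => hc j' (List.mem_cons_of_mem _ hj')
    have ihE := ih hE fun j' hj' => hc j' (List.mem_cons_of_mem _ hj')
    have hρ : ∀ x, y (m - 1) (j + 1) * (v * (y (m - 1) 0 * x)) = y (m - 1) (j + 1) * x := by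
      intro x
      rw [← mul_assoc v, hvu, one_mul]
    have h0 := fun c' => qdet_cons_insert_last (q := q) (y := y) 0 c' hE
    have h1 := fun c' => qdet_cons_insert_last (q := q) (y := y) (j + 1) c' hE
    -- the sums over `E` given by `sum_rotMat_mul` are minors up to the term of the pivot row; two of
    -- these minors have equal columns `0`, or columns `j + 1` and `0` in the wrong order
    simp only [List.map_cons]
    constructor
    · rw [qdet_cons_shiftRows, Finset.sum_congr rfl fun i hi => by rw [(ih' i).1],
        sum_rotMat_mul hq hy huv hvu hE hj, ← sub_eq_iff_eq_add.mpr (h0 _),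
        ← sub_eq_iff_eq_add.mpr (h1 _), hy.qdet_self hq (by omega) _ hlast,
        hy.qdet_swap hq (l := j + 1) (by omega) hj _ hlast]
      congr 1
      simp only [mul_sub, mul_smul_comm, mul_assoc, hρ, mul_zero]
      match_scalars <;> (field_simp; try ring)
    · rw [qdet_cons_insert_zero, Finset.sum_congr rfl fun i hi => by rw [(ih' i).2],
        sum_rotMat_mul hq hy huv hvu hE hj, ← sub_eq_iff_eq_add.mpr (h0 _),
        ← sub_eq_iff_eq_add.mpr (h1 _), ihE.1, ← smul_mul_assoc, ← mul_assoc, ← add_mul]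
      congr 1
      simp only [rotMat, if_pos hj, mul_sub, mul_smul_comm, mul_assoc, hρ]
      match_scalars <;> (field_simp; try ring)

/-- Minors of the rotated matrix which involve its last column: they are minors of the original
matrix which do not involve the pivot row, divided by the pivot. -/
theorem qdet_rotMat_append (hN : 0 < N) {E : Finset ℕ} (hE : ∀ i ∈ E, i < m - 1)
    {c : List ℕ} (hc : ∀ j ∈ c, j + 1 < N) :
    qdet q (rotMat q m N y v) (c ++ [N - 1]) (shiftRows E) =
        qdet q y (0 :: c.map (· + 1)) E * v ∧
      qdet q (rotMat q m N y v) (c ++ [N - 1]) (insert 0 (shiftRows E)) =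
        qdet q y (c.map (· + 1)) E * v := by
  have hN1 : ¬ N - 1 + 1 < N := by omega
  induction c generalizing E with
  | nil =>
    constructor
    · rw [List.map_nil, List.nil_append, qdet_cons_shiftRows, qdet_cons, Finset.sum_mul]
      refine Finset.sum_congr rfl fun i hi => ?_
      have : shiftRows (E.erase i) = ∅ ↔ E.erase i = ∅ := Finset.map_eq_empty
      simp only [qdet_nil, this, rotMat, if_neg hN1]
      split_ifs <;> simp
    · rw [List.map_nil, List.nil_append]
      by_cases h : E = ∅
      · subst h
        simp [qdet_cons, qdet_nil, shiftRows, rotMat, hN1]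
      · rw [qdet_eq_zero, qdet_eq_zero, zero_mul]
        · simpa using h
        · rw [Finset.card_insert_of_notMem (zero_notMem_shiftRows E)]
          simpa [shiftRows] using h
  | cons j c ih =>
    have hj : j + 1 < N := hc j (by simp)
    have hE' : ∀ i ∈ E, i < m := fun i hi => by have := hE i hi; omega
    have ih' := fun i => ih (E := E.erase i)
      (fun i' hi' => hE i' (Finset.mem_of_mem_erase hi'))
      fun j' hj' => hc j' (List.mem_cons_of_mem _ hj')
    have ihE := ih hE fun j' hj' => hc j' (List.mem_cons_of_mem _ hj')
    have h0 := fun c' => qdet_cons (q := q) (y := y) 0 c' E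
    have h1 := fun c' => qdet_cons (q := q) (y := y) (j + 1) c' E
    -- without the pivot row, the sums over `E` given by `sum_rotMat_mul` are minors
    simp only [List.map_cons, List.cons_append]
    constructor
    · rw [qdet_cons_shiftRows, Finset.sum_congr rfl fun i hi => by rw [(ih' i).1],
        sum_rotMat_mul hq hy huv hvu hE hj, ← h0, ← h1, hy.qdet_self hq (by omega) _ hE',
        hy.qdet_swap hq (l := j + 1) (by omega) hj _ hE']
      congr 1
      rw [mul_zero]
      match_scalars <;> (field_simp; try ring)
    · rw [qdet_cons_insert_zero, Finset.sum_congr rfl fun i hi => by rw [(ih' i).2],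
        sum_rotMat_mul hq hy huv hvu hE hj, ← h0, ← h1, ihE.1, ← smul_mul_assoc, ← mul_assoc,
        ← add_mul]
      congr 1
      simp only [rotMat, if_pos hj]
      match_scalars <;> (field_simp; try ring)

end RotationMinors

/-! ### Rotating the index sets -/

section RotationStates

theorem sort_eq_of_pairwise {J : Finset ℕ} {l : List ℕ} (hl : l.Pairwise (· < ·))
    (h : ∀ x, x ∈ l ↔ x ∈ J) : J.sort = l := by
  have hJ : J = l.toFinset := by ext x; simp [h]
  rw [hJ]
  exact (List.toFinset_sort _ (hl.imp fun h => h.ne)).mpr (hl.imp fun h => h.le)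

theorem pairwise_lt_sort (J : Finset ℕ) : J.sort.Pairwise (· < ·) :=
  (J.sortedLT_sort).pairwise

theorem sort_shiftRows (F : Finset ℕ) : (shiftRows F).sort = F.sort.map (· + 1) := by
  refine sort_eq_of_pairwise ?_ fun x => ?_
  · rw [List.pairwise_map]
    exact (pairwise_lt_sort F).imp fun h => by omega
  · simp [mem_shiftRows]

theorem sort_insert_zero_shiftRows (F : Finset ℕ) :
    (insert 0 (shiftRows F)).sort = 0 :: F.sort.map (· + 1) := by
  refine sort_eq_of_pairwise ?_ fun x => ?_
  · rw [← sort_shiftRows, List.pairwise_cons]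
    refine ⟨fun x hx => ?_, pairwise_lt_sort _⟩
    obtain ⟨x', -, rfl⟩ := mem_shiftRows.mp ((Finset.mem_sort _).mp hx)
    omega
  · simp [mem_shiftRows]

theorem sort_insert_last {F : Finset ℕ} {p : ℕ} (h : ∀ j ∈ F, j < p) :
    (insert p F).sort = F.sort ++ [p] := by
  refine sort_eq_of_pairwise ?_ fun x => ?_
  · rw [List.pairwise_append]
    refine ⟨pairwise_lt_sort _, List.pairwise_singleton _ _, fun x hx z hz => ?_⟩
    rw [List.mem_singleton.mp hz]
    exact h x ((Finset.mem_sort _).mp hx)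
  · simp [or_comm]

/-- The index set `Q(I,J)` for the first column `a`, in terms of natural numbers: of the positions
`s < n` counted cyclically from `a`, those in `[0, m)` are kept unless removed by a row in `I`, and
those in `[m, n)` are added by a column in `J`. -/
def cycSet (n m a : ℕ) (I J : Finset ℕ) : Finset ℕ :=
  ((Finset.range n).filter fun s => (s < m ∧ m - 1 - s ∉ I) ∨ (m ≤ s ∧ s - m ∈ J)).image
    fun s => (a + s) % n

theorem mem_cycSet {n m a : ℕ} {I J : Finset ℕ} {x : ℕ} : x ∈ cycSet n m a I J ↔
    ∃ s < n, ((s < m ∧ m - 1 - s ∉ I) ∨ (m ≤ s ∧ s - m ∈ J)) ∧ (a + s) % n = x := by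
  simp [cycSet, and_assoc]

/-- Rotating the first column by one step amounts to rotating rows and columns by one step. -/
theorem cycSet_succ {m N a : ℕ} (hm : 0 < m) (hN : 0 < N) {I J I' J' : Finset ℕ}
    (h1 : ∀ i, i < m - 1 → (i ∈ I' ↔ i + 1 ∈ I)) (h2 : m - 1 ∈ I' ↔ N - 1 ∉ J)
    (h3 : 0 ∈ J' ↔ 0 ∉ I) (h4 : ∀ j, j + 1 < N → (j + 1 ∈ J' ↔ j ∈ J)) :
    cycSet (m + N) m (a + 1) I J = cycSet (m + N) m a I' J' := by
  have key : ∀ s < m + N, ((s < m ∧ m - 1 - s ∉ I) ∨ (m ≤ s ∧ s - m ∈ J)) ↔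
      let s' := if s + 1 < m + N then s + 1 else 0
      (s' < m ∧ m - 1 - s' ∉ I') ∨ (m ≤ s' ∧ s' - m ∈ J') := by
    intro s hs
    by_cases hs1 : s + 1 < m + N
    · simp only [if_pos hs1]
      by_cases hs2 : s + 1 < m
      · have e := h1 (m - 1 - (s + 1)) (by omega)
        rw [show m - 1 - (s + 1) + 1 = m - 1 - s by omega] at e
        have a1 : s < m := by omega
        have a2 : ¬ m ≤ s := by omega
        have a3 : ¬ m ≤ s + 1 := by omega
        simp [a1, a2, a3, hs2, e]
      · by_cases hs3 : s + 1 = m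
        · have a1 : s < m := by omega
          have a2 : ¬ m ≤ s := by omega
          have a3 : m ≤ s + 1 := by omega
          rw [show m - 1 - s = 0 by omega, show s + 1 - m = 0 by omega, h3]
          simp [a1, a2, a3, hs2]
        · have a1 : ¬ s < m := by omega
          have a2 : m ≤ s := by omega
          have a3 : m ≤ s + 1 := by omega
          have e := h4 (s - m) (by omega)
          rw [show s - m + 1 = s + 1 - m by omega] at e
          simp [a1, a2, a3, hs2, e]
    · simp only [if_neg hs1]
      have a1 : ¬ s < m := by omega
      have a2 : m ≤ s := by omega
      have a3 : ¬ m ≤ 0 := by omega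
      rw [Nat.sub_zero, h2, show s - m = N - 1 by omega]
      simp [a1, a2, a3, hm]
  ext x
  rw [mem_cycSet, mem_cycSet]
  constructor
  · rintro ⟨s, hs, h, rfl⟩
    refine ⟨if s + 1 < m + N then s + 1 else 0, ?_, (key s hs).mp h, ?_⟩
    · split_ifs <;> omega
    · split_ifs with h'
      · congr 1; omega
      · rw [show a + 1 + s = a + 0 + (m + N) by omega, Nat.add_mod_right]
  · rintro ⟨s', hs', h, rfl⟩
    rcases s' with _ | s
    · refine ⟨m + N - 1, by omega, (key _ (by omega)).mpr ?_, ?_⟩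
      · rwa [if_neg (by omega)]
      · rw [show a + 1 + (m + N - 1) = a + 0 + (m + N) by omega, Nat.add_mod_right]
    · refine ⟨s, by omega, (key _ (by omega)).mpr ?_, ?_⟩
      · rwa [if_pos hs']
      · congr 1; omega

variable {k : Type*} [Field k] (q : k) {R : Type*} [Ring R] [Algebra k R]

variable (k) in
/-- Two elements commute up to a nonzero scalar. -/
def ScalarCommute (x y : R) : Prop := ∃ c : k, c ≠ 0 ∧ x * y = c • (y * x)

theorem ScalarCommute.mul_left {x x' y : R} (h : ScalarCommute k x y)
    (h' : ScalarCommute k x' y) : ScalarCommute k (x * x') y := by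
  obtain ⟨c, hc, h⟩ := h
  obtain ⟨c', hc', h'⟩ := h'
  refine ⟨c' * c, mul_ne_zero hc' hc, ?_⟩
  rw [mul_assoc, h', mul_smul_comm, ← mul_assoc, h, smul_mul_assoc, smul_smul, mul_assoc]

theorem ScalarCommute.symm {x y : R} (h : ScalarCommute k x y) : ScalarCommute k y x := by
  obtain ⟨c, hc, h⟩ := h
  exact ⟨c⁻¹, inv_ne_zero hc, by rw [h, smul_smul, inv_mul_cancel₀ hc, one_smul]⟩

theorem ScalarCommute.mul_right {x y y' : R} (h : ScalarCommute k x y)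
    (h' : ScalarCommute k x y') : ScalarCommute k x (y * y') :=
  (h.symm.mul_left h'.symm).symm

theorem ScalarCommute.inv_right {x y v : R} (h : ScalarCommute k x y) (hyv : y * v = 1)
    (hvy : v * y = 1) : ScalarCommute k x v := by
  obtain ⟨c, hc, h⟩ := h
  have := mul_eq_of_inverse_left hyv hvy h
  exact ScalarCommute.symm ⟨c, hc, this⟩

theorem ScalarCommute.refl (x : R) : ScalarCommute k x x := ⟨1, one_ne_zero, by simp⟩

theorem ScalarCommute.one_left (x : R) : ScalarCommute k 1 x := ⟨1, one_ne_zero, by simp⟩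

/-- The family `P`, indexed by sets of columns, is described by the quantum matrix `y` from the
first column `a`: the minors of `y` are the quotients of the values of `P` by its value at the
consecutive set starting at `a`, and this value commutes with the minors up to scalars. -/
structure RotState (m N a : ℕ) (y : ℕ → ℕ → R) (P : Finset ℕ → R) : Prop where
  qmat : IsQMat q m N y
  minor : ∀ I J : Finset ℕ, I ⊆ Finset.range m → J ⊆ Finset.range N → I.card = J.card →
    qdet q y J.sort I * P (cycSet (m + N) m a ∅ ∅) = P (cycSet (m + N) m a I J)
  comm : ∀ I J : Finset ℕ, I ⊆ Finset.range m → J ⊆ Finset.range N → I.card = J.card →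
    ScalarCommute k (P (cycSet (m + N) m a ∅ ∅)) (qdet q y J.sort I)

variable {q} {m N a : ℕ} {y : ℕ → ℕ → R} {P : Finset ℕ → R}

/-- The lower left entry of a quantum matrix commutes with all minors up to scalars. -/
theorem IsQMat.scalarCommute_corner (hy : IsQMat q m N y) (hq : q ≠ 0) {I : Finset ℕ}
    (hI : I ⊆ Finset.range m) {c : List ℕ} (hc : ∀ j ∈ c, j < N) :
    ScalarCommute k (y (m - 1) 0) (qdet q y c I) := by
  refine ⟨(∏ i ∈ I, if i = m - 1 then q else 1) *
    (c.map fun j => if j = 0 then q⁻¹ else 1).prod, mul_ne_zero ?_ ?_,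
    mul_qdet (α := fun i => if i = m - 1 then q else 1)
      (β := fun j => if j = 0 then q⁻¹ else 1) fun i hi j hj => ?_⟩
  · exact Finset.prod_ne_zero_iff.mpr fun i _ => by split_ifs <;> simp [hq]
  · refine List.prod_ne_zero ?_
    intro h
    obtain ⟨j, -, hj⟩ := List.mem_map.mp h
    revert hj
    split_ifs <;> simp [hq]
  · have hi' := Finset.mem_range.mp (hI hi)
    have hj' := hc j hj
    by_cases h1 : i = m - 1 <;> by_cases h2 : j = 0
    · subst h1 h2
      simp [hq]
    · subst h1
      rw [if_pos rfl, if_neg h2, mul_one]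
      exact hy.row _ _ _ (by omega) (by omega) hj'
    · subst h2
      rw [if_neg h1, if_pos rfl, one_mul, hy.col i (m - 1) 0 (by omega) (by omega) hj', smul_smul,
        inv_mul_cancel₀ hq, one_smul]
    · rw [if_neg h1, if_neg h2, one_mul, one_smul]
      exact hy.anti i (m - 1) 0 j (by omega) (by omega) (by omega) hj'

/-- One step of rotation. The pivot is the quotient of the values of `P` at the consecutive sets
starting at `a + 1` and `a`, so it is invertible, and dividing by it replaces the denominator
of all quotients. -/
theorem RotState.succ (hs : RotState q m N a y P) (hq : q ≠ 0) (hm : 0 < m) (hN : 0 < N)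
    (hP : IsUnit (P (cycSet (m + N) m a ∅ ∅))) (hP' : IsUnit (P (cycSet (m + N) m (a + 1) ∅ ∅))) :
    ∃ y', RotState q m N (a + 1) y' P := by
  set M := cycSet (m + N) m a ∅ ∅ with hM
  set M' := cycSet (m + N) m (a + 1) ∅ ∅ with hM'
  have hcorner : qdet q y (Finset.sort {0}) {m - 1} = y (m - 1) 0 := by
    simp [qdet_cons, qdet_nil, Finset.filter_singleton]
  have hu : y (m - 1) 0 * P M = P M' := by
    rw [← hcorner, hs.minor {m - 1} {0} (by simpa using hm) (by simpa using hN) (by simp), hM',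
      cycSet_succ hm hN (I' := {m - 1}) (J' := {0})] <;> simp
    omega
  have hcomm_u : ScalarCommute k (P M) (y (m - 1) 0) := by
    rw [← hcorner]
    exact hs.comm {m - 1} {0} (by simpa using hm) (by simpa using hN) (by simp)
  obtain ⟨v, huv, hvu⟩ : ∃ v, y (m - 1) 0 * v = 1 ∧ v * y (m - 1) 0 = 1 := by
    have h : IsUnit (y (m - 1) 0) := by
      obtain ⟨w, hw⟩ := hP
      rw [show y (m - 1) 0 = P M' * (↑w⁻¹ : R) by rw [← hu, ← hw, mul_assoc, Units.mul_inv,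
        mul_one]]
      exact hP'.mul w⁻¹.isUnit
    exact ⟨(↑h.unit⁻¹ : R), h.mul_val_inv, h.val_inv_mul⟩
  -- every minor of the rotated matrix is a minor of the original matrix divided by the pivot
  have key : ∀ I J : Finset ℕ, I ⊆ Finset.range m → J ⊆ Finset.range N → I.card = J.card →
      ∃ I' J' : Finset ℕ, I' ⊆ Finset.range m ∧ J' ⊆ Finset.range N ∧ I'.card = J'.card ∧
        qdet q (rotMat q m N y v) J.sort I = qdet q y J'.sort I' * v ∧
        cycSet (m + N) m (a + 1) I J = cycSet (m + N) m a I' J' := by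
    intro I J hI hJ hIJ
    -- `E` and `F` are the rows and columns coming from outside the pivot row and column
    set E := (Finset.range (m - 1)).filter fun i => i + 1 ∈ I with hE
    set F := J.erase (N - 1) with hF
    have hE1 : ∀ i ∈ E, i < m - 1 := fun i hi => Finset.mem_range.mp (Finset.mem_filter.mp hi).1
    have hE2 : ∀ i, i < m - 1 → (i ∈ E ↔ i + 1 ∈ I) := fun i hi => by simp [hE, hi]
    have hF1 : ∀ j ∈ F, j + 1 < N := by
      intro j hj
      have h1 := Finset.mem_range.mp (hJ (Finset.mem_of_mem_erase hj))
      have h2 := Finset.ne_of_mem_erase hj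
      omega
    have hF2 : ∀ j ∈ F, j < N - 1 := fun j hj => by have := hF1 j hj; omega
    have hF3 : ∀ j, j + 1 < N → (j ∈ F ↔ j ∈ J) := fun j hj => by
      rw [hF, Finset.mem_erase, and_iff_right (by omega)]
    have hF4 : ∀ j ∈ F.sort, j + 1 < N := fun j hj => hF1 j ((Finset.mem_sort _).mp hj)
    have hIE : I = if 0 ∈ I then insert 0 (shiftRows E) else shiftRows E := by
      ext i
      rcases i with _ | i
      · split_ifs with h <;> simp [h, mem_shiftRows]
      · have h1 : i + 1 ∈ I ↔ i + 1 ∈ shiftRows E := by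
          rw [mem_shiftRows]
          constructor
          · intro h
            have := Finset.mem_range.mp (hI h)
            exact ⟨i, (hE2 i (by omega)).mpr h, rfl⟩
          · rintro ⟨i', hi', h⟩
            obtain rfl : i' = i := by omega
            exact (hE2 i' (hE1 i' hi')).mp hi'
        rw [h1]
        split_ifs <;> simp
    have hcE : (shiftRows E).card = E.card := Finset.card_map _
    have hcF : (shiftRows F).card = F.card := Finset.card_map _
    have hEm : m - 1 ∉ E := fun h => lt_irrefl _ (hE1 _ h)
    have hFN : N - 1 ∉ F := Finset.notMem_erase _ _
    have hsub1 : insert (m - 1) E ⊆ Finset.range m := by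
      intro i hi
      rcases Finset.mem_insert.mp hi with rfl | hi
      · simpa using hm
      · have := hE1 i hi
        rw [Finset.mem_range]; omega
    have hsub2 : insert 0 (shiftRows F) ⊆ Finset.range N := by
      intro j hj
      rcases Finset.mem_insert.mp hj with rfl | hj
      · simpa using hN
      · obtain ⟨j', hj', rfl⟩ := mem_shiftRows.mp hj
        exact Finset.mem_range.mpr (hF1 j' hj')
    have hm1 : ∀ i, i < m - 1 → i ≠ m - 1 := fun i hi => by omega
    have hJI : ∀ j, j + 1 < N → (j + 1 ∈ shiftRows F ↔ j ∈ J) := fun j hj => by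
      rw [← hF3 j hj]; simp [mem_shiftRows]
    by_cases hJN : N - 1 ∈ J
    · have hJ' : J = insert (N - 1) F := (Finset.insert_erase hJN).symm
      have hsort : J.sort = F.sort ++ [N - 1] := by rw [hJ', sort_insert_last hF2]
      have hcJ : J.card = F.card + 1 := by rw [hJ', Finset.card_insert_of_notMem hFN]
      by_cases h0 : 0 ∈ I
      · rw [if_pos h0] at hIE
        refine ⟨E, shiftRows F, (Finset.subset_insert _ _).trans hsub1,
          (Finset.subset_insert _ _).trans hsub2, ?_, ?_, ?_⟩
        · have := congrArg Finset.card hIE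
          rw [Finset.card_insert_of_notMem (zero_notMem_shiftRows E)] at this
          omega
        · rw [hIE, hsort, sort_shiftRows]
          exact (qdet_rotMat_append hq hs.qmat huv hvu hN hE1 hF4).2
        · exact cycSet_succ hm hN hE2 (by simp [hEm, hJN]) (by simp [h0, zero_notMem_shiftRows])
            hJI
      · rw [if_neg h0] at hIE
        refine ⟨E, insert 0 (shiftRows F), (Finset.subset_insert _ _).trans hsub1, hsub2,
          ?_, ?_, ?_⟩
        · have := congrArg Finset.card hIE
          rw [Finset.card_insert_of_notMem (zero_notMem_shiftRows F)]
          omega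
        · rw [hIE, hsort, sort_insert_zero_shiftRows]
          exact (qdet_rotMat_append hq hs.qmat huv hvu hN hE1 hF4).1
        · exact cycSet_succ hm hN hE2 (by simp [hEm, hJN]) (by simp [h0])
            fun j hj => by rw [← hJI j hj]; simp
    · have hJ' : F = J := Finset.erase_eq_of_notMem hJN
      have hE3 : ∀ i, i < m - 1 → (i ∈ insert (m - 1) E ↔ i + 1 ∈ I) := fun i hi => by
        rw [← hE2 i hi, Finset.mem_insert, or_iff_right (hm1 i hi)]
      have hcm : (insert (m - 1) E).card = E.card + 1 := Finset.card_insert_of_notMem hEm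
      by_cases h0 : 0 ∈ I
      · rw [if_pos h0] at hIE
        refine ⟨insert (m - 1) E, shiftRows F, hsub1,
          (Finset.subset_insert _ _).trans hsub2, ?_, ?_, ?_⟩
        · have := congrArg Finset.card hIE
          rw [Finset.card_insert_of_notMem (zero_notMem_shiftRows E)] at this
          rw [hcm, hcF, hJ']
          omega
        · rw [hIE, ← hJ', sort_shiftRows]
          exact (qdet_rotMat hq hs.qmat huv hvu hm hE1 hF4).2
        · exact cycSet_succ hm hN hE3 (by simp [hJN]) (by simp [h0, zero_notMem_shiftRows]) hJI
      · rw [if_neg h0] at hIE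
        refine ⟨insert (m - 1) E, insert 0 (shiftRows F), hsub1, hsub2, ?_, ?_, ?_⟩
        · have := congrArg Finset.card hIE
          rw [Finset.card_insert_of_notMem (zero_notMem_shiftRows F), hcm, hcF, hJ']
          omega
        · rw [hIE, ← hJ', sort_insert_zero_shiftRows]
          exact (qdet_rotMat hq hs.qmat huv hvu hm hE1 hF4).1
        · exact cycSet_succ hm hN hE3 (by simp [hJN]) (by simp [h0])
            fun j hj => by rw [← hJI j hj]; simp
  refine ⟨rotMat q m N y v, rotMat_isQMat hq hs.qmat huv hvu, ?_, ?_⟩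
  · intro I J hI hJ hIJ
    obtain ⟨I', J', hI', hJ', hIJ', h1, h2⟩ := key I J hI hJ hIJ
    rw [h1, h2, ← hs.minor I' J' hI' hJ' hIJ', ← hM', ← hM, ← hu, mul_assoc, ← mul_assoc v, hvu,
      one_mul]
  · intro I J hI hJ hIJ
    obtain ⟨I', J', hI', hJ', hIJ', h1, -⟩ := key I J hI hJ hIJ
    rw [h1, ← hM', ← hu]
    refine ScalarCommute.mul_left ?_ ?_
    · exact (hs.qmat.scalarCommute_corner hq hI' fun j hj => Finset.mem_range.mp
        (hJ' ((Finset.mem_sort _).mp hj))).mul_right ((ScalarCommute.refl _).inv_right huv hvu)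
    · exact (hs.comm I' J' hI' hJ' hIJ').mul_right (hcomm_u.inv_right huv hvu)

theorem RotState.iterate (hs : RotState q m N 0 y P) (hq : q ≠ 0) (hm : 0 < m) (hN : 0 < N)
    (a : ℕ) (hP : ∀ b ≤ a, IsUnit (P (cycSet (m + N) m b ∅ ∅))) :
    ∃ y', RotState q m N a y' P := by
  induction a with
  | zero => exact ⟨y, hs⟩
  | succ a ih =>
    obtain ⟨y', hy'⟩ := ih fun b hb => hP b (by omega)
    exact hy'.succ hq hm hN (hP a (by omega)) (hP (a + 1) le_rfl)

/-- A quantum matrix describes its own minors, viewed as a family indexed by sets of `m` columns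
among `m + n`, the first `m` columns standing for an identity matrix. -/
theorem IsQMat.rotState {n : ℕ} {X : ℕ → ℕ → R} (hX : IsQMat q m n X) :
    RotState q m n 0 X fun K => qdet q X ((Finset.range n).filter fun j => m + j ∈ K).sort
      ((Finset.range m).filter fun i => m - 1 - i ∉ K) := by
  have hmem : ∀ I J x, x < m + n → (x ∈ cycSet (m + n) m 0 I J ↔
      ((x < m ∧ m - 1 - x ∉ I) ∨ (m ≤ x ∧ x - m ∈ J))) := by
    intro I J x hx
    rw [mem_cycSet]
    constructor
    · rintro ⟨s, hs, h, rfl⟩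
      rwa [zero_add, Nat.mod_eq_of_lt hs]
    · intro h
      exact ⟨x, hx, h, by rw [zero_add, Nat.mod_eq_of_lt hx]⟩
  have hcol : ∀ I J, J ⊆ Finset.range n →
      (Finset.range n).filter (fun j => m + j ∈ cycSet (m + n) m 0 I J) = J := by
    intro I J hJ
    ext j
    rw [Finset.mem_filter, Finset.mem_range]
    constructor
    · rintro ⟨hj, h⟩
      rw [hmem _ _ _ (by omega)] at h
      rcases h with ⟨h, -⟩ | ⟨-, h⟩
      · omega
      · rwa [Nat.add_sub_cancel_left] at h
    · intro h
      have hj := Finset.mem_range.mp (hJ h)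
      refine ⟨hj, (hmem _ _ _ (by omega)).mpr (Or.inr ⟨by omega, ?_⟩)⟩
      rwa [Nat.add_sub_cancel_left]
  have hrow : ∀ I J, I ⊆ Finset.range m →
      (Finset.range m).filter (fun i => m - 1 - i ∉ cycSet (m + n) m 0 I J) = I := by
    intro I J hI
    ext i
    rw [Finset.mem_filter, Finset.mem_range]
    have e : ∀ i < m, m - 1 - (m - 1 - i) = i := fun i hi => by omega
    constructor
    · rintro ⟨hi, h⟩
      rw [hmem _ _ _ (by omega)] at h
      by_contra hI'
      exact h (Or.inl ⟨by omega, by rwa [e i hi]⟩)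
    · intro h
      have hi := Finset.mem_range.mp (hI h)
      refine ⟨hi, fun h' => ?_⟩
      rw [hmem _ _ _ (by omega), e i hi] at h'
      rcases h' with ⟨-, h'⟩ | ⟨h', -⟩
      · exact h' h
      · omega
  refine ⟨hX, fun I J hI hJ _ => ?_, fun I J hI hJ _ => ?_⟩
  · rw [hrow I J hI, hcol I J hJ, hrow ∅ ∅ (by simp), hcol ∅ ∅ (by simp)]
    simp [qdet_nil]
  · rw [hrow ∅ ∅ (by simp), hcol ∅ ∅ (by simp)]
    simpa [qdet_nil] using ScalarCommute.one_left _

/-- If all minors of an `m × (m + N)` quantum matrix `X` are invertible, then its maximal minors are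
described from every first column by an `m × N` quantum matrix. Starting from `[1 | X]`, whose
maximal minors are all the minors of `X`, one rotates `m` times, restricts to the first `N` columns,
and then rotates `a` times. -/
theorem IsQMat.exists_rotState {n : ℕ} {X : ℕ → ℕ → R} (hX : IsQMat q m n X) (hq : q ≠ 0)
    (hm : 0 < m) (hn : m + N = n)
    (hunit : ∀ I J : Finset ℕ, I ⊆ Finset.range m → J ⊆ Finset.range n → I.card = J.card →
      IsUnit (qdet q X J.sort I)) (hN : 0 < N) (a : ℕ) :
    ∃ y, RotState q m N a y fun K => qdet q X K.sort (Finset.range m) := by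
  -- in the first `m` rotations the `b`-th denominator is the minor of `X` with its last `b` rows and
  -- first `b` columns
  obtain ⟨y, hy⟩ := hX.rotState.iterate hq hm (by omega) m (by
    intro b hb
    have hmem : ∀ x < m + n, (x ∈ cycSet (m + n) m b ∅ ∅ ↔ b ≤ x ∧ x < b + m) := by
      intro x hx
      rw [mem_cycSet]
      constructor
      · rintro ⟨s, hs, h, rfl⟩
        simp only [Finset.notMem_empty, not_false_iff, and_true, and_false, or_false] at h
        rw [Nat.mod_eq_of_lt (by omega)]
        omega
      · rintro ⟨h1, h2⟩
        refine ⟨x - b, by omega, Or.inl ⟨by omega, by simp⟩, ?_⟩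
        rw [Nat.add_sub_cancel' h1, Nat.mod_eq_of_lt hx]
    have hcol : (Finset.range n).filter (fun j => m + j ∈ cycSet (m + n) m b ∅ ∅) =
        Finset.range b := by
      ext j
      rw [Finset.mem_filter, Finset.mem_range, Finset.mem_range]
      constructor
      · rintro ⟨hj, h⟩
        rw [hmem _ (by omega)] at h
        omega
      · intro h
        refine ⟨by omega, (hmem _ (by omega)).mpr (by omega)⟩
    have hrow : (Finset.range m).filter (fun i => m - 1 - i ∉ cycSet (m + n) m b ∅ ∅) =
        (Finset.range b).image fun i => m - 1 - i := by
      ext i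
      rw [Finset.mem_filter, Finset.mem_range, Finset.mem_image]
      constructor
      · rintro ⟨hi, h⟩
        rw [hmem _ (by omega)] at h
        exact ⟨m - 1 - i, Finset.mem_range.mpr (by omega), by omega⟩
      · rintro ⟨i, hi, rfl⟩
        rw [Finset.mem_range] at hi
        refine ⟨by omega, fun h => ?_⟩
        rw [hmem _ (by omega)] at h
        omega
    refine hunit _ _ (Finset.filter_subset _ _) (Finset.filter_subset _ _) ?_
    rw [hrow, hcol, Finset.card_image_of_injOn]
    intro i hi i' hi' h
    simp only [Finset.coe_range, Set.mem_Iio] at hi hi' h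
    omega)
  -- after `m` rotations, sets of columns of `[1 | X]` which come from the first `N` columns of `y`
  -- consist of columns of `X`
  have hcyc : ∀ I J, J ⊆ Finset.range N →
      (Finset.range n).filter (fun j => m + j ∈ cycSet (m + n) m m I J) =
        cycSet (m + N) m 0 I J ∧
      (Finset.range m).filter (fun i => m - 1 - i ∉ cycSet (m + n) m m I J) =
        Finset.range m := by
    intro I J hJ
    have hlt : ∀ s, ((s < m ∧ m - 1 - s ∉ I) ∨ (m ≤ s ∧ s - m ∈ J)) → s < n := by
      rintro s (⟨h, -⟩ | ⟨-, h⟩)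
      · omega
      · have := Finset.mem_range.mp (hJ h)
        omega
    constructor
    · ext j
      rw [Finset.mem_filter, Finset.mem_range, mem_cycSet, mem_cycSet]
      constructor
      · rintro ⟨hj, s, hs, h, h'⟩
        have := hlt s h
        rw [Nat.mod_eq_of_lt (by omega)] at h'
        obtain rfl : s = j := by omega
        exact ⟨s, by omega, h, by rw [zero_add, Nat.mod_eq_of_lt (by omega)]⟩
      · rintro ⟨s, hs, h, rfl⟩
        rw [zero_add, Nat.mod_eq_of_lt hs]
        exact ⟨by omega, s, by omega, h, Nat.mod_eq_of_lt (by omega)⟩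
    · refine Finset.filter_true_of_mem fun i hi h => ?_
      obtain ⟨s, hs, h, h'⟩ := mem_cycSet.mp h
      have := hlt s h
      rw [Nat.mod_eq_of_lt (by omega)] at h'
      have := Finset.mem_range.mp hi
      omega
  have hNn : Finset.range N ⊆ Finset.range n := Finset.range_subset_range.mpr (by omega)
  have h0 : RotState q m N 0 y fun K => qdet q X K.sort (Finset.range m) := by
    refine ⟨⟨fun i j l hi hj hl => hy.qmat.row i j l hi hj (by omega),
      fun i s j hi hs hj => hy.qmat.col i s j hi hs (by omega),
      fun i s j l hi hs hj hl => hy.qmat.anti i s j l hi hs hj (by omega),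
      fun i s j l hi hs hj hl => hy.qmat.diag i s j l hi hs hj (by omega)⟩, ?_, ?_⟩
    · intro I J hI hJ hIJ
      have := hy.minor I J hI (hJ.trans hNn) hIJ
      simpa only [(hcyc I J hJ).1, (hcyc I J hJ).2, (hcyc ∅ ∅ (by simp)).1,
        (hcyc ∅ ∅ (by simp)).2] using this
    · intro I J hI hJ hIJ
      have := hy.comm I J hI (hJ.trans hNn) hIJ
      simpa only [(hcyc ∅ ∅ (by simp)).1, (hcyc ∅ ∅ (by simp)).2] using this
  refine h0.iterate hq hm hN a fun b _ => hunit _ _ subset_rfl ?_ ?_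
  · intro x hx
    obtain ⟨s, hs, -, rfl⟩ := mem_cycSet.mp hx
    rw [Finset.mem_range, ← hn]
    exact Nat.mod_lt _ (by omega)
  · have : cycSet (m + N) m b ∅ ∅ = (Finset.range m).image fun s => (b + s) % (m + N) := by
      ext x
      rw [mem_cycSet, Finset.mem_image]
      constructor
      · rintro ⟨s, hs, h, rfl⟩
        simp only [Finset.notMem_empty, not_false_iff, and_true, and_false, or_false] at h
        exact ⟨s, Finset.mem_range.mpr h, rfl⟩
      · rintro ⟨s, hs, rfl⟩
        rw [Finset.mem_range] at hs
        exact ⟨s, by omega, Or.inl ⟨hs, by simp⟩, rfl⟩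
    rw [this, Finset.card_image_of_injOn]
    intro s hs s' hs' h
    simp only [Finset.coe_range, Set.mem_Iio] at hs hs'
    have h' : b + s ≡ b + s' [MOD m + N] := h
    have := Nat.ModEq.add_left_cancel' b h'
    rwa [Nat.ModEq, Nat.mod_eq_of_lt (by omega), Nat.mod_eq_of_lt (by omega)] at this

end RotationStates

/-! ### Quantum matrices in a quantum torus -/

section AddRow

variable {k : Type*} [Field k] {q : k} {R : Type*} [Ring R] [Algebra k R]

/-- The relations between the entries of rows `i < s` and columns `j < l` of a matrix extended by
`IsQMat.addRow`. Here `P`, `S` are the parts over the columns `c ∈ [j, l)` and `c ≥ l` of the sum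
that defines the entries in row `i`, `P'`, `S'` are the same for row `s`, and `t`, `t'` are the
entries of the added row in columns `j` and `l`. -/
theorem addRow_relations (hq : q ≠ 0) {P S P' S' t t' : R}
    (hPS : P * S = q ^ 2 • (S * P)) (hSS : S * S' = q • (S' * S))
    (hx : P * S' = q • (S' * P) + (q ^ 2 - 1) • (S * P')) (hx' : S * P' = q⁻¹ • (P' * S))
    (h1 : t * S = q⁻¹ • (S * t)) (h1' : t * S' = q⁻¹ • (S' * t))
    (h3 : t' * S = q⁻¹ • (S * t')) (h3' : t' * S' = q⁻¹ • (S' * t'))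
    (h4 : t' * P = q • (P * t')) (h4' : t' * P' = q • (P' * t'))
    (ht : t * t' = q • (t' * t)) :
    ((P + S) * t) * (S * t') = q • ((S * t') * ((P + S) * t)) ∧
    ((P' + S') * t) * (S * t') = (S * t') * ((P' + S') * t) ∧
    ((P + S) * t) * (S' * t') - (S' * t') * ((P + S) * t) =
      (q - q⁻¹) • ((S * t') * ((P' + S') * t)) := by
  have hP'S : P' * S = q • (S * P') := by
    rw [hx', smul_smul, mul_inv_cancel₀ hq, one_smul]
  have hS'S : S' * S = q⁻¹ • (S * S') := by
    rw [hSS, smul_smul, inv_mul_cancel₀ hq, one_smul]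
  have hx2 : P * S' = q • (S' * P) + (q ^ 2 - 1) • (S * P') := hx
  refine ⟨?_, ?_, ?_⟩ <;>
  · simp only [add_mul, mul_add, mul_assoc, smul_mul_assoc, mul_smul_comm,
      mul_assoc_of_mul_eq h1, mul_assoc_of_mul_eq h1', mul_assoc_of_mul_eq h3,
      mul_assoc_of_mul_eq h3', mul_assoc_of_mul_eq h4, mul_assoc_of_mul_eq h4',
      mul_assoc_of_mul_eq hPS, mul_assoc_of_mul_eq hP'S, mul_assoc_of_mul_eq hS'S,
      mul_assoc_of_mul_eq hx, ht]
    match_scalars <;> (field_simp; try ring)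

variable {r n : ℕ} {y : ℕ → ℕ → R} {τ : ℕ → Rˣ}

/-- Adding a last row of invertible entries `τ j` to a quantum matrix `y`: the other rows are
multiplied from the right by the triangular matrix with entries `τ c⁻¹ τ j` for `j ≤ c`. -/
theorem IsQMat.addRow (hq : q ≠ 0) (hy : IsQMat q r n y)
    (hτ : ∀ j l, j < l → l < n → (τ j : R) * τ l = q • (τ l * τ j : R))
    (hyτ : ∀ i j l, i < r → j < n → l < n →
      y i j * τ l = (if j = l then q else 1) • (τ l * y i j : R)) :
    IsQMat q (r + 1) n fun i j =>
      if i < r then (∑ c ∈ Finset.Ico j n, y i c * (↑(τ c)⁻¹ : R)) * τ j else τ j := by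
  set z : ℕ → ℕ → R := fun i c => y i c * (↑(τ c)⁻¹ : R) with hz
  -- the relations between `y` and the inverses of the added row
  have σy : ∀ i c d, i < r → c < n → d < n →
      (↑(τ c)⁻¹ : R) * y i d = (if d = c then q else 1) • (y i d * (↑(τ c)⁻¹ : R)) :=
    fun i c d hi hc hd => mul_eq_of_inverse_left (Units.mul_inv _) (Units.inv_mul _)
      (hyτ i d c hi hd hc)
  have σσ : ∀ c d, c < d → d < n →
      (↑(τ c)⁻¹ : R) * (↑(τ d)⁻¹ : R) = q • ((↑(τ d)⁻¹ : R) * (↑(τ c)⁻¹ : R)) := by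
    intro c d hcd hd
    refine mul_eq_of_inverse_left (Units.mul_inv _) (Units.inv_mul _) ?_
    have := mul_eq_of_inverse_left (Units.mul_inv (τ d)) (Units.inv_mul _) (hτ c d hcd hd)
    rw [this]
  have τσ1 : ∀ l c, l < c → c < n →
      (τ l : R) * (↑(τ c)⁻¹ : R) = q⁻¹ • ((↑(τ c)⁻¹ : R) * τ l) := by
    intro l c hlc hc
    rw [mul_eq_of_inverse_left (Units.mul_inv (τ c)) (Units.inv_mul _) (hτ l c hlc hc), smul_smul,
      inv_mul_cancel₀ hq, one_smul]
  have τσ2 : ∀ l c, c < l → l < n →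
      (τ l : R) * (↑(τ c)⁻¹ : R) = q • ((↑(τ c)⁻¹ : R) * τ l) := by
    intro l c hcl hl
    have h : (τ l : R) * τ c = q⁻¹ • (τ c * τ l : R) := by
      rw [hτ c l hcl hl, smul_smul, inv_mul_cancel₀ hq, one_smul]
    rw [mul_eq_of_inverse_left (Units.mul_inv (τ c)) (Units.inv_mul _) h, smul_smul,
      mul_inv_cancel₀ hq, one_smul]
  have τy : ∀ i j l, i < r → j < n → l < n →
      (τ l : R) * y i j = (if j = l then q⁻¹ else 1) • (y i j * τ l : R) := by
    intro i j l hi hj hl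
    rw [hyτ i j l hi hj hl, smul_smul]
    split_ifs <;> simp [hq]
  have τz1 : ∀ i l c, i < r → l ≤ c → c < n → (τ l : R) * z i c = q⁻¹ • (z i c * τ l) := by
    intro i l c hi hlc hc
    rw [hz, ← mul_assoc, τy i c l hi hc (by omega), smul_mul_assoc, mul_assoc]
    rcases hlc.eq_or_lt with rfl | h
    · simp [mul_assoc]
    · rw [if_neg (by omega), τσ1 l c h hc, one_smul, mul_smul_comm, mul_assoc]
  have τz2 : ∀ i l c, i < r → c < l → l < n → (τ l : R) * z i c = q • (z i c * τ l) := by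
    intro i l c hi hcl hl
    rw [hz, ← mul_assoc, τy i c l hi (by omega) hl, smul_mul_assoc, mul_assoc, if_neg (by omega),
      τσ2 l c hcl hl, one_smul, mul_smul_comm, mul_assoc]
  -- the relations between the summands `z i c`
  have z1 : ∀ i c d, i < r → c < d → d < n → z i c * z i d = q ^ 2 • (z i d * z i c) := by
    intro i c d hi hcd hd
    simp only [hz, mul_assoc, mul_assoc_of_mul_eq (σy i c d hi (by omega) hd),
      mul_assoc_of_mul_eq (σy i d c hi hd (by omega)), σσ c d hcd hd,
      mul_assoc_of_mul_eq (hy.row i c d hi hcd hd), smul_mul_assoc, mul_smul_comm]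
    rw [if_neg (by omega), if_neg (by omega)]
    match_scalars
    ring
  have z2 : ∀ i s c, i < s → s < r → c < n → z i c * z s c = q • (z s c * z i c) := by
    intro i s c his hs hc
    simp only [hz, mul_assoc, mul_assoc_of_mul_eq (σy i c c (by omega) hc hc),
      mul_assoc_of_mul_eq (σy s c c hs hc hc),
      mul_assoc_of_mul_eq (hy.col i s c his hs hc), smul_mul_assoc, mul_smul_comm, if_true]
  have z3 : ∀ i s c d, i < s → s < r → c < d → d < n →
      z i c * z s d = q • (z s d * z i c) + (q ^ 2 - 1) • (z i d * z s c) := by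
    intro i s c d his hs hcd hd
    have e := sub_eq_iff_eq_add.mp (hy.diag i s c d his hs hcd hd)
    simp only [hz, mul_assoc, mul_assoc_of_mul_eq (σy s c d hs (by omega) hd),
      mul_assoc_of_mul_eq (σy i d c (by omega) hd (by omega)),
      mul_assoc_of_mul_eq (σy s d c hs hd (by omega)), σσ c d hcd hd,
      mul_assoc_of_mul_eq e, smul_mul_assoc, mul_smul_comm, add_mul]
    rw [if_neg (by omega), if_neg (by omega)]
    match_scalars <;> (field_simp; try ring)
  have z4 : ∀ i s c d, i < s → s < r → c < d → d < n →
      z i d * z s c = q⁻¹ • (z s c * z i d) := by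
    intro i s c d his hs hcd hd
    simp only [hz, mul_assoc, mul_assoc_of_mul_eq (σy s d c hs hd (by omega)),
      mul_assoc_of_mul_eq (σy i c d (by omega) (by omega) hd), σσ c d hcd hd,
      mul_assoc_of_mul_eq (hy.anti i s c d his hs hcd hd), smul_mul_assoc, mul_smul_comm]
    rw [if_neg (by omega), if_neg (by omega)]
    match_scalars <;> (field_simp; try ring)
  -- the same relations for sums over consecutive intervals of columns
  set T : ℕ → ℕ → ℕ → R := fun i j l => ∑ c ∈ Finset.Ico j l, z i c with hT
  have T1 : ∀ i j l p, i < r → p ≤ n → T i j l * T i l p = q ^ 2 • (T i l p * T i j l) := by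
    intro i j l p hi hp
    rw [hT]
    simp only
    rw [Finset.sum_mul_sum, Finset.sum_mul_sum, Finset.sum_comm, Finset.smul_sum]
    refine Finset.sum_congr rfl fun d hd => ?_
    rw [Finset.smul_sum]
    refine Finset.sum_congr rfl fun c hc => ?_
    rw [Finset.mem_Ico] at hc hd
    exact z1 i c d hi (by omega) (by omega)
  have T3 : ∀ i s j l p, i < s → s < r → p ≤ n → T i j l * T s l p =
      q • (T s l p * T i j l) + (q ^ 2 - 1) • (T i l p * T s j l) := by
    intro i s j l p his hs hp
    rw [hT]
    simp only
    rw [Finset.sum_mul_sum, Finset.sum_mul_sum, Finset.sum_mul_sum, Finset.sum_comm,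
      Finset.smul_sum, Finset.smul_sum, ← Finset.sum_add_distrib]
    refine Finset.sum_congr rfl fun d hd => ?_
    rw [Finset.smul_sum, Finset.smul_sum, ← Finset.sum_add_distrib]
    refine Finset.sum_congr rfl fun c hc => ?_
    rw [Finset.mem_Ico] at hc hd
    exact z3 i s c d his hs (by omega) (by omega)
  have T4 : ∀ i s j l p, i < s → s < r → p ≤ n →
      T i l p * T s j l = q⁻¹ • (T s j l * T i l p) := by
    intro i s j l p his hs hp
    rw [hT]
    simp only
    rw [Finset.sum_mul_sum, Finset.sum_mul_sum, Finset.sum_comm, Finset.smul_sum]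
    refine Finset.sum_congr rfl fun c hc => ?_
    rw [Finset.smul_sum]
    refine Finset.sum_congr rfl fun d hd => ?_
    rw [Finset.mem_Ico] at hc hd
    exact z4 i s c d his hs (by omega) (by omega)
  -- here the sums run over the same interval: the mixed terms of `T3` and `T4` combine
  have T2 : ∀ i s j p, i < s → s < r → p ≤ n → T i j p * T s j p = q • (T s j p * T i j p) := by
    intro i s j p his hs hp
    induction p with
    | zero => simp [hT]
    | succ p ih =>
      by_cases hjp : j ≤ p
      · have e : ∀ i, T i j (p + 1) = T i j p + T i p (p + 1) := fun i =>
          (Finset.sum_Ico_consecutive _ hjp (by omega)).symm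
        have e' : ∀ i, T i p (p + 1) = z i p := fun i => by simp [hT]
        have a1 := T3 i s j p (p + 1) his hs hp
        have a2 := T4 i s j p (p + 1) his hs hp
        rw [e i, e s]
        simp only [add_mul, mul_add, a1, a2, ih (by omega)]
        simp only [e', z2 i s p his hs (by omega)]
        match_scalars <;> (field_simp; try ring)
      · simp [hT, Finset.Ico_eq_empty_of_le (show p + 1 ≤ j by omega)]
  have τT1 : ∀ i j l p, i < r → j ≤ l → p ≤ n →
      (τ j : R) * T i l p = q⁻¹ • (T i l p * τ j) := by
    intro i j l p hi hjl hp
    rw [hT]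
    simp only
    rw [Finset.mul_sum, Finset.sum_mul, Finset.smul_sum]
    refine Finset.sum_congr rfl fun c hc => ?_
    rw [Finset.mem_Ico] at hc
    exact τz1 i j c hi (by omega) (by omega)
  have τT2 : ∀ i j l, i < r → l < n → (τ l : R) * T i j l = q • (T i j l * τ l) := by
    intro i j l hi hl
    rw [hT]
    simp only
    rw [Finset.mul_sum, Finset.sum_mul, Finset.smul_sum]
    refine Finset.sum_congr rfl fun c hc => ?_
    rw [Finset.mem_Ico] at hc
    exact τz2 i l c hi (by omega) hl
  have eT : ∀ i j l, j < l → l < n → T i j n = T i j l + T i l n := fun i j l h1 h2 =>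
    (Finset.sum_Ico_consecutive _ h1.le h2.le).symm
  generalize hX : (fun i j => if i < r then T i j n * τ j else τ j : ℕ → ℕ → R) = X
  have x1 : ∀ i j, i < r → X i j = T i j n * τ j := by
    intro i j hi
    rw [← hX]
    exact if_pos hi
  have x2 : ∀ j, X r j = τ j := by
    intro j
    rw [← hX]
    exact if_neg (lt_irrefl r)
  have x2' : ∀ i, ¬ i < r → i < r + 1 → ∀ j, X i j = τ j := by
    intro i hi hi' j
    rw [show i = r by omega, x2]
  clear hX
  have rel := fun i s j l (his : i < s) (hs : s < r) (hjl : j < l) (hl : l < n) =>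
    addRow_relations hq (T1 i j l n (his.trans hs) le_rfl)
      (T2 i s l n his hs le_rfl) (T3 i s j l n his hs le_rfl)
      (T4 i s j l n his hs le_rfl) (τT1 i j l n (his.trans hs) hjl.le le_rfl)
      (τT1 s j l n hs hjl.le le_rfl) (τT1 i l l n (his.trans hs) le_rfl le_rfl)
      (τT1 s l l n hs le_rfl le_rfl) (τT2 i j l (his.trans hs) hl) (τT2 s j l hs hl)
      (hτ j l hjl hl)
  have diag0 : ∀ i j l, i < r → j < l → l < n → T i j n * τ j * τ l - τ l * (T i j n * τ j) =
      (q - q⁻¹) • (T i l n * τ l * τ j) := by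
    intro i j l hi hjl hl
    have a1 := τT1 i l l n hi le_rfl le_rfl
    have a2 := τT2 i j l hi hl
    simp only [eT i j l hjl hl, add_mul, mul_add, mul_assoc, hτ j l hjl hl,
      mul_assoc_of_mul_eq a1, mul_assoc_of_mul_eq a2, smul_mul_assoc, mul_smul_comm]
    match_scalars <;> (field_simp; try ring)
  constructor
  · intro i j l hi hjl hl
    by_cases hi' : i < r
    swap
    · simp only [x2' i hi' hi]
      exact hτ j l hjl hl
    · simp only [x1 i _ hi']
      have a1 := T1 i j l n hi' le_rfl
      have a2 := τT1 i j l n hi' hjl.le le_rfl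
      have a3 := τT1 i l l n hi' le_rfl le_rfl
      have a4 := τT2 i j l hi' hl
      simp only [eT i j l hjl hl, add_mul, mul_add, mul_assoc, hτ j l hjl hl,
        mul_assoc_of_mul_eq a1, mul_assoc_of_mul_eq a2, mul_assoc_of_mul_eq a3,
        mul_assoc_of_mul_eq a4, smul_mul_assoc, mul_smul_comm]
      match_scalars <;> (field_simp; try ring)
  · intro i s j his hs hj
    by_cases hs' : s < r
    swap
    · obtain rfl : s = r := by omega
      simp only [x1 i _ his, x2]
      have a1 := τT1 i j j n his le_rfl le_rfl
      rw [← mul_assoc, a1, smul_mul_assoc, smul_smul, mul_inv_cancel₀ hq, one_smul]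
    · simp only [x1 i _ (his.trans hs'), x1 s _ hs']
      have a1 := τT1 i j j n (his.trans hs') le_rfl le_rfl
      have a2 := τT1 s j j n hs' le_rfl le_rfl
      simp only [mul_assoc, mul_assoc_of_mul_eq a1, mul_assoc_of_mul_eq a2,
        mul_assoc_of_mul_eq (T2 i s j n his hs' le_rfl), smul_mul_assoc, mul_smul_comm]
      match_scalars
      ring
  · intro i s j l his hs hjl hl
    by_cases hs' : s < r
    swap
    · obtain rfl : s = r := by omega
      simp only [x1 i _ his, x2]
      have a1 := τT1 i j l n his hjl.le le_rfl
      rw [← mul_assoc, a1, smul_mul_assoc, mul_assoc, hτ j l hjl hl, mul_smul_comm, smul_smul,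
        inv_mul_cancel₀ hq, one_smul, mul_assoc]
    · simp only [x1 i _ (his.trans hs'), x1 s _ hs', eT _ j l hjl hl]
      exact (rel i s j l his hs' hjl hl).2.1
  · intro i s j l his hs hjl hl
    by_cases hs' : s < r
    swap
    · obtain rfl : s = r := by omega
      simp only [x1 i _ his, x2]
      exact diag0 i j l his hjl hl
    · simp only [x1 i _ (his.trans hs'), x1 s _ hs', eT _ j l hjl hl]
      exact (rel i s j l his hs' hjl hl).2.2

end AddRow

section TorusMatrix

variable {k : Type*} [Field k] {q : k} {R : Type*} [Ring R] [Algebra k R]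

/-- The quantum matrix built from units `t i j`, one row after another: the entry in row `i` and
column `j` of the matrix with `r` rows is a sum of Laurent monomials in the `t i j`, and the last
row consists of the `t (r - 1) j`. -/
def torusMat (t : ℕ → ℕ → Rˣ) (n : ℕ) : ℕ → ℕ → ℕ → R
  | 0 => fun _ _ => 0
  | r + 1 => fun i j =>
      if i < r then (∑ c ∈ Finset.Ico j n, torusMat t n r i c * (↑(t r c)⁻¹ : R)) * t r j else t r j

variable {t : ℕ → ℕ → Rˣ} {m n : ℕ}

/-- A row built so far commutes with the units of later rows as its own unit `t i j` does; the
factors by which a summand is multiplied commute with the later units up to scalars which cancel. -/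
theorem torusMat_mul_later_row (hq : q ≠ 0)
    (ht' : ∀ i s j l, i < s → s < m → j < n → l < n →
      (t i j : R) * t s l = (if j = l then q else 1) • (t s l * t i j : R)) :
    ∀ r i s j l, i < r → r ≤ s → s < m → j < n → l < n →
      torusMat t n r i j * t s l = (if j = l then q else 1) • (t s l * torusMat t n r i j : R) := by
  intro r
  induction r with
  | zero => intro i s j l hi; omega
  | succ r ih =>
    intro i s j l hi hs hsm hj hl
    by_cases hir : i < r
    swap
    · simp only [torusMat, if_neg hir]
      exact ht' r s j l (by omega) hsm hj hl
    simp only [torusMat, if_pos hir]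
    have hsum : ∀ c ∈ Finset.Ico j n, torusMat t n r i c * (↑(t r c)⁻¹ : R) * t s l =
        t s l * (torusMat t n r i c * (↑(t r c)⁻¹ : R)) := by
      intro c hc
      rw [Finset.mem_Ico] at hc
      have h1 := ih i s c l hir (by omega) hsm hc.2 hl
      have h0 : (t s l : R) * t r c = (if c = l then q⁻¹ else 1) • (t r c * t s l : R) := by
        rw [ht' r s c l (by omega) hsm hc.2 hl, smul_smul]
        split_ifs <;> simp [hq]
      have h2 := mul_eq_of_inverse_left (Units.mul_inv (t r c)) (Units.inv_mul _) h0
      rw [mul_assoc, h2, mul_smul_comm, ← mul_assoc, h1, smul_mul_assoc, smul_smul, ← mul_assoc]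
      split_ifs <;> simp [hq]
    rw [mul_assoc, ht' r s j l (by omega) hsm hj hl, mul_smul_comm, ← mul_assoc, Finset.sum_mul,
      Finset.sum_congr rfl hsum, ← Finset.mul_sum, mul_assoc]

theorem torusMat_isQMat (hq : q ≠ 0)
    (ht : ∀ i j l, i < m → j < l → l < n → (t i j : R) * t i l = q • (t i l * t i j : R))
    (ht' : ∀ i s j l, i < s → s < m → j < n → l < n →
      (t i j : R) * t s l = (if j = l then q else 1) • (t s l * t i j : R)) :
    ∀ r, r ≤ m → IsQMat q r n (torusMat t n r) := by
  intro r
  induction r with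
  | zero => intro _; constructor <;> intros <;> omega
  | succ r ih =>
    intro hr
    exact (ih (by omega)).addRow hq (fun j l hjl hl => ht r j l hr hjl hl)
      fun i j l hi hj hl => torusMat_mul_later_row hq ht' r i r j l hi le_rfl hr hj hl

end TorusMatrix

/-! ### Twisted group algebras and leading monomials -/

section TorusOp

variable {k : Type*} [Field k] {q : k} {G : Type*} [AddCommGroup G] (B : G →ₗ[ℤ] G →ₗ[ℤ] ℤ)

variable (q) in
/-- The operator by which the monomial with exponent `g` acts on the group algebra of `G` twisted
by the bilinear form `B`: it maps the basis vector at `h` to `q ^ B g h` times that at `g + h`. -/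
def torusOp (g : G) : Module.End k (G →₀ k) :=
  Finsupp.linearCombination k fun h => Finsupp.single (g + h) (q ^ B g h)

theorem torusOp_single (g h : G) (c : k) :
    torusOp q B g (Finsupp.single h c) = Finsupp.single (g + h) (q ^ B g h * c) := by
  simp [torusOp, mul_comm]

theorem torusOp_zero : torusOp q B 0 = 1 := by
  refine Finsupp.lhom_ext fun h c => ?_
  simp [torusOp_single]

theorem torusOp_mul (hq : q ≠ 0) (g h : G) :
    torusOp q B g * torusOp q B h = q ^ B g h • torusOp q B (g + h) := by
  refine Finsupp.lhom_ext fun u c => ?_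
  rw [Module.End.mul_apply, torusOp_single, torusOp_single, LinearMap.smul_apply, torusOp_single,
    Finsupp.smul_single, smul_eq_mul, ← mul_assoc, ← mul_assoc, ← zpow_add₀ hq, ← zpow_add₀ hq,
    add_assoc, map_add, map_add, LinearMap.add_apply]
  congr 3
  ring

/-- A linearly independent family in an algebra which is multiplicative up to nonzero scalars, as the
monomials in a quantum torus are. -/
structure IsTwistedGroupFamily (k : Type*) [Field k] {G : Type*} [AddCommGroup G] {A : Type*}
    [Ring A] [Algebra k A] (e : G → A) : Prop where
  zero : e 0 = 1
  mul : ∀ g h, ∃ c : k, c ≠ 0 ∧ e g * e h = c • e (g + h)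
  linearIndependent : LinearIndependent k e

theorem isTwistedGroupFamily_torusOp (hq : q ≠ 0) : IsTwistedGroupFamily k (torusOp q B) where
  zero := torusOp_zero B
  mul g h := ⟨_, zpow_ne_zero _ hq, torusOp_mul B hq g h⟩
  linearIndependent := by
    refine LinearIndependent.of_comp (LinearMap.applyₗ (Finsupp.single 0 1)) ?_
    have h : (LinearMap.applyₗ (R := k) (M₂ := G →₀ k) (Finsupp.single (0 : G) (1 : k))) ∘
        torusOp q B = fun g => Finsupp.single g (1 : k) := by
      funext g
      simp [torusOp_single]
    rw [h]
    exact Finsupp.linearIndependent_single_one k G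

end TorusOp

section HasLead

variable {k : Type*} [Field k] {G : Type*} [AddCommGroup G] {A : Type*} [Ring A] [Algebra k A]
  {e : G → A} {d : G →ₗ[ℤ] ℤ}

theorem IsTwistedGroupFamily.isUnit (he : IsTwistedGroupFamily k e) (g : G) : IsUnit (e g) := by
  obtain ⟨a, ha, h⟩ := he.mul g (-g)
  obtain ⟨b, hb, h'⟩ := he.mul (-g) g
  rw [add_neg_cancel, he.zero] at h
  rw [neg_add_cancel, he.zero] at h'
  have h1 : e g * (a⁻¹ • e (-g)) = 1 := by
    rw [mul_smul_comm, h, smul_smul, inv_mul_cancel₀ ha, one_smul]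
  have h2 : (b⁻¹ • e (-g)) * e g = 1 := by
    rw [smul_mul_assoc, h', smul_smul, inv_mul_cancel₀ hb, one_smul]
  refine isUnit_iff_exists.mpr ⟨_, h1, ?_⟩
  rw [← left_inv_eq_right_inv h2 h1]
  exact h2

variable (k e d) in
/-- The Laurent series `f` has leading monomial `v`: all coefficients below `d v` vanish, and the
coefficient at `d v` is a nonzero scalar multiple of `e v`. -/
def HasLead (f : HahnSeries ℤ A) (v : G) : Prop :=
  (∃ c : k, c ≠ 0 ∧ f.coeff (d v) = c • e v) ∧ ∀ i < d v, f.coeff i = 0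

/-- The lowest coefficient of a product. The lower bounds `a` and `b` of the orders may fail to be
attained. -/
theorem coeff_mul_add_of_lt {f g : HahnSeries ℤ A} {a b : ℤ}
    (hf : ∀ i < a, f.coeff i = 0) (hg : ∀ i < b, g.coeff i = 0) :
    (f * g).coeff (a + b) = f.coeff a * g.coeff b ∧ ∀ i < a + b, (f * g).coeff i = 0 := by
  constructor
  · rw [HahnSeries.coeff_mul]
    by_cases h : f.coeff a = 0 ∨ g.coeff b = 0
    · rw [Finset.sum_eq_zero]
      · rcases h with h | h <;> simp [h]
      · intro p hp
        rw [Finset.mem_antidiagonal] at hp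
        by_cases h1 : p.1 < a
        · rw [hf _ h1, zero_mul]
        by_cases h2 : p.2 < b
        · rw [hg _ h2, mul_zero]
        obtain ⟨e1, e2⟩ : p.1 = a ∧ p.2 = b := by omega
        rcases h with h | h <;> simp [e1, e2, h]
    · push Not at h
      rw [Finset.sum_eq_single_of_mem (a, b)]
      · rw [Finset.mem_antidiagonal]
        exact ⟨h.1, h.2, rfl⟩
      · intro p hp hne
        rw [Finset.mem_antidiagonal] at hp
        by_cases h1 : p.1 < a
        · rw [hf _ h1, zero_mul]
        by_cases h2 : p.2 < b
        · rw [hg _ h2, mul_zero]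
        exact absurd (Prod.ext (by omega : p.1 = a) (by omega : p.2 = b)) hne
  · intro i hi
    rw [HahnSeries.coeff_mul]
    refine Finset.sum_eq_zero fun p hp => ?_
    rw [Finset.mem_antidiagonal] at hp
    by_cases h1 : p.1 < a
    · rw [hf _ h1, zero_mul]
    · rw [hg _ (by omega), mul_zero]

theorem HasLead.mul (he : IsTwistedGroupFamily k e) {f g : HahnSeries ℤ A} {v w : G}
    (hf : HasLead k e d f v) (hg : HasLead k e d g w) : HasLead k e d (f * g) (v + w) := by
  obtain ⟨⟨a, ha, hfa⟩, hf'⟩ := hf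
  obtain ⟨⟨b, hb, hgb⟩, hg'⟩ := hg
  obtain ⟨h1, h2⟩ := coeff_mul_add_of_lt hf' hg'
  obtain ⟨c, hc, hvw⟩ := he.mul v w
  refine ⟨⟨a * b * c, mul_ne_zero (mul_ne_zero ha hb) hc, ?_⟩, ?_⟩
  · rw [map_add, h1, hfa, hgb, smul_mul_smul_comm, hvw, smul_smul]
  · rw [map_add]
    exact h2

theorem HasLead.one (he : IsTwistedGroupFamily k e) : HasLead k e d (1 : HahnSeries ℤ A) 0 := by
  refine ⟨⟨1, one_ne_zero, ?_⟩, fun i hi => ?_⟩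
  · simp [he.zero]
  · rw [map_zero] at hi
    simp [HahnSeries.coeff_one, hi.ne]

theorem HasLead.smul {f : HahnSeries ℤ A} {v : G}
    (hf : HasLead k e d f v) {c : k} (hc : c ≠ 0) : HasLead k e d (c • f) v := by
  obtain ⟨⟨a, ha, hfa⟩, hf'⟩ := hf
  refine ⟨⟨c * a, mul_ne_zero hc ha, ?_⟩, fun i hi => ?_⟩
  · rw [HahnSeries.coeff_smul, hfa, smul_smul]
  · rw [HahnSeries.coeff_smul, hf' i hi, smul_zero]

/-- Adding terms of larger order does not change the leading monomial. -/
theorem HasLead.add_sum {ι : Type*} {f : HahnSeries ℤ A} {v : G}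
    (hf : HasLead k e d f v) (s : Finset ι) (g : ι → HahnSeries ℤ A)
    (w : ι → G) (hg : ∀ i ∈ s, HasLead k e d (g i) (w i)) (hw : ∀ i ∈ s, d v < d (w i)) :
    HasLead k e d (f + ∑ i ∈ s, g i) v := by
  classical
  induction s using Finset.induction_on with
  | empty => simpa using hf
  | insert i s hi ih =>
    rw [Finset.sum_insert hi, add_left_comm]
    obtain ⟨⟨a, ha, hfa⟩, hf'⟩ := ih (fun j hj => hg j (Finset.mem_insert_of_mem hj))
      fun j hj => hw j (Finset.mem_insert_of_mem hj)
    have hgi := (hg i (Finset.mem_insert_self i s)).2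
    have hwi := hw i (Finset.mem_insert_self i s)
    refine ⟨⟨a, ha, ?_⟩, fun j hj => ?_⟩
    · rw [HahnSeries.coeff_add, hgi _ hwi, zero_add, hfa]
    · rw [HahnSeries.coeff_add, hgi _ (hj.trans hwi), zero_add, hf' j hj]

/-- Up to a shift of the order, `f` is a power series with invertible constant term. -/
theorem HasLead.isUnit (he : IsTwistedGroupFamily k e) {f : HahnSeries ℤ A} {v : G}
    (hf : HasLead k e d f v) : IsUnit f := by
  obtain ⟨⟨a, ha, hfa⟩, hf'⟩ := hf
  set p : PowerSeries A := PowerSeries.mk fun n => f.coeff (n + d v) with hp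
  have hpu : IsUnit p := by
    rw [PowerSeries.isUnit_iff_constantCoeff, ← PowerSeries.coeff_zero_eq_constantCoeff_apply, hp,
      PowerSeries.coeff_mk, Nat.cast_zero, zero_add, hfa]
    exact (he.isUnit v).smul (Units.mk0 a ha)
  have hs : IsUnit (HahnSeries.single (d v) (1 : A)) := by
    refine isUnit_iff_exists.mpr ⟨HahnSeries.single (-d v) 1, ?_, ?_⟩ <;>
    simp [HahnSeries.single_mul_single]
  have : f = HahnSeries.single (d v) 1 * HahnSeries.ofPowerSeries ℤ _ p := by
    ext1
    funext i
    rw [HahnSeries.coeff_single_mul, one_mul]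
    rcases lt_or_ge i (d v) with h | h
    · rw [hf' i h, HahnSeries.ofPowerSeries_apply, HahnSeries.embDomain_of_notMem_range]
      simp only [Set.mem_range, not_exists]
      intro n
      simp
      omega
    · obtain ⟨n, hn⟩ := Int.eq_ofNat_of_zero_le (sub_nonneg.mpr h)
      rw [hn, HahnSeries.ofPowerSeries_apply_coeff, hp, PowerSeries.coeff_mk, ← hn, sub_add_cancel]
  rw [this]
  exact hs.mul (hpu.map (HahnSeries.ofPowerSeries ℤ A))

theorem linearIndependent_of_hasLead (he : IsTwistedGroupFamily k e) {ι : Type*}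
    {f : ι → HahnSeries ℤ A} {v : ι → G}
    (hf : ∀ i, HasLead k e d (f i) (v i)) (hv : Function.Injective v) :
    LinearIndependent k f := by
  classical
  rw [linearIndependent_iff']
  intro s a ha
  by_contra! hne
  obtain ⟨i₀, hi₀, hai₀⟩ := hne
  -- among the terms with nonzero coefficients, look at those of least order
  obtain ⟨i₁, hi₁, hmin⟩ := Finset.exists_min_image (s.filter fun i => a i ≠ 0) (fun i => d (v i))
    ⟨i₀, Finset.mem_filter.mpr ⟨hi₀, hai₀⟩⟩
  rw [Finset.mem_filter] at hi₁
  choose c hc hcoeff using fun i => (hf i).1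
  have h := congrArg (fun g : HahnSeries ℤ A => g.coeff (d (v i₁))) ha
  simp only [HahnSeries.coeff_sum, HahnSeries.coeff_smul, HahnSeries.coeff_zero] at h
  have h' : ∑ i ∈ s.filter (fun i => d (v i) = d (v i₁)), (a i * c i) • e (v i) = 0 := by
    rw [← h, Finset.sum_filter]
    refine Finset.sum_congr rfl fun i hi => ?_
    split_ifs with hd
    · rw [← hd, hcoeff, smul_smul]
    · by_cases hai : a i = 0
      · rw [hai, zero_smul]
      · have := hmin i (Finset.mem_filter.mpr ⟨hi, hai⟩)
        rw [(hf i).2 _ (lt_of_le_of_ne this (Ne.symm hd)), smul_zero]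
  have := linearIndependent_iff'.mp (he.linearIndependent.comp v hv) _ _ h' i₁
    (Finset.mem_filter.mpr ⟨hi₁.1, rfl⟩)
  exact mul_ne_zero hi₁.2 (hc i₁) this

end HasLead

/-! ### Leading monomials of minors -/

section TorusMatrixLeads

/-- The monomial which pairs the rows in one list with the columns in another. -/
def pairing : List ℕ → List ℕ → (ℕ × ℕ →₀ ℤ)
  | i :: I, j :: J => Finsupp.single (i, j) 1 + pairing I J
  | _, _ => 0

/-- The order `-∑ i j` of the monomial in which `t i j` occurs with exponent one. It makes the
diagonal term of a minor the one of least order. -/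
def matrixOrder : (ℕ × ℕ →₀ ℤ) →ₗ[ℤ] ℤ :=
  Finsupp.linearCombination ℤ fun p : ℕ × ℕ => -((p.1 : ℤ) * p.2)

/-- The bilinear form which is one on pairs of positions `p`, `p'` in the same row or column with
`p` before `p'`, and zero on all other pairs. Its antisymmetrisation records the commutation
relations of the quantum torus in which the matrix is built. -/
def rookForm : (ℕ × ℕ →₀ ℤ) →ₗ[ℤ] (ℕ × ℕ →₀ ℤ) →ₗ[ℤ] ℤ :=
  Finsupp.linearCombination ℤ fun p : ℕ × ℕ => Finsupp.linearCombination ℤ fun p' : ℕ × ℕ =>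
    if (p.1 = p'.1 ∧ p.2 < p'.2) ∨ (p.1 < p'.1 ∧ p.2 = p'.2) then 1 else 0

theorem matrixOrder_single (i j : ℕ) (a : ℤ) :
    matrixOrder (Finsupp.single (i, j) a) = -(a * (i * j)) := by
  simp [matrixOrder]

theorem rookForm_single (p p' : ℕ × ℕ) :
    rookForm (Finsupp.single p 1) (Finsupp.single p' 1) =
      if (p.1 = p'.1 ∧ p.2 < p'.2) ∨ (p.1 < p'.1 ∧ p.2 = p'.2) then 1 else 0 := by
  simp [rookForm]

/-- The rearrangement inequality which singles out the diagonal term of a minor in its expansion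
along the first column. -/
theorem matrixOrder_pairing_lt {i₁ j : ℕ} {R c : List ℕ} {i : ℕ}
    (hR : (i₁ :: R).Pairwise (· < ·)) (hc : (j :: c).Pairwise (· < ·)) (hlen : R.length = c.length)
    (hi : i ∈ R) :
    matrixOrder (Finsupp.single (i₁, j) 1 + pairing R c) <
      matrixOrder (Finsupp.single (i, j) 1 + pairing (i₁ :: R.erase i) c) := by
  induction R generalizing i₁ j c with
  | nil => simp at hi
  | cons r R ih =>
    cases c with
    | nil => simp at hlen
    | cons j' c =>
      have h1 : i₁ < r := (List.pairwise_cons.mp hR).1 r (by simp)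
      have h2 : j < j' := (List.pairwise_cons.mp hc).1 j' (by simp)
      have hR' := (List.pairwise_cons.mp hR).2
      have hc' := (List.pairwise_cons.mp hc).2
      by_cases hir : i = r
      · subst hir
        simp only [List.erase_cons_head, pairing, map_add, matrixOrder_single]
        zify at h1 h2
        nlinarith
      · have hiR : i ∈ R := by
          rcases List.mem_cons.mp hi with h | h
          · exact absurd h hir
          · exact h
        have h3 : r < i := (List.pairwise_cons.mp hR').1 i hiR
        have := ih hR' hc' (by simpa using hlen) hiR
        rw [List.erase_cons_tail (by simpa using fun h => hir h.symm)]
        simp only [pairing, map_add, matrixOrder_single] at this ⊢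
        zify at h1 h2 h3
        nlinarith

variable {k : Type*} [Field k] {q : k} {A : Type*} [Ring A] [Algebra k A]
  {e : (ℕ × ℕ →₀ ℤ) → A} {m n : ℕ}

/-- The leading monomial of a minor is the product of the leading monomials on its diagonal. -/
theorem hasLead_qdet (he : IsTwistedGroupFamily k e) (hq : q ≠ 0) {X : ℕ → ℕ → HahnSeries ℤ A}
    (hX : ∀ i j, i < m → j < n → HasLead k e matrixOrder (X i j) (Finsupp.single (i, j) 1))
    {c R : List ℕ} (hc : c.Pairwise (· < ·)) (hcn : ∀ j ∈ c, j < n) (hR : R.Pairwise (· < ·))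
    (hRm : ∀ i ∈ R, i < m) (hlen : R.length = c.length) :
    HasLead k e matrixOrder (qdet q X c R.toFinset) (pairing R c) := by
  induction c generalizing R with
  | nil =>
    obtain rfl : R = [] := List.length_eq_zero_iff.mp hlen
    simpa [qdet_nil, pairing] using HasLead.one he
  | cons j c ih =>
    cases R with
    | nil => simp at hlen
    | cons i₁ R =>
      have hR' := List.pairwise_cons.mp hR
      have hlen' : R.length = c.length := by simpa using hlen
      have term : ∀ i ∈ i₁ :: R, HasLead k e matrixOrder
          ((-q) ^ ((i₁ :: R).toFinset.filter (· < i)).card •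
            (X i j * qdet q X c ((i₁ :: R).toFinset.erase i)))
          (Finsupp.single (i, j) 1 + pairing ((i₁ :: R).erase i) c) := by
        intro i hi
        refine HasLead.smul ?_ (pow_ne_zero _ (neg_ne_zero.mpr hq))
        refine (hX i j (hRm i hi) (hcn j (by simp))).mul he ?_
        have : (i₁ :: R).toFinset.erase i = ((i₁ :: R).erase i).toFinset := by
          ext x
          rw [Finset.mem_erase, List.mem_toFinset, List.mem_toFinset,
            List.Nodup.mem_erase_iff (hR.imp fun h => h.ne)]
        rw [this]
        refine ih (List.pairwise_cons.mp hc).2 (fun j' hj' => hcn j' (by simp [hj']))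
          (hR.sublist List.erase_sublist) (fun i' hi' => hRm i' (List.mem_of_mem_erase hi')) ?_
        rw [List.length_erase_of_mem hi]
        simpa using hlen
      rw [qdet_cons, ← Finset.add_sum_erase _ _ (show i₁ ∈ (i₁ :: R).toFinset by simp)]
      have h0 := term i₁ (by simp)
      rw [List.erase_cons_head] at h0
      refine h0.add_sum _ _ (fun i => Finsupp.single (i, j) 1 + pairing ((i₁ :: R).erase i) c)
        ?_ ?_
      · intro i hi
        exact term i (List.mem_toFinset.mp (Finset.mem_of_mem_erase hi))
      · intro i hi
        rw [Finset.mem_erase, List.mem_toFinset, List.mem_cons] at hi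
        rw [List.erase_cons_tail (by simpa using Ne.symm hi.1)]
        exact matrixOrder_pairing_lt hR hc hlen' (hi.2.resolve_left hi.1)

/-- The entries of the matrix built from the units `t i j` have the same leading monomials as the
units themselves. -/
theorem hasLead_torusMat (he : IsTwistedGroupFamily k e) {t : ℕ → ℕ → (HahnSeries ℤ A)ˣ}
    (ht : ∀ i j, HasLead k e matrixOrder (t i j : HahnSeries ℤ A) (Finsupp.single (i, j) 1))
    (ht' : ∀ i j, HasLead k e matrixOrder (↑(t i j)⁻¹ : HahnSeries ℤ A)
      (-Finsupp.single (i, j) 1)) {r i j : ℕ} (hi : i < r) (hj : j < n) :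
    HasLead k e matrixOrder (torusMat t n r i j) (Finsupp.single (i, j) 1) := by
  induction r generalizing j with
  | zero => omega
  | succ r ih =>
    by_cases hir : i < r
    swap
    · obtain rfl : i = r := by omega
      simp only [torusMat, if_neg hir]
      exact ht i j
    simp only [torusMat, if_pos hir]
    -- the summand with `c = j` is the entry of the smaller matrix; the order of any other one is
    -- larger by `(r - i) (c - j)`
    rw [← Finset.Ioo_insert_left hj, Finset.sum_insert (by simp), add_mul, mul_assoc,
      Units.inv_mul, mul_one, Finset.sum_mul]
    refine (ih hir hj).add_sum _ _
      (fun c => Finsupp.single (i, c) 1 + -Finsupp.single (r, c) 1 + Finsupp.single (r, j) 1) ?_ ?_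
    · intro c hc
      rw [Finset.mem_Ioo] at hc
      exact ((ih hir hc.2).mul he (ht' r c)).mul he (ht r j)
    · intro c hc
      rw [Finset.mem_Ioo] at hc
      simp only [map_add, map_neg, matrixOrder_single]
      have h1 := hc.1
      zify at h1 hir
      nlinarith

theorem hahnSeries_single_smul (a : ℤ) (c : k) (x : A) :
    HahnSeries.single a (c • x) = c • HahnSeries.single a x := by
  ext i
  rw [HahnSeries.coeff_smul, HahnSeries.coeff_single, HahnSeries.coeff_single]
  split_ifs <;> simp

/-- A quantum matrix of Laurent series all of whose minors have leading monomials, the products of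
their diagonal entries. -/
theorem IsTwistedGroupFamily.exists_isQMat (he : IsTwistedGroupFamily k e) (hq : q ≠ 0)
    (hcomm : ∀ g h, e g * e h = q ^ (rookForm g h - rookForm h g) • (e h * e g)) (m n : ℕ) :
    ∃ X : ℕ → ℕ → HahnSeries ℤ A, IsQMat q m n X ∧
      ∀ I J : Finset ℕ, I ⊆ Finset.range m → J ⊆ Finset.range n → I.card = J.card →
        HasLead k e matrixOrder (qdet q X J.sort I) (pairing I.sort J.sort) := by
  have lead : ∀ v, HasLead k e matrixOrder (HahnSeries.single (matrixOrder v) (e v)) v := fun v =>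
    ⟨⟨1, one_ne_zero, by simp⟩, fun i hi => HahnSeries.coeff_single_of_ne hi.ne⟩
  choose t ht using fun v => (lead v).isUnit he
  have ht' : ∀ v, HasLead k e matrixOrder (↑(t v)⁻¹ : HahnSeries ℤ A) (-v) := by
    intro v
    obtain ⟨c, hc, h⟩ := he.mul v (-v)
    have : (↑(t v)⁻¹ : HahnSeries ℤ A) =
        c⁻¹ • HahnSeries.single (matrixOrder (-v)) (e (-v)) := by
      refine Units.inv_eq_of_mul_eq_one_right ?_
      rw [ht, mul_smul_comm, HahnSeries.single_mul_single, h, add_neg_cancel, he.zero, map_neg,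
        add_neg_cancel, ← hahnSeries_single_smul, smul_smul, inv_mul_cancel₀ hc, one_smul]
      rfl
    rw [this]
    exact (lead _).smul (inv_ne_zero hc)
  have comm : ∀ g h, (t g * t h : HahnSeries ℤ A) =
      q ^ (rookForm g h - rookForm h g) • (t h * t g : HahnSeries ℤ A) := by
    intro g h
    rw [ht, ht, HahnSeries.single_mul_single, HahnSeries.single_mul_single, hcomm, add_comm,
      hahnSeries_single_smul]
  set T : ℕ → ℕ → (HahnSeries ℤ A)ˣ := fun i j => t (Finsupp.single (i, j) 1)
  have hX : ∀ i j, i < m → j < n →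
      HasLead k e matrixOrder (torusMat T n m i j) (Finsupp.single (i, j) 1) := fun i j hi hj =>
    hasLead_torusMat he (fun i j => by rw [ht]; exact lead _) (fun i j => ht' _) hi hj
  refine ⟨torusMat T n m, torusMat_isQMat (m := m) hq ?_ ?_ m le_rfl, fun I J hI hJ hIJ => ?_⟩
  · intro i j l _ hjl _
    rw [comm, rookForm_single, rookForm_single, if_pos (Or.inl ⟨rfl, hjl⟩), if_neg (by grind)]
    simp [T]
  · intro i s j l his _ _ _
    have h0 : rookForm (Finsupp.single (s, l) 1) (Finsupp.single (i, j) 1) = 0 := by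
      rw [rookForm_single, if_neg (by grind)]
    rw [comm, h0, rookForm_single]
    by_cases hjl : j = l
    · rw [if_pos (Or.inr ⟨his, hjl⟩), if_pos hjl]
      simp [T]
    · rw [if_neg (by grind), if_neg hjl]
      simp [T]
  · have h := hasLead_qdet he hq hX (pairwise_lt_sort J)
      (fun j hj => Finset.mem_range.mp (hJ ((Finset.mem_sort _).mp hj))) (pairwise_lt_sort I)
      (fun i hi => Finset.mem_range.mp (hI ((Finset.mem_sort _).mp hi))) (by simpa using hIJ)
    rwa [Finset.sort_toFinset] at h

end TorusMatrixLeads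

universe u in
/-- The quantum torus for the antisymmetrisation of `rookForm`, realised by operators. -/
theorem exists_isTwistedGroupFamily {k : Type u} [Field k] {q : k} (hq : q ≠ 0) :
    ∃ (A : Type u) (_ : Ring A) (_ : Algebra k A) (e : (ℕ × ℕ →₀ ℤ) → A),
      IsTwistedGroupFamily k e ∧
        ∀ g h, e g * e h = q ^ (rookForm g h - rookForm h g) • (e h * e g) := by
  refine ⟨_, inferInstance, inferInstance, torusOp q rookForm, isTwistedGroupFamily_torusOp _ hq,
    fun g h => ?_⟩
  rw [torusOp_mul _ hq, torusOp_mul _ hq, smul_smul, ← zpow_add₀ hq, sub_add_cancel, add_comm]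

/-! ### Growth and injectivity -/

section Growth

variable {k : Type*} [Field k] {S : Type*} [Ring S] [Algebra k S] {ι : Type*}

variable (k) in
/-- The span of the words of length at most `D`. -/
def wordSpan (x : ι → S) (D : ℕ) : Submodule k S :=
  Submodule.span k (wordProd x '' {l | l.length ≤ D})

theorem mul_mem_wordSpan {x : ι → S} {C D : ℕ} {a b : S} (ha : a ∈ wordSpan k x C)
    (hb : b ∈ wordSpan k x D) : a * b ∈ wordSpan k x (C + D) := by
  have h := Submodule.mul_mem_mul ha hb
  rw [wordSpan, wordSpan, Submodule.span_mul_span] at h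
  refine Submodule.span_mono ?_ h
  rintro _ ⟨_, ⟨l, hl, rfl⟩, _, ⟨l', hl', rfl⟩, rfl⟩
  refine ⟨l ++ l', ?_, wordProd_append x l l'⟩
  rw [Set.mem_ofPred_eq] at *
  rw [List.length_append]
  omega

theorem one_mem_wordSpan (x : ι → S) (D : ℕ) : 1 ∈ wordSpan k x D :=
  Submodule.subset_span ⟨[], Nat.zero_le D, by simp [wordProd]⟩

theorem wordSpan_mono (x : ι → S) {C D : ℕ} (h : C ≤ D) : wordSpan k x C ≤ wordSpan k x D :=
  Submodule.span_mono (Set.image_mono fun _ hl => le_trans hl h)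

theorem wordProd_mem_wordSpan {κ : Type*} {x : ι → S} {C : ℕ} {w : κ → S}
    (hw : ∀ i, w i ∈ wordSpan k x C) (l : List κ) :
    wordProd w l ∈ wordSpan k x (C * l.length) := by
  induction l with
  | nil => simpa [wordProd] using one_mem_wordSpan x 0
  | cons i l ih =>
    rw [wordProd_cons, List.length_cons, Nat.mul_succ, Nat.add_comm]
    exact mul_mem_wordSpan (hw i) ih

/-- The number of exponents up to degree `D` which are not divisible by `e₀` is bounded by a
polynomial in `D` whose degree is one less than the number of variables: one coordinate is smaller
than that of `e₀`. -/
theorem finite_not_le [Fintype ι] (e₀ : ι →₀ ℕ) (D : ℕ) :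
    {e : ι →₀ ℕ | e.degree ≤ D ∧ ¬ e₀ ≤ e}.Finite ∧
      {e : ι →₀ ℕ | e.degree ≤ D ∧ ¬ e₀ ≤ e}.ncard ≤
        e₀.degree * (D + 1) ^ (Fintype.card ι - 1) := by
  classical
  set F : Finset (ι →₀ ℕ) := Finset.univ.biUnion fun p : ι =>
    (Fintype.piFinset fun p' => if p' = p then Finset.range (e₀ p) else Finset.range (D + 1)).map
      (Finsupp.equivFunOnFinite (M := ℕ)).symm.toEmbedding with hF
  have hsub : {e : ι →₀ ℕ | e.degree ≤ D ∧ ¬ e₀ ≤ e} ⊆ F := by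
    rintro e ⟨hD, he⟩
    rw [Finsupp.le_def] at he
    push Not at he
    obtain ⟨p, hp⟩ := he
    rw [hF, Finset.mem_coe, Finset.mem_biUnion]
    refine ⟨p, Finset.mem_univ p, Finset.mem_map.mpr ⟨e, ?_, by ext; simp⟩⟩
    rw [Fintype.mem_piFinset]
    intro p'
    split_ifs with h
    · rw [h]
      exact Finset.mem_range.mpr hp
    · exact Finset.mem_range.mpr (Nat.lt_succ_of_le ((Finsupp.le_degree p' e).trans hD))
  refine ⟨F.finite_toSet.subset hsub, (Set.ncard_le_ncard hsub F.finite_toSet).trans ?_⟩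
  rw [Set.ncard_coe_finset, Finsupp.degree_eq_sum, Finset.sum_mul]
  refine Finset.card_biUnion_le.trans (Finset.sum_le_sum fun p _ => ?_)
  rw [Finset.card_map, Fintype.card_piFinset, ← Finset.mul_prod_erase _ _ (Finset.mem_univ p),
    if_pos rfl, Finset.card_range]
  refine Nat.mul_le_mul_left _ (le_of_eq ?_)
  rw [Finset.prod_congr rfl (g := fun _ => D + 1), Finset.prod_const,
    Finset.card_erase_of_mem (Finset.mem_univ p), Finset.card_univ]
  intro p' hp'
  rw [if_neg (Finset.ne_of_mem_erase hp'), Finset.card_range]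

variable [LinearOrder ι]

/-- A homomorphism from an algebra with quasicommuting generators is injective if its image grows as
fast as a polynomial ring in as many variables: a kernel would bound the growth of the image by a
polynomial of smaller degree. -/
theorem QuasiCommute.injective_of_growth [Fintype ι] {x : ι → S} (hx : QuasiCommute k x)
    (hspan : ∀ s : S, s ∈ Submodule.span k (Set.range (wordProd x)))
    {R : Type*} [Ring R] [Algebra k R] (ρ : S →ₐ[k] R) (C : ℕ)
    (h : ∀ L : ℕ, ∃ g : (ι → Fin (L + 1)) → R, LinearIndependent k g ∧
      ∀ E, g E ∈ (wordSpan k x (C * L)).map ρ.toLinearMap) :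
    Function.Injective ρ := by
  classical
  rw [injective_iff_map_eq_zero]
  intro f hρ
  by_contra hf
  obtain ⟨e₀, he₀⟩ := hx.exists_exponent_of_ker hspan ρ hf hρ
  -- with this `L`, the bound `e₀.degree * (C * L + 1) ^ (N - 1)` for the dimension, where `N` is the
  -- number of generators, is at most `L * (L + 1) ^ (N - 1)`, which is less than `(L + 1) ^ N`
  set L := e₀.degree * (C + 1) ^ (Fintype.card ι - 1) with hL
  obtain ⟨g, hg, hmem⟩ := h L
  obtain ⟨hfin, hcard⟩ := finite_not_le e₀ (C * L)
  set W := (fun e : ι →₀ ℕ => ρ (wordProd x (contentWord e))) ''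
    {e | e.degree ≤ C * L ∧ ¬ e₀ ≤ e} with hW
  have hWfin : W.Finite := hfin.image _
  have : Fintype W := hWfin.fintype
  have hle : (wordSpan k x (C * L)).map ρ.toLinearMap ≤ Submodule.span k W := by
    rw [wordSpan, Submodule.map_span, Submodule.span_le]
    rintro _ ⟨_, ⟨l, hl, rfl⟩, rfl⟩
    exact he₀ _ l hl
  have h1 := linearIndependent_le_span' g hg W
    (by rintro _ ⟨E, rfl⟩; exact hle (hmem E))
  rw [Cardinal.mk_fintype, Fintype.card_fun, Fintype.card_fin, Nat.cast_le,
    Set.fintypeCard_eq_ncard] at h1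
  have h2 : (L + 1) ^ Fintype.card ι ≤ e₀.degree * (C * L + 1) ^ (Fintype.card ι - 1) :=
    (h1.trans (Set.ncard_image_le hfin)).trans hcard
  rcases Nat.eq_zero_or_pos (Fintype.card ι) with h0 | hpos
  · have : IsEmpty ι := Fintype.card_eq_zero_iff.mp h0
    have : e₀ = 0 := Subsingleton.elim _ _
    rw [h0, this] at h2
    simp at h2
  · have h3 : e₀.degree * (C * L + 1) ^ (Fintype.card ι - 1) ≤
        L * (L + 1) ^ (Fintype.card ι - 1) := by
      conv_rhs => rw [hL]
      rw [mul_assoc, ← mul_pow]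
      gcongr
      nlinarith
    have h4 : (L + 1) ^ Fintype.card ι = (L + 1) * (L + 1) ^ (Fintype.card ι - 1) := by
      rw [← pow_succ', Nat.sub_add_cancel hpos]
    have h5 : 0 < (L + 1) ^ (Fintype.card ι - 1) := by positivity
    nlinarith

end Growth

/-! ### The algebra of quantum matrices and its minors -/

section QuantumMinors

variable {k : Type*} [Field k] {q : k}

/-- The permutation of `Fin (t + 1)` which maps `0` to `p` and is `τ` on the remaining entries. -/
def consPerm {t : ℕ} (p : Fin (t + 1)) (τ : Equiv.Perm (Fin t)) : Equiv.Perm (Fin (t + 1)) :=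
  ((finSuccEquiv t).trans (Equiv.optionCongr τ)).trans (finSuccEquiv' p).symm

theorem consPerm_zero {t : ℕ} (p : Fin (t + 1)) (τ : Equiv.Perm (Fin t)) :
    consPerm p τ 0 = p := by
  simp [consPerm]

theorem consPerm_succ {t : ℕ} (p : Fin (t + 1)) (τ : Equiv.Perm (Fin t)) (r : Fin t) :
    consPerm p τ r.succ = p.succAbove (τ r) := by
  simp [consPerm]

theorem consPerm_bijective (t : ℕ) : Function.Bijective
    fun x : Fin (t + 1) × Equiv.Perm (Fin t) => consPerm x.1 x.2 := by
  rw [Fintype.bijective_iff_injective_and_card]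
  constructor
  · rintro ⟨p, τ⟩ ⟨p', τ'⟩ h
    have h0 : p = p' := by
      have := congrArg (fun σ : Equiv.Perm (Fin (t + 1)) => σ 0) h
      simpa only [consPerm_zero] using this
    subst h0
    congr 1
    ext1 r
    have := congrArg (fun σ : Equiv.Perm (Fin (t + 1)) => σ r.succ) h
    simp only [consPerm_succ] at this
    exact Fin.succAbove_right_injective this
  · rw [Fintype.card_prod, Fintype.card_perm, Fintype.card_perm, Fintype.card_fin,
      Fintype.card_fin, Nat.factorial_succ]

theorem invCount_consPerm {t : ℕ} (p : Fin (t + 1)) (τ : Equiv.Perm (Fin t)) :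
    invCount (consPerm p τ) = p + invCount τ := by
  have hp : ∑ r : Fin t, (if p.succAbove (τ r) < p then 1 else 0) = (p : ℕ) := by
    rw [Equiv.sum_comp τ fun r => if p.succAbove r < p then 1 else 0]
    have h := Fin.sum_univ_succAbove (fun x : Fin (t + 1) => if x < p then 1 else 0) p
    rw [if_neg (lt_irrefl p), zero_add] at h
    rw [← h, ← Finset.card_filter, Finset.filter_gt_eq_Iio, Fin.card_Iio]
  unfold invCount
  rw [Finset.card_filter, Finset.card_filter, Fintype.sum_prod_type, Fintype.sum_prod_type,
    Fin.sum_univ_succ]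
  congr 1
  · rw [Fin.sum_univ_succ, ← hp]
    simp [consPerm_zero, consPerm_succ]
  · refine Finset.sum_congr rfl fun a _ => ?_
    rw [Fin.sum_univ_succ]
    simp [consPerm_succ, Fin.succAbove_lt_succAbove_iff]

variable {R : Type*} [Ring R] [Algebra k R]

/-- The sum over permutations defining a quantum minor agrees with its Laplace expansion. -/
theorem sum_perm_eq_qdet (X : ℕ → ℕ → R) {t : ℕ} {f : Fin t → ℕ} (hf : StrictMono f)
    (g : Fin t → ℕ) :
    ∑ σ : Equiv.Perm (Fin t), (-q) ^ invCount σ •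
      (List.ofFn fun r => X (f (σ r)) (g r)).prod =
        qdet q X (List.ofFn g) (Finset.univ.image f) := by
  induction t with
  | zero => simp [invCount, qdet_nil]
  | succ t ih =>
    rw [← Function.Bijective.sum_comp (consPerm_bijective t), Fintype.sum_prod_type,
      List.ofFn_succ, qdet_cons, Finset.sum_image fun _ _ _ _ h => hf.injective h]
    refine Finset.sum_congr rfl fun p _ => ?_
    have h1 : ((Finset.univ.image f).filter (· < f p)).card = p := by
      rw [Finset.filter_image, Finset.card_image_of_injective _ hf.injective]
      simp [hf.lt_iff_lt, Finset.filter_gt_eq_Iio]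
    have h2 : (Finset.univ.image f).erase (f p) =
        Finset.univ.image fun r => f (p.succAbove r) := by
      ext x
      simp only [Finset.mem_erase, Finset.mem_image, Finset.mem_univ, true_and]
      constructor
      · rintro ⟨hx, i, rfl⟩
        obtain ⟨r, rfl⟩ := Fin.exists_succAbove_eq fun h : i = p => hx (by rw [h])
        exact ⟨r, rfl⟩
      · rintro ⟨r, rfl⟩
        exact ⟨fun h => Fin.succAbove_ne p r (hf.injective h), _, rfl⟩
    rw [h1, h2, ← ih (f := fun r => f (p.succAbove r))
      (hf.comp (Fin.strictMono_succAbove p)) fun r => g r.succ, Finset.mul_sum, Finset.smul_sum]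
    refine Finset.sum_congr rfl fun τ _ => ?_
    simp only [invCount_consPerm, List.ofFn_succ, List.prod_cons, consPerm_zero, consPerm_succ,
      mul_smul_comm, smul_smul, pow_add]

variable {m n : ℕ}

theorem xGen_row (i : Fin m) {j l : Fin n} (h : j < l) :
    xGen k q i j * xGen k q i l = q • (xGen k q i l * xGen k q i j) := by
  simpa only [xGen, map_mul, map_smul] using RingQuot.mkAlgHom_rel k (QMatRel.row (q := q) i j l h)

theorem xGen_col {i s : Fin m} (j : Fin n) (h : i < s) :
    xGen k q i j * xGen k q s j = q • (xGen k q s j * xGen k q i j) := by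
  simpa only [xGen, map_mul, map_smul] using RingQuot.mkAlgHom_rel k (QMatRel.col (q := q) i s j h)

theorem xGen_anti {i s : Fin m} {j l : Fin n} (h : s < i) (h' : j < l) :
    xGen k q i j * xGen k q s l = xGen k q s l * xGen k q i j := by
  simpa only [xGen, map_mul] using
    RingQuot.mkAlgHom_rel k (QMatRel.anti (q := q) i s j l h h')

theorem xGen_diag {i s : Fin m} {j l : Fin n} (h : i < s) (h' : j < l) :
    xGen k q i j * xGen k q s l - xGen k q s l * xGen k q i j =
      (q - q⁻¹) • (xGen k q i l * xGen k q s j) := by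
  simpa only [xGen, map_mul, map_smul, map_sub] using
    RingQuot.mkAlgHom_rel k (QMatRel.diag (q := q) i s j l h h')

/-- The homomorphism from the generic algebra of quantum matrices given by a quantum matrix. -/
def IsQMat.lift {X : ℕ → ℕ → R} (hX : IsQMat q m n X) : QMat k q m n →ₐ[k] R :=
  RingQuot.liftAlgHom k ⟨FreeAlgebra.lift k fun p => X p.1 p.2, by
    intro a b h
    cases h with
    | row i j l h => simpa using hX.row i j l i.2 h l.2
    | col i s j h => simpa using hX.col i s j h s.2 j.2
    | anti i s j l h h' => simpa using hX.anti s i j l h i.2 h' l.2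
    | diag i s j l h h' => simpa using hX.diag i s j l h s.2 h' l.2⟩

theorem IsQMat.lift_xGen {X : ℕ → ℕ → R} (hX : IsQMat q m n X) (i : Fin m) (j : Fin n) :
    hX.lift (xGen k q i j) = X i j := by
  simp [IsQMat.lift, xGen]

theorem IsQMat.lift_qMinor {X : ℕ → ℕ → R} (hX : IsQMat q m n X) {t : ℕ} (I : Finset (Fin m))
    (J : Finset (Fin n)) (hI : I.card = t) (hJ : J.card = t) :
    hX.lift (qMinor q I J hI hJ) =
      qdet q X (J.map Fin.valEmbedding).sort (I.map Fin.valEmbedding) := by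
  have h1 : (J.map Fin.valEmbedding).sort = List.ofFn fun r => (J.orderEmbOfFin hJ r : ℕ) := by
    refine sort_eq_of_pairwise ?_ fun x => ?_
    · rw [List.pairwise_ofFn]
      intro a b hab
      exact (J.orderEmbOfFin hJ).strictMono hab
    · rw [List.mem_ofFn, Finset.mem_map]
      constructor
      · rintro ⟨r, rfl⟩
        exact ⟨_, J.orderEmbOfFin_mem hJ r, rfl⟩
      · rintro ⟨j, hj, rfl⟩
        obtain ⟨r, rfl⟩ := (Set.ext_iff.mp (J.range_orderEmbOfFin hJ) j).mpr hj
        exact ⟨r, rfl⟩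
  have h2 : I.map Fin.valEmbedding = Finset.univ.image fun r => (I.orderEmbOfFin hI r : ℕ) := by
    ext x
    rw [Finset.mem_image, Finset.mem_map]
    constructor
    · rintro ⟨i, hi, rfl⟩
      obtain ⟨r, rfl⟩ := (Set.ext_iff.mp (I.range_orderEmbOfFin hI) i).mpr hi
      exact ⟨r, Finset.mem_univ r, rfl⟩
    · rintro ⟨r, _, rfl⟩
      exact ⟨_, I.orderEmbOfFin_mem hI r, rfl⟩
  rw [h1, h2, ← sum_perm_eq_qdet X (f := fun r => (I.orderEmbOfFin hI r : ℕ))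
    (fun a b hab => (I.orderEmbOfFin hI).strictMono hab), qMinor, map_sum]
  refine Finset.sum_congr rfl fun σ _ => ?_
  rw [map_smul, map_list_prod, List.map_ofFn]
  simp only [Function.comp_def, hX.lift_xGen]

/-- The generators of quantum matrices, indexed by the lexicographically ordered positions. -/
def matGen (k : Type*) [Field k] (q : k) (m n : ℕ) (p : Fin m ×ₗ Fin n) : QMat k q m n :=
  xGen k q (ofLex p).1 (ofLex p).2

/-- The generators quasicommute: the extra term `x_{il} x_{sj}` for `i < s`, `j < l` has smaller
content than `x_{ij} x_{sl}`, since `(i, j)` is the first of the four positions. -/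
theorem quasiCommute_matGen (hq : q ≠ 0) (m n : ℕ) : QuasiCommute k (matGen k q m n) := by
  have of_eq : ∀ {p p' : Fin m ×ₗ Fin n} {c : k}, c ≠ 0 →
      matGen k q m n p * matGen k q m n p' = c • (matGen k q m n p' * matGen k q m n p) →
      ∃ c : k, c ≠ 0 ∧ matGen k q m n p * matGen k q m n p' -
        c • (matGen k q m n p' * matGen k q m n p) ∈
          lowerSpan k (matGen k q m n) (Finsupp.single p 1 + Finsupp.single p' 1) :=
    fun {p p' c} hc h => ⟨c, hc, by rw [h, sub_self]; exact zero_mem _⟩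
  have swap : ∀ {x y : QMat k q m n}, x * y = q • (y * x) → y * x = q⁻¹ • (x * y) := by
    intro x y h
    rw [h, smul_smul, inv_mul_cancel₀ hq, one_smul]
  have lower : ∀ {i s : Fin m} {j l : Fin n}, i < s → j < l →
      xGen k q i l * xGen k q s j ∈ lowerSpan k (matGen k q m n)
        (Finsupp.single (toLex (i, j)) 1 + Finsupp.single (toLex (s, l)) 1) := by
    intro i s j l h h'
    refine Submodule.subset_span ⟨[toLex (i, l), toLex (s, j)], ?_, ?_⟩
    · rw [Finsupp.DegLex.lt_iff]
      refine Or.inr ⟨?_, ?_⟩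
      · simp [wordContent]
      · rw [Finsupp.Lex.lt_iff]
        refine ⟨toLex (i, j), ?_, ?_⟩
        · intro p hp
          have h0 : toLex (i, j) < toLex (i, l) :=
            Prod.Lex.toLex_lt_toLex.mpr (Or.inr ⟨rfl, h'⟩)
          have e1 : p ≠ toLex (i, j) := hp.ne
          have e2 : p ≠ toLex (s, l) := (hp.trans (Prod.Lex.toLex_lt_toLex.mpr (Or.inl h))).ne
          have e3 : p ≠ toLex (i, l) := (hp.trans h0).ne
          have e4 : p ≠ toLex (s, j) := (hp.trans (Prod.Lex.toLex_lt_toLex.mpr (Or.inl h))).ne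
          simp [wordContent, e1.symm, e2.symm, e3.symm, e4.symm]
        · simp [wordContent, h.ne', h'.ne']
    · simp [wordProd, matGen]
  intro p p'
  obtain ⟨⟨i, j⟩, rfl⟩ := toLex.surjective p
  obtain ⟨⟨s, l⟩, rfl⟩ := toLex.surjective p'
  have hq' := inv_ne_zero hq
  rcases lt_trichotomy i s with h | rfl | h <;> rcases lt_trichotomy j l with h' | rfl | h'
  · refine ⟨1, one_ne_zero, ?_⟩
    simp only [matGen, ofLex_toLex, one_smul, xGen_diag h h']
    exact Submodule.smul_mem _ _ (lower h h')
  · exact of_eq hq (xGen_col j h)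
  · exact of_eq one_ne_zero ((xGen_anti h h').symm.trans (one_smul _ _).symm)
  · exact of_eq hq (xGen_row i h')
  · exact of_eq one_ne_zero (one_smul _ _).symm
  · exact of_eq hq' (swap (xGen_row i h'))
  · exact of_eq one_ne_zero ((xGen_anti h h').trans (one_smul _ _).symm)
  · exact of_eq hq' (swap (xGen_col j h))
  · refine ⟨1, one_ne_zero, ?_⟩
    have e := xGen_diag (k := k) (q := q) h h'
    simp only [matGen, ofLex_toLex, one_smul]
    rw [← neg_sub, e, add_comm]
    exact Submodule.neg_mem _ (Submodule.smul_mem _ _ (lower h h'))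

theorem mem_span_wordProd_matGen (z : QMat k q m n) :
    z ∈ Submodule.span k (Set.range (wordProd (matGen k q m n))) := by
  obtain ⟨a, rfl⟩ := RingQuot.mkAlgHom_surjective k (QMatRel k q m n) z
  induction a using FreeAlgebra.induction with
  | grade0 r =>
    rw [AlgHom.commutes, Algebra.algebraMap_eq_smul_one]
    exact Submodule.smul_mem _ _ (Submodule.subset_span ⟨[], by simp [wordProd]⟩)
  | grade1 p =>
    exact Submodule.subset_span ⟨[toLex p], by simp [wordProd, matGen, xGen]⟩
  | mul a b ha hb =>
    rw [map_mul]
    have h := Submodule.mul_mem_mul ha hb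
    rw [Submodule.span_mul_span] at h
    refine Submodule.span_mono ?_ h
    rintro _ ⟨_, ⟨l, rfl⟩, _, ⟨l', rfl⟩, rfl⟩
    exact ⟨l ++ l', wordProd_append _ l l'⟩
  | add a b ha hb =>
    rw [map_add]
    exact Submodule.add_mem _ ha hb

end QuantumMinors

/-! ### Injectivity from leading monomials -/

section Injectivity

variable {k : Type*} [Field k] {q : k} {A : Type*} [Ring A] [Algebra k A]
  {e : (ℕ × ℕ →₀ ℤ) → A} {m n N : ℕ}

theorem HasLead.wordProd {G : Type*} [AddCommGroup G] {e : G → A} {d : G →ₗ[ℤ] ℤ}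
    (he : IsTwistedGroupFamily k e) {ι : Type*} {w : ι → HahnSeries ℤ A} {v : ι → G}
    (hw : ∀ i, HasLead k e d (w i) (v i)) (l : List ι) :
    HasLead k e d (wordProd w l) (l.map v).sum := by
  induction l with
  | nil => simpa [QuantumGrassmannian.wordProd] using HasLead.one he
  | cons i l ih =>
    rw [wordProd_cons, List.map_cons, List.sum_cons]
    exact (hw i).mul he ih

theorem sum_map_contentWord {ι : Type*} [LinearOrder ι] [Fintype ι] {G : Type*} [AddCommMonoid G]
    (v : ι → G) (E : ι →₀ ℕ) : ((contentWord E).map v).sum = ∑ p, E p • v p := by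
  have key : ∀ l : List ι, (l.map v).sum = Finsupp.linearCombination ℕ v (wordContent l) := by
    intro l
    induction l with
    | nil => simp [wordContent]
    | cons p l ih => simp [wordContent_cons, ih]
  rw [key, wordContent_contentWord, Finsupp.linearCombination_apply, Finsupp.sum_fintype]
  simp

/-- Quantum matrices with independent leading monomials satisfy no relations besides the defining
ones. -/
theorem IsQMat.lift_injective (he : IsTwistedGroupFamily k e) (hq : q ≠ 0)
    {X : ℕ → ℕ → HahnSeries ℤ A} (hX : IsQMat q m n X)
    (hlead : ∀ i j, i < m → j < n → HasLead k e matrixOrder (X i j) (Finsupp.single (i, j) 1)) :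
    Function.Injective hX.lift := by
  refine (quasiCommute_matGen hq m n).injective_of_linearIndependent mem_span_wordProd_matGen _ ?_
  have hmap : ∀ l, hX.lift (wordProd (matGen k q m n) l) =
      wordProd (fun p : Fin m ×ₗ Fin n => X (ofLex p).1 (ofLex p).2) l := by
    intro l
    rw [wordProd, wordProd, map_list_prod, List.map_map]
    simp only [Function.comp_def, matGen, hX.lift_xGen]
  simp only [hmap]
  refine linearIndependent_of_hasLead he (fun E => HasLead.wordProd he
    (fun p => hlead _ _ (ofLex p).1.2 (ofLex p).2.2) _) ?_
  intro E E' h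
  simp only [sum_map_contentWord] at h
  ext p
  have := DFunLike.congr_fun h ((ofLex p).1.val, (ofLex p).2.val)
  have key : ∀ E : Fin m ×ₗ Fin n →₀ ℕ, (∑ p', E p' •
      Finsupp.single ((ofLex p').1.val, (ofLex p').2.val) (1 : ℤ))
        ((ofLex p).1.val, (ofLex p).2.val) = E p := by
    intro E
    rw [Finsupp.finsetSum_apply, Finset.sum_eq_single p]
    · simp
    · intro p' _ hne
      rw [Finsupp.smul_apply, Finsupp.single_eq_of_ne, smul_zero]
      intro h'
      rw [Prod.mk.injEq] at h'
      exact hne (ofLex.injective (Prod.ext (Fin.ext h'.1.symm) (Fin.ext h'.2.symm)))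
    · simp
  rw [key, key] at this
  exact_mod_cast this

/-- Every set of columns of the right size arises from some rows and columns, whichever the
consecutive set one starts from. -/
theorem exists_cycSet_eq {a : ℕ} (hm : 0 < m) {K : Finset ℕ} (hK : K ⊆ Finset.range (m + N))
    (hcard : K.card = m) : ∃ I J : Finset ℕ, I ⊆ Finset.range m ∧ J ⊆ Finset.range N ∧
      I.card = J.card ∧ cycSet (m + N) m a I J = K := by
  set T := (Finset.range (m + N)).filter fun s => (a + s) % (m + N) ∈ K with hT
  have himg : T.image (fun s => (a + s) % (m + N)) = K := by
    ext x
    rw [Finset.mem_image]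
    constructor
    · rintro ⟨s, hs, rfl⟩
      exact (Finset.mem_filter.mp hs).2
    · intro hx
      have hxn := Finset.mem_range.mp (hK hx)
      have e : (a + (x + ((m + N) - a % (m + N))) % (m + N)) % (m + N) = x := by
        have hlt := Nat.mod_lt a (show 0 < m + N by omega)
        rw [Nat.add_mod_mod, ← Nat.mod_add_mod,
          show a % (m + N) + (x + (m + N - a % (m + N))) = x + (m + N) by omega,
          Nat.add_mod_right, Nat.mod_eq_of_lt hxn]
      refine ⟨(x + ((m + N) - a % (m + N))) % (m + N), ?_, e⟩
      rw [hT, Finset.mem_filter, e, Finset.mem_range]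
      exact ⟨Nat.mod_lt _ (by omega), hx⟩
  refine ⟨(Finset.range m).filter fun i => m - 1 - i ∉ T,
    (Finset.range N).filter fun j => m + j ∈ T, Finset.filter_subset _ _,
    Finset.filter_subset _ _, ?_, ?_⟩
  · have hinj : Set.InjOn (fun s => (a + s) % (m + N)) T := by
      intro s hs s' hs' h
      have h1 := Finset.mem_range.mp (Finset.mem_filter.mp hs).1
      have h2 := Finset.mem_range.mp (Finset.mem_filter.mp hs').1
      exact Nat.ModEq.eq_of_lt_of_lt (Nat.ModEq.add_left_cancel' a h) h1 h2
    have hTcard : T.card = m := by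
      rw [← hcard, ← himg, Finset.card_image_of_injOn hinj]
    have hsum : T.card = ((Finset.range m).filter (· ∈ T)).card +
        ((Finset.range N).filter fun j => m + j ∈ T).card := by
      have hTe : T = (Finset.range (m + N)).filter (· ∈ T) := by
        rw [Finset.filter_mem_eq_inter, Finset.inter_eq_right.mpr (Finset.filter_subset _ _)]
      conv_lhs => rw [hTe]
      rw [Finset.card_filter, Finset.card_filter, Finset.card_filter, Finset.sum_range_add]
    have hrefl : ((Finset.range m).filter fun i => m - 1 - i ∉ T).card =
        ((Finset.range m).filter (· ∉ T)).card := by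
      rw [Finset.card_filter, Finset.card_filter,
        Finset.sum_range_reflect (fun i => if i ∉ T then 1 else 0) m]
    have hcompl := Finset.card_filter_add_card_filter_not (s := Finset.range m) (· ∈ T)
    rw [Finset.card_range] at hcompl
    omega
  · rw [← himg, cycSet]
    congr 1
    ext s
    rw [Finset.mem_filter]
    have hTs : s ∈ T → s < m + N := fun h => Finset.mem_range.mp (Finset.mem_filter.mp h).1
    simp only [Finset.mem_filter, Finset.mem_range, not_and, not_not]
    constructor
    · rintro ⟨h, (⟨h1, h2⟩ | ⟨h1, h2⟩)⟩
      · have := h2 (by omega)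
        rwa [show m - 1 - (m - 1 - s) = s by omega] at this
      · have := h2.2
        rwa [show m + (s - m) = s by omega] at this
    · intro h
      refine ⟨hTs h, ?_⟩
      rcases lt_or_ge s m with hs | hs
      · refine Or.inl ⟨hs, fun _ => ?_⟩
        rwa [show m - 1 - (m - 1 - s) = s by omega]
      · refine Or.inr ⟨hs, by have := hTs h; omega, ?_⟩
        rwa [show m + (s - m) = s by omega]

/-- The set of `m` columns in which row `i` is paired with column `i` if `i < r`, and with column
`i + s` otherwise. -/
def stepSet (m r s : ℕ) : Finset ℕ :=
  (Finset.range m).image fun i => if i < r then i else i + s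

theorem sort_stepSet (m r s : ℕ) :
    (stepSet m r s).sort = (List.range m).map fun i => if i < r then i else i + s := by
  refine sort_eq_of_pairwise ?_ fun x => ?_
  · rw [List.pairwise_map]
    refine List.pairwise_lt_range.imp fun {a b} h => ?_
    split_ifs <;> omega
  · simp [stepSet]

theorem sort_range (m : ℕ) : (Finset.range m).sort = List.range m :=
  sort_eq_of_pairwise List.pairwise_lt_range fun x => by simp

theorem card_stepSet (m r s : ℕ) : (stepSet m r s).card = m := by
  rw [← Finset.length_sort (· ≤ ·), sort_stepSet]
  simp

theorem stepSet_subset {m r s N : ℕ} (hs : s ≤ N) : stepSet m r s ⊆ Finset.range (m + N) := by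
  intro x hx
  rw [stepSet, Finset.mem_image] at hx
  obtain ⟨i, hi, rfl⟩ := hx
  rw [Finset.mem_range] at *
  split_ifs <;> omega

theorem pairing_map (l : List ℕ) (f : ℕ → ℕ) :
    pairing l (l.map f) = (l.map fun i => Finsupp.single (i, f i) (1 : ℤ)).sum := by
  induction l with
  | nil => rfl
  | cons i l ih => rw [List.map_cons, pairing, ih, List.map_cons, List.sum_cons]

theorem pairing_stepSet_apply {m r s i j : ℕ} (hi : i < m) :
    pairing (Finset.range m).sort (stepSet m r s).sort (i, i + j + 1) =
      if r ≤ i ∧ s = j + 1 then 1 else 0 := by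
  rw [sort_range, sort_stepSet, pairing_map]
  change (∑ i' ∈ Finset.range m, Finsupp.single (i', if i' < r then i' else i' + s) (1 : ℤ))
    (i, i + j + 1) = _
  rw [Finsupp.finsetSum_apply, Finset.sum_eq_single_of_mem i (Finset.mem_range.mpr hi)]
  · rw [Finsupp.single_apply]
    refine if_congr ?_ rfl rfl
    rw [Prod.mk.injEq]
    split_ifs <;> omega
  · intro i' _ hne
    rw [Finsupp.single_eq_of_ne]
    rw [ne_eq, Prod.mk.injEq]
    exact fun h => hne h.1.symm

/-- The denominators `u` of a product of fractions are collected on the right. -/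
theorem wordProd_mul_pow {R : Type*} [Ring R] [Algebra k R] {ι : Type*} {w p : ι → R} {u : R}
    (h : ∀ i, w i * u = p i) (hu : ∀ i, ScalarCommute k u (w i)) (l : List ι) :
    ∃ c : k, c ≠ 0 ∧ wordProd w l * u ^ l.length = c • wordProd p l := by
  have comm : ∀ l : List ι, ScalarCommute k u (wordProd w l) := by
    intro l
    induction l with
    | nil => exact ⟨1, one_ne_zero, by simp [wordProd]⟩
    | cons i l ih =>
      rw [wordProd_cons]
      exact (hu i).mul_right ih
  induction l with
  | nil => exact ⟨1, one_ne_zero, by simp [wordProd]⟩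
  | cons i l ih =>
    obtain ⟨c, hc, ih⟩ := ih
    obtain ⟨c', hc', h'⟩ := (comm l).symm
    refine ⟨c' * c, mul_ne_zero hc' hc, ?_⟩
    rw [wordProd_cons, List.length_cons, pow_succ', mul_assoc, ← mul_assoc _ u, h', smul_mul_assoc,
      mul_assoc u, ih, mul_smul_comm, mul_smul_comm, mul_smul_comm, smul_smul, ← mul_assoc, h,
      wordProd_cons]

/-- A minor of `y` is the image of an element of degree at most its size. -/
theorem mem_wordSpan_lift {R : Type*} [Ring R] [Algebra k R] {y : ℕ → ℕ → R}
    (hy : IsQMat q m N y) {c : List ℕ} (hc : ∀ j ∈ c, j < N) {I : Finset ℕ}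
    (hI : I ⊆ Finset.range m) :
    qdet q y c I ∈ (wordSpan k (matGen k q m N) c.length).map hy.lift.toLinearMap := by
  induction c generalizing I with
  | nil =>
    rw [qdet_nil]
    split_ifs
    · exact ⟨1, one_mem_wordSpan _ _, map_one hy.lift⟩
    · exact zero_mem _
  | cons j c ih =>
    rw [qdet_cons]
    refine Submodule.sum_mem _ fun i hi => Submodule.smul_mem _ _ ?_
    have him := Finset.mem_range.mp (hI hi)
    obtain ⟨z, hz, hz'⟩ := ih (fun j' hj' => hc j' (by simp [hj']))
      ((Finset.erase_subset i I).trans hI)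
    refine ⟨matGen k q m N (toLex (⟨i, him⟩, ⟨j, hc j (by simp)⟩)) * z, ?_, ?_⟩
    · rw [List.length_cons, Nat.add_comm]
      refine mul_mem_wordSpan (Submodule.subset_span ⟨[_], ?_, by simp [wordProd]; rfl⟩) hz
      simp
    · rw [← hz']
      simp [matGen, hy.lift_xGen]

/-- The exponents can be read off from the partial sums which occur in the leading monomials of
products of the minors with column sets `stepSet m r s`. -/
theorem eq_of_sum_le_eq {f g : Fin m → ℤ}
    (h : ∀ i : Fin m, ∑ r, (if r ≤ i then f r else 0) = ∑ r, (if r ≤ i then g r else 0)) :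
    f = g := by
  funext i
  induction i using WellFoundedLT.induction with
  | ind i ih =>
    have e : ∀ f : Fin m → ℤ, ∑ r, (if r ≤ i then f r else 0) =
        f i + ∑ r ∈ Finset.univ.filter (· < i), f r := by
      intro f
      rw [← Finset.sum_filter, ← Finset.sum_insert (by simp)]
      refine Finset.sum_congr ?_ fun _ _ => rfl
      ext r
      simp [le_iff_eq_or_lt]
    have := h i
    rw [e, e, Finset.sum_congr rfl fun r hr => ih r (Finset.mem_filter.mp hr).2] at this
    exact add_right_cancel this

/-- The quantum matrix whose minors are the quotients of the maximal minors satisfies no relations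
besides the defining ones. -/
theorem RotState.lift_injective (he : IsTwistedGroupFamily k e) (hq : q ≠ 0) (hm : 0 < m) {a : ℕ}
    {y : ℕ → ℕ → HahnSeries ℤ A} {P : Finset ℕ → HahnSeries ℤ A} (hy : RotState q m N a y P)
    (hP : ∀ K ⊆ Finset.range (m + N), K.card = m →
      HasLead k e matrixOrder (P K) (pairing (Finset.range m).sort K.sort)) :
    Function.Injective hy.qmat.lift := by
  -- the letters `some p` stand for maximal minors with multiplicatively independent leading
  -- monomials, the letter `none` for the minor on the first `m` columns
  set K : Option (Fin m ×ₗ Fin N) → Finset ℕ := fun o =>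
    o.elim (stepSet m 0 0) fun p => stepSet m (ofLex p).1 ((ofLex p).2 + 1) with hK
  have hKsub : ∀ o, K o ⊆ Finset.range (m + N) := by
    rintro (_ | p)
    · exact stepSet_subset (Nat.zero_le N)
    · exact stepSet_subset (ofLex p).2.2
  have hKcard : ∀ o, (K o).card = m := by
    rintro (_ | p) <;> exact card_stepSet _ _ _
  choose I J hI hJ hIJ hKIJ using fun o => exists_cycSet_eq (a := a) hm (hKsub o) (hKcard o)
  set w : Option (Fin m ×ₗ Fin N) → HahnSeries ℤ A := fun o => qdet q y (J o).sort (I o) with hw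
  have hwP : ∀ o, w o * P (cycSet (m + N) m a ∅ ∅) = P (K o) := by
    intro o
    rw [hw]
    simp only
    rw [hy.minor _ _ (hI o) (hJ o) (hIJ o), hKIJ]
  have hwmem : ∀ o, w o ∈ (wordSpan k (matGen k q m N) m).map hy.qmat.lift.toLinearMap := by
    intro o
    have hlen : (J o).sort.length ≤ m := by
      rw [Finset.length_sort, ← hIJ]
      simpa using Finset.card_le_card (hI o)
    exact Submodule.map_mono (wordSpan_mono _ hlen) (mem_wordSpan_lift hy.qmat
      (fun j hj => Finset.mem_range.mp (hJ o ((Finset.mem_sort _).mp hj))) (hI o))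
  choose z hz hzw using hwmem
  refine (quasiCommute_matGen hq m N).injective_of_growth mem_span_wordProd_matGen _
    (m * Fintype.card (Fin m ×ₗ Fin N)) fun L => ?_
  set E' : (Fin m ×ₗ Fin N → Fin (L + 1)) → (Fin m ×ₗ Fin N →₀ ℕ) := fun E =>
    Finsupp.equivFunOnFinite.symm fun p => (E p : ℕ) with hE'
  set D := Fintype.card (Fin m ×ₗ Fin N) * L with hD
  -- words of the same length `D`, filled up with the letter `none`
  set l : (Fin m ×ₗ Fin N → Fin (L + 1)) → List (Option (Fin m ×ₗ Fin N)) := fun E =>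
    (contentWord (E' E)).map some ++ List.replicate (D - (contentWord (E' E)).length) none with hl
  have hlen : ∀ E, (l E).length = D := by
    intro E
    have : (contentWord (E' E)).length ≤ D := by
      rw [← wordContent_degree, wordContent_contentWord, Finsupp.degree_eq_sum, hD,
        ← smul_eq_mul, ← Finset.card_univ]
      exact Finset.sum_le_card_nsmul _ _ _ fun p _ => Nat.lt_succ_iff.mp (E p).2
    simp only [hl, List.length_append, List.length_map, List.length_replicate]
    omega
  refine ⟨fun E => wordProd w (l E), ?_, fun E => ⟨wordProd z (l E), ?_, ?_⟩⟩
  · refine LinearIndependent.of_comp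
      (LinearMap.mulRight k (P (cycSet (m + N) m a ∅ ∅) ^ D)) ?_
    refine linearIndependent_of_hasLead he (d := matrixOrder) (v := fun E =>
      ((l E).map fun o => pairing (Finset.range m).sort (K o).sort).sum) ?_ ?_
    · intro E
      obtain ⟨c, hc, h⟩ := wordProd_mul_pow (k := k) hwP
        (fun o => hy.comm _ _ (hI o) (hJ o) (hIJ o)) (l E)
      rw [hlen] at h
      rw [Function.comp_apply, LinearMap.mulRight_apply, h]
      exact (HasLead.wordProd he (fun o => hP _ (hKsub o) (hKcard o)) _).smul hc
    · intro E₁ E₂ h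
      simp only [hl, List.map_append, List.map_map, List.map_replicate, List.sum_append,
        List.sum_replicate, sum_map_contentWord] at h
      funext p
      -- row `i` is paired with column `i + j + 1` by the step sets of `(r, j)` with `r ≤ i` only
      have coord : ∀ (E : Fin m ×ₗ Fin N → Fin (L + 1)) (c : ℕ) (i : Fin m) (j : Fin N),
          (∑ p, E' E p • ((fun o => pairing (Finset.range m).sort (K o).sort) ∘ some) p +
            c • pairing (Finset.range m).sort (K none).sort) (i.val, i.val + j.val + 1) =
          ∑ r, (if r ≤ i then ((E (toLex (r, j)) : ℕ) : ℤ) else 0) := by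
        intro E c i j
        have e0 : pairing (Finset.range m).sort (K none).sort (i.val, i.val + j.val + 1) = 0 := by
          simp only [hK, Option.elim_none]
          rw [pairing_stepSet_apply i.2, if_neg (by omega)]
        rw [Finsupp.add_apply, Finsupp.smul_apply, e0, smul_zero, add_zero,
          Finsupp.finsetSum_apply, ← (toLex (α := Fin m × Fin N)).sum_comp, Fintype.sum_prod_type]
        refine Finset.sum_congr rfl fun r _ => ?_
        rw [Finset.sum_eq_single_of_mem j (Finset.mem_univ j)]
        · simp only [hK, hE', Finsupp.smul_apply, Function.comp_apply, Option.elim_some,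
            ofLex_toLex]
          rw [pairing_stepSet_apply i.2]
          simp
        · intro j' _ hne
          simp only [hK, Finsupp.smul_apply, Function.comp_apply, Option.elim_some, ofLex_toLex]
          rw [pairing_stepSet_apply i.2, if_neg, smul_zero]
          rintro ⟨_, h⟩
          exact hne (Fin.ext (by omega))
      have := eq_of_sum_le_eq (f := fun r => ((E₁ (toLex (r, (ofLex p).2)) : ℕ) : ℤ))
        (g := fun r => ((E₂ (toLex (r, (ofLex p).2)) : ℕ) : ℤ)) fun i => by
          rw [← coord E₁ _ i, ← coord E₂ _ i, h]
      have := congrFun this (ofLex p).1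
      exact Fin.ext (by exact_mod_cast this)
  · have := wordProd_mem_wordSpan hz (l E)
    rwa [hlen, hD, ← mul_assoc] at this
  · have : (w : Option (Fin m ×ₗ Fin N) → HahnSeries ℤ A) = fun o => hy.qmat.lift (z o) :=
      funext fun o => (hzw o).symm
    simp only [AlgHom.toLinearMap_apply, wordProd, map_list_prod, List.map_map, this,
      Function.comp_def]

end Injectivity

/-! ### The dehomogenisation -/

section Dehomogenisation

/-- The index set `Q(I,J)` in terms of natural numbers. -/
theorem map_idxQ {m n : ℕ} (hmn : m ≤ n) (a : Fin n) (I : Finset (Fin m))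
    (J : Finset (Fin (n - m))) : (idxQ a I J).map Fin.valEmbedding =
      cycSet (m + (n - m)) m a (I.map Fin.valEmbedding) (J.map Fin.valEmbedding) := by
  have hI : ∀ i, i ∈ I.map Fin.valEmbedding ↔ ∃ h : i < m, ⟨i, h⟩ ∈ I := by
    intro i
    rw [Finset.mem_map]
    exact ⟨by rintro ⟨i, hi, rfl⟩; exact ⟨i.2, hi⟩, fun ⟨h, hi⟩ => ⟨_, hi, rfl⟩⟩
  have hJ : ∀ j, j ∈ J.map Fin.valEmbedding ↔ ∃ h : j < n - m, ⟨j, h⟩ ∈ J := by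
    intro j
    rw [Finset.mem_map]
    exact ⟨by rintro ⟨j, hj, rfl⟩; exact ⟨j.2, hj⟩, fun ⟨h, hj⟩ => ⟨_, hj, rfl⟩⟩
  ext x
  rw [mem_cycSet, Nat.add_sub_of_le hmn, Finset.mem_map]
  constructor
  · rintro ⟨c, hc, rfl⟩
    rcases Finset.mem_union.mp hc with hc | hc
    · obtain ⟨j, hj, rfl⟩ := Finset.mem_image.mp hc
      refine ⟨m + j, by omega, Or.inr ⟨by omega, ?_⟩, rfl⟩
      rw [hJ, Nat.add_sub_cancel_left]
      exact ⟨j.2, hj⟩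
    · obtain ⟨hc, hc'⟩ := Finset.mem_sdiff.mp hc
      obtain ⟨s, hs, rfl⟩ := Finset.mem_image.mp hc
      rw [Finset.mem_range] at hs
      refine ⟨s, by omega, Or.inl ⟨hs, fun h => hc' ?_⟩, rfl⟩
      rw [hI] at h
      obtain ⟨h, hi⟩ := h
      refine Finset.mem_image.mpr ⟨_, hi, ?_⟩
      simp only
      rw [show m - 1 - (m - 1 - s) = s by omega]
  · rintro ⟨s, hs, ⟨hsm, hsI⟩ | ⟨hsm, hsJ⟩, rfl⟩
    · refine ⟨cyc a s, Finset.mem_union_right _ (Finset.mem_sdiff.mpr ⟨?_, fun h => ?_⟩), rfl⟩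
      · exact Finset.mem_image.mpr ⟨s, Finset.mem_range.mpr hsm, rfl⟩
      · obtain ⟨i, hi, h⟩ := Finset.mem_image.mp h
        have := cyc_inj a (by omega) hs h
        refine hsI ((hI _).mpr ⟨by omega, ?_⟩)
        rwa [show (⟨m - 1 - s, by omega⟩ : Fin m) = i from Fin.ext (by simp only; omega)]
    · rw [hJ] at hsJ
      obtain ⟨h, hj⟩ := hsJ
      refine ⟨cyc a s, Finset.mem_union_left _ (Finset.mem_image.mpr ⟨_, hj, ?_⟩), rfl⟩
      simp only
      rw [show m + (s - m) = s by omega]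

theorem idxQ_empty {m n : ℕ} (a : Fin n) :
    idxQ a (∅ : Finset (Fin m)) (∅ : Finset (Fin (n - m))) = consec m a := by
  simp [idxQ, addedCols, removedCols]

variable {k : Type*} [Field k] {q : k} {R : Type*} [Ring R] [Algebra k R]

section Localisation

variable {B : Type*} [Ring B] [Algebra k B] (s : B) [IsNormalNonZeroDivisor s]

/-- An injective homomorphism which maps `s` to a unit extends to an injective homomorphism on the
localisation at `s`. -/
theorem exists_lift_loc (ψ : B →ₐ[k] R) (hψ : Function.Injective ψ) (hs : IsUnit (ψ s)) :
    ∃ Λ : Loc s →ₐ[k] R, Function.Injective Λ ∧ (∀ b, Λ (toLoc s b) = ψ b) ∧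
      Λ (invLoc s) * ψ s = 1 := by
  have hunit : ∀ x : Submonoid.powers s, IsUnit (ψ x) := by
    rintro ⟨_, d, rfl⟩
    simpa using hs.pow d
  set fS : Submonoid.powers s →* Rˣ :=
    IsUnit.liftRight ((ψ : B →* R).comp (Submonoid.powers s).subtype) hunit with hfS
  have hf : ∀ x : Submonoid.powers s, (ψ : B →+* R) x = fS x := fun x => rfl
  set Λ₀ : Loc s →+* R := OreLocalization.universalHom (ψ : B →+* R) fS hf with hΛ₀
  have h1 : ∀ b, Λ₀ (toLoc s b) = ψ b := fun b =>
    OreLocalization.universalHom_commutes (ψ : B →+* R) fS hf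
  refine ⟨{ Λ₀ with commutes' := fun r => ?_ }, ?_, h1, ?_⟩
  · have := (toLocHom k s).commutes r
    rw [toLocHom_apply] at this
    change Λ₀ _ = _
    rw [← this, h1, AlgHom.commutes]
  · change Function.Injective Λ₀
    rw [injective_iff_map_eq_zero]
    intro z hz
    induction z using OreLocalization.ind with
    | _ b x =>
      rw [hΛ₀, OreLocalization.universalHom_apply, Units.mul_right_eq_zero] at hz
      have : b = 0 := hψ (by rw [map_zero]; exact hz)
      rw [this, OreLocalization.zero_oreDiv]
  · change Λ₀ _ * _ = _
    rw [← h1, ← map_mul, invLoc_mul_toLoc, map_one]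

end Localisation

variable {m n N : ℕ}

theorem IsQMat.lift_maxMinor {X : ℕ → ℕ → R} (hX : IsQMat q m n X) (K : Finset (Fin n))
    (hK : K.card = m) : hX.lift (maxMinor q K hK) =
      qdet q X (K.map Fin.valEmbedding).sort (Finset.range m) := by
  rw [maxMinor, hX.lift_qMinor]
  congr 1
  ext x
  simp

theorem map_valEmbedding_subset {n : ℕ} (K : Finset (Fin n)) :
    K.map Fin.valEmbedding ⊆ Finset.range n := by
  intro x hx
  obtain ⟨c, _, rfl⟩ := Finset.mem_map.mp hx
  exact Finset.mem_range.mpr c.2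

/-- An element of the quantum grassmannian which commutes with the generators up to scalars is normal
and regular if it becomes invertible in some ring containing the quantum grassmannian. -/
theorem isNormalNonZeroDivisor_of_scalarCommute (ψ : qGrass q m n →ₐ[k] R)
    (hψ : Function.Injective ψ) {s : qGrass q m n} (hs : IsUnit (ψ s))
    (hcomm : ∀ (K : Finset (Fin n)) (hK : K.card = m), ScalarCommute k (ψ s) (ψ (plucker q K hK))) :
    IsNormalNonZeroDivisor s := by
  have key : ∀ b (hb : b ∈ qGrass q m n),
      (∃ c : qGrass q m n, s * ⟨b, hb⟩ = c * s) ∧ ∃ c : qGrass q m n, ⟨b, hb⟩ * s = s * c := by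
    intro b hb
    induction hb using Algebra.adjoin_induction with
    | mem b hb =>
      obtain ⟨K, hK, rfl⟩ := hb
      obtain ⟨c, _, h⟩ := hcomm K hK
      obtain ⟨c', _, h'⟩ := (hcomm K hK).symm
      refine ⟨⟨c • plucker q K hK, hψ ?_⟩, ⟨c' • plucker q K hK, hψ ?_⟩⟩
      · rw [map_mul, map_mul, map_smul, smul_mul_assoc]
        exact h
      · rw [map_mul, map_mul, map_smul, mul_smul_comm]
        exact h'
    | algebraMap r =>
      exact ⟨⟨algebraMap k _ r, (Algebra.commutes r s).symm⟩,
        ⟨algebraMap k _ r, Algebra.commutes r s⟩⟩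
    | add b c hb hc ihb ihc =>
      obtain ⟨⟨b₁, h₁⟩, ⟨b₂, h₂⟩⟩ := ihb
      obtain ⟨⟨c₁, h₃⟩, ⟨c₂, h₄⟩⟩ := ihc
      refine ⟨⟨b₁ + c₁, ?_⟩, ⟨b₂ + c₂, ?_⟩⟩
      · rw [add_mul, ← h₁, ← h₃, ← mul_add]
        rfl
      · rw [mul_add, ← h₂, ← h₄, ← add_mul]
        rfl
    | mul b c hb hc ihb ihc =>
      obtain ⟨⟨b₁, h₁⟩, ⟨b₂, h₂⟩⟩ := ihb
      obtain ⟨⟨c₁, h₃⟩, ⟨c₂, h₄⟩⟩ := ihc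
      refine ⟨⟨b₁ * c₁, ?_⟩, ⟨b₂ * c₂, ?_⟩⟩
      · rw [mul_assoc, ← h₃, ← mul_assoc, ← h₁, mul_assoc]
        rfl
      · rw [← mul_assoc, ← h₂, mul_assoc, ← h₄, ← mul_assoc]
        rfl
  refine ⟨?_, fun b hb => hψ ?_, fun b hb => hψ ?_⟩
  · ext z
    constructor
    · rintro ⟨b, rfl⟩
      obtain ⟨c, hc⟩ := (key b.1 b.2).1
      exact ⟨c, hc.symm⟩
    · rintro ⟨b, rfl⟩
      obtain ⟨c, hc⟩ := (key b.1 b.2).2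
      exact ⟨c, hc.symm⟩
  · rw [map_zero, ← hs.mul_right_eq_zero, ← map_mul, hb, map_zero]
  · rw [map_zero, ← hs.mul_left_eq_zero, ← map_mul, hb, map_zero]

theorem IsQMat.lift_mem {y : ℕ → ℕ → R} (hy : IsQMat q m N y) (S : Subalgebra k R)
    (hS : ∀ i j, i < m → j < N → y i j ∈ S) (z : QMat k q m N) : hy.lift z ∈ S := by
  induction mem_span_wordProd_matGen z using Submodule.span_induction with
  | mem z hz =>
    obtain ⟨l, rfl⟩ := hz
    rw [wordProd, map_list_prod, List.map_map]
    refine S.list_prod_mem fun z hz => ?_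
    obtain ⟨p, _, rfl⟩ := List.mem_map.mp hz
    rw [Function.comp_apply, matGen, hy.lift_xGen]
    exact hS _ _ (ofLex p).1.2 (ofLex p).2.2
  | zero => rw [map_zero]; exact S.zero_mem
  | add a b _ _ ha hb => rw [map_add]; exact S.add_mem ha hb
  | smul c a _ ha => rw [map_smul]; exact S.smul_mem ha c

/-- An element which commutes with the entries up to scalars can be moved past the subalgebra
generated by them. -/
theorem IsQMat.exists_mul_lift {y : ℕ → ℕ → R} (hy : IsQMat q m N y) {u : R}
    (hu : ∀ i j, i < m → j < N → ScalarCommute k u (y i j)) (z : QMat k q m N) :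
    ∃ z', u * hy.lift z = hy.lift z' * u := by
  induction mem_span_wordProd_matGen z using Submodule.span_induction with
  | mem z hz =>
    obtain ⟨l, rfl⟩ := hz
    induction l with
    | nil => exact ⟨1, by simp [wordProd]⟩
    | cons p l ih =>
      obtain ⟨z', hz'⟩ := ih
      obtain ⟨c, _, h⟩ := hu _ _ (ofLex p).1.2 (ofLex p).2.2
      refine ⟨c • (matGen k q m N p * z'), ?_⟩
      rw [wordProd_cons, map_mul, map_smul, map_mul, matGen, hy.lift_xGen, ← mul_assoc, h,
        smul_mul_assoc, mul_assoc, hz', smul_mul_assoc, mul_assoc]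
  | zero => exact ⟨0, by simp⟩
  | add a b _ _ ha hb =>
    obtain ⟨a', ha⟩ := ha
    obtain ⟨b', hb⟩ := hb
    exact ⟨a' + b', by rw [map_add, map_add, mul_add, add_mul, ha, hb]⟩
  | smul c a _ ha =>
    obtain ⟨a', ha⟩ := ha
    exact ⟨c • a', by rw [map_smul, map_smul, mul_smul_comm, smul_mul_assoc, ha]⟩

theorem qdet_singleton (y : ℕ → ℕ → R) (i j : ℕ) : qdet q y ({j} : Finset ℕ).sort {i} = y i j := by
  rw [Finset.sort_singleton, qdet_cons, Finset.sum_singleton,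
    Finset.filter_false_of_mem (by simp)]
  simp [qdet_nil]

/-- If the maximal minors of `X` are described by `y` from the first column `a`, then the quantum
matrix `y` gives the isomorphism onto the dehomogenisation at `[M]`. All algebras are compared inside
the ring `R` which contains the entries of `X` and `y`. -/
theorem RotState.isoDhom [NeZero m] (hmn : m ≤ n) (a : Fin n) {X y : ℕ → ℕ → R}
    (hX : IsQMat q m n X) (hinj : Function.Injective hX.lift)
    (hy : RotState q m (n - m) a y fun K => qdet q X K.sort (Finset.range m))
    (hinj' : Function.Injective hy.qmat.lift)
    (hu : IsUnit (qdet q X (cycSet (m + (n - m)) m a ∅ ∅).sort (Finset.range m))) :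
    ∃ _hM : IsNormalNonZeroDivisor (consecMinor q hmn a),
    ∃ ρ : QMat k q m (n - m) ≃ₐ[k] GrassDhom q hmn a,
      (∀ (i : Fin m) (j : Fin (n - m)),
        (ρ (xGen k q i j) : Loc (consecMinor q hmn a)) =
          curly q hmn a (idxQ a {i} {j}) (idxQ_card hmn a {i} {j} (by simp))) ∧
      (∀ (t : ℕ) (I : Finset (Fin m)) (J : Finset (Fin (n - m)))
        (hI : I.card = t) (hJ : J.card = t),
        (ρ (qMinor q I J hI hJ) : Loc (consecMinor q hmn a)) =
          curly q hmn a (idxQ a I J) (idxQ_card hmn a I J (hI.trans hJ.symm))) := by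
  have hm : 0 < m := NeZero.pos m
  set u : R := qdet q X (cycSet (m + (n - m)) m a ∅ ∅).sort (Finset.range m) with hu_def
  set ψ : qGrass q m n →ₐ[k] R := hX.lift.comp (qGrass q m n).val with hψ_def
  have hψ : Function.Injective ψ := hinj.comp Subtype.val_injective
  have hψK : ∀ (K : Finset (Fin n)) (hK : K.card = m), ψ (plucker q K hK) =
      qdet q X (K.map Fin.valEmbedding).sort (Finset.range m) := fun K hK => hX.lift_maxMinor K hK
  have hψs : ψ (consecMinor q hmn a) = u := by
    rw [consecMinor, hψK, ← idxQ_empty, map_idxQ hmn]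
    rfl
  -- every maximal minor is a multiple of `[M]` by a minor of `y`
  have hfactor : ∀ (K : Finset (Fin n)) (hK : K.card = m), ∃ w ∈ hy.qmat.lift.range,
      ScalarCommute k u w ∧ ψ (plucker q K hK) = w * u := by
    intro K hK
    obtain ⟨I, J, hI, hJ, hIJ, h⟩ := exists_cycSet_eq (N := n - m) (a := a) hm
      (K := K.map Fin.valEmbedding) (by rw [Nat.add_sub_of_le hmn]; exact map_valEmbedding_subset K)
      (by rw [Finset.card_map, hK])
    refine ⟨qdet q y J.sort I, ?_, hy.comm I J hI hJ hIJ, ?_⟩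
    · obtain ⟨z, _, hz⟩ := mem_wordSpan_lift hy.qmat
        (c := J.sort) (fun j hj => Finset.mem_range.mp (hJ ((Finset.mem_sort _).mp hj))) hI
      exact ⟨z, hz⟩
    · rw [hy.minor I J hI hJ hIJ, h, hψK]
  have hM : IsNormalNonZeroDivisor (consecMinor q hmn a) := by
    refine isNormalNonZeroDivisor_of_scalarCommute ψ hψ (by rwa [hψs]) fun K hK => ?_
    obtain ⟨w, _, hw, h⟩ := hfactor K hK
    rw [hψs, h]
    exact hw.mul_right (ScalarCommute.refl u)
  refine ⟨hM, ?_⟩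
  obtain ⟨Λ, hΛ, hΛB, hΛinv⟩ := exists_lift_loc (consecMinor q hmn a) ψ hψ (by rwa [hψs])
  set v := Λ (invLoc (consecMinor q hmn a)) with hv
  rw [hψs] at hΛinv
  have huv : u * v = 1 := by
    rw [← hψs, ← hΛB, hv, ← map_mul, toLoc_mul_invLoc, map_one]
  have hcurly : ∀ (K : Finset (Fin n)) (hK : K.card = m), Λ (curly q hmn a K hK) =
      qdet q X (K.map Fin.valEmbedding).sort (Finset.range m) * v := by
    intro K hK
    rw [curly, map_mul, hΛB, hψK]
  have hminor : ∀ (I : Finset (Fin m)) (J : Finset (Fin (n - m))) (h : I.card = J.card),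
      Λ (curly q hmn a (idxQ a I J) (idxQ_card hmn a I J h)) =
        qdet q y (J.map Fin.valEmbedding).sort (I.map Fin.valEmbedding) := by
    intro I J h
    rw [hcurly, map_idxQ hmn, ← hy.minor _ _ (map_valEmbedding_subset I)
      (map_valEmbedding_subset J) (by simpa using h), mul_assoc, huv, mul_one]
  have hentry : ∀ (i : Fin m) (j : Fin (n - m)),
      Λ (curly q hmn a (idxQ a {i} {j}) (idxQ_card hmn a {i} {j} (by simp))) = y i j := by
    intro i j
    rw [hminor {i} {j} (by simp), Finset.map_singleton, Finset.map_singleton, Fin.valEmbedding_apply,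
      Fin.valEmbedding_apply, qdet_singleton]
  have hentrycomm : ∀ i j, i < m → j < n - m → ScalarCommute k u (y i j) := by
    intro i j hi hj
    rw [← qdet_singleton (q := q) y i j]
    exact hy.comm {i} {j} (by simpa using hi) (by simpa using hj) (by simp)
  -- dividing a product of `d` maximal minors by the `d`-th power of `[M]` gives a polynomial in the
  -- entries of `y`
  have hpow : ∀ (d : ℕ) (b : qGrass q m n), b ∈ grassDeg q m n d →
      ψ b * v ^ d ∈ hy.qmat.lift.range := by
    intro d b hb
    unfold grassDeg at hb
    induction hb using Submodule.pow_induction_on_left' with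
    | algebraMap r =>
      rw [pow_zero, mul_one, AlgHom.commutes]
      exact Subalgebra.algebraMap_mem _ r
    | add b c i _ _ hb hc =>
      rw [map_add, add_mul]
      exact Subalgebra.add_mem _ hb hc
    | mem_mul b hb i c _ hc =>
      have hb' : ∃ w ∈ hy.qmat.lift.range, ψ b = w * u := by
        unfold pluckerSpan at hb
        induction hb using Submodule.span_induction with
        | mem b hb =>
          obtain ⟨K, hK, rfl⟩ := hb
          obtain ⟨w, hw, _, h⟩ := hfactor K hK
          exact ⟨w, hw, h⟩
        | zero => exact ⟨0, Subalgebra.zero_mem _, by rw [map_zero, zero_mul]⟩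
        | add b c _ _ hb hc =>
          obtain ⟨w, hw, h⟩ := hb
          obtain ⟨w', hw', h'⟩ := hc
          exact ⟨w + w', Subalgebra.add_mem _ hw hw', by rw [map_add, add_mul, h, h']⟩
        | smul r b _ hb =>
          obtain ⟨w, hw, h⟩ := hb
          exact ⟨r • w, Subalgebra.smul_mem _ hw r, by rw [map_smul, smul_mul_assoc, h]⟩
      obtain ⟨w, hw, h⟩ := hb'
      obtain ⟨z, hz⟩ : ∃ z, hy.qmat.lift z = ψ c * v ^ i := hc
      obtain ⟨z', hz'⟩ := hy.qmat.exists_mul_lift hentrycomm z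
      have : ψ (b * c) * v ^ (i + 1) = w * hy.qmat.lift z' := by
        rw [map_mul, h, pow_succ, mul_assoc, ← mul_assoc (ψ c), ← hz, mul_assoc w u,
          ← mul_assoc u, hz', mul_assoc (hy.qmat.lift z'), huv, mul_one]
      rw [this]
      exact Subalgebra.mul_mem _ hw ⟨z', rfl⟩
  have hrange : hy.qmat.lift.range = (GrassDhom q hmn a).map Λ := by
    apply le_antisymm
    · rintro _ ⟨z, rfl⟩
      refine hy.qmat.lift_mem _ (fun i j hi hj => ?_) z
      refine ⟨_, ⟨1, plucker q (idxQ a {⟨i, hi⟩} {⟨j, hj⟩}) (idxQ_card hmn a _ _ (by simp)),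
        plucker_mem q _ _, ?_⟩, hentry ⟨i, hi⟩ ⟨j, hj⟩⟩
      rw [pow_one, curly]
    · rintro _ ⟨_, ⟨d, b, hb, rfl⟩, rfl⟩
      have := hpow d b hb
      rwa [← hΛB, hv, ← map_pow, ← map_mul] at this
  set ρ : QMat k q m (n - m) ≃ₐ[k] GrassDhom q hmn a :=
    ((AlgEquiv.ofInjective hy.qmat.lift hinj').trans (Subalgebra.equivOfEq _ _ hrange)).trans
      ((GrassDhom q hmn a).equivMapOfInjective Λ hΛ).symm with hρ_def
  have hρ : ∀ z, Λ (ρ z : Loc (consecMinor q hmn a)) = hy.qmat.lift z := by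
    intro z
    rw [← Subalgebra.coe_equivMapOfInjective_apply _ Λ hΛ, hρ_def, AlgEquiv.trans_apply,
      AlgEquiv.apply_symm_apply]
    rfl
  refine ⟨ρ, fun i j => hΛ ?_, fun t I J hI hJ => hΛ ?_⟩
  · rw [hρ, hy.qmat.lift_xGen, hentry]
  · rw [hρ, hy.qmat.lift_qMinor, hminor I J (hI.trans hJ.symm)]

/-- If there are only `m` columns, then `[M]` is the only maximal minor. -/
theorem RotState.zero_columns {a : ℕ} (P : Finset ℕ → R) :
    RotState q m 0 a (fun _ _ => 0) P := by
  have h : ∀ I J : Finset ℕ, J ⊆ Finset.range 0 → I.card = J.card → I = ∅ ∧ J = ∅ := by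
    intro I J hJ hIJ
    have hJ : J = ∅ := by simpa using hJ
    exact ⟨Finset.card_eq_zero.mp (by rw [hIJ, hJ, Finset.card_empty]), hJ⟩
  refine ⟨by constructor <;> intros <;> omega, fun I J _ hJ hIJ => ?_, fun I J _ hJ hIJ => ?_⟩ <;>
  obtain ⟨rfl, rfl⟩ := h I J hJ hIJ <;> rw [Finset.sort_empty, qdet_nil, if_pos rfl]
  · exact one_mul _
  · exact (ScalarCommute.one_left _).symm

end Dehomogenisation

end QuantumGrassmannian

end

theorem mainTheorem3 {k : Type*} [Field k] (q : k) (hq : q ≠ 0) (m n : ℕ) [NeZero m]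
    (hmn : m ≤ n) (a : Fin n) :
    ∃ _hM : IsNormalNonZeroDivisor (consecMinor q hmn a),
    ∃ ρ : QMat k q m (n - m) ≃ₐ[k] GrassDhom q hmn a,
      (∀ (i : Fin m) (j : Fin (n - m)),
        (ρ (xGen k q i j) : Loc (consecMinor q hmn a)) =
          curly q hmn a (idxQ a {i} {j}) (idxQ_card hmn a {i} {j} (by simp))) ∧
      (∀ (t : ℕ) (I : Finset (Fin m)) (J : Finset (Fin (n - m)))
        (hI : I.card = t) (hJ : J.card = t),
        (ρ (qMinor q I J hI hJ) : Loc (consecMinor q hmn a)) =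
          curly q hmn a (idxQ a I J) (idxQ_card hmn a I J (hI.trans hJ.symm))) := by
  have hm : 0 < m := NeZero.pos m
  obtain ⟨A, _, _, e, he, hcomm⟩ := exists_isTwistedGroupFamily hq
  obtain ⟨X, hX, hlead⟩ := he.exists_isQMat hq hcomm m n
  have hn : m + (n - m) = n := Nat.add_sub_of_le hmn
  have hex : ∃ y, RotState q m (n - m) a y fun K : Finset ℕ =>
      qdet q X K.sort (Finset.range m) := by
    rcases Nat.eq_zero_or_pos (n - m) with h0 | hN
    · rw [h0]
      exact ⟨_, RotState.zero_columns _⟩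
    · exact hX.exists_rotState hq hm hn (fun I J hI hJ hIJ => (hlead I J hI hJ hIJ).isUnit he) hN a
  obtain ⟨y, hy⟩ := hex
  have hP : ∀ K ⊆ Finset.range (m + (n - m)), K.card = m →
      HasLead k e matrixOrder (qdet q X K.sort (Finset.range m))
        (pairing (Finset.range m).sort K.sort) := fun K hK hKm =>
    hlead _ K subset_rfl (hK.trans (by rw [hn])) (by rw [Finset.card_range, hKm])
  refine hy.isoDhom hmn a hX ?_ (hy.lift_injective he hq hm hP) ?_
  · refine hX.lift_injective he hq fun i j hi hj => ?_
    have := hlead {i} {j} (by simpa using hi) (by simpa using hj) (by simp)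
    rw [qdet_singleton] at this
    simpa [pairing] using this
  · have hcyc := map_idxQ hmn a (∅ : Finset (Fin m)) ∅
    rw [Finset.map_empty, Finset.map_empty] at hcyc
    rw [← hcyc]
    refine (hP _ ?_ ?_).isUnit he
    · rw [hn]
      exact map_valEmbedding_subset _
    · rw [Finset.card_map, idxQ_empty, consec_card hmn]
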